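/- For a probability space $\Omega$ let $L_1(\Omega,[0,1])$ be the space of $[0,1]$-valued random variables on $\Omega$ (modulo a.s. equality), viewed as a structure of continuous logic $(M,0,\neg,\tfrac12,\dot-)$ with the $L_1$ distance, where $\neg x=1-x$, $\tfrac12 x=x/2$ and $x\dot- y=\max(x-y,0)$. The models of the theory $ARV$ are the spaces $L_1(\Omega,[0,1])$ with $\Omega$ atomless. For a subset $A$ of such a model, $\sigma(A)$ denotes the least complete subalgebra of the probability algebra of $\Omega$ with respect to which every member of $A$ is measurable. For a complete subalgebra $\mathcal A$ of a probability algebra, an $n$-dimensional distribution over $\mathcal A$ is an $L_1(\mathcal A,[0,1])$-valued Borel measure $\vec\mu$ on $\mathbb R^n$ which is $\sigma$-additive in the $L_1$ topology and satisfies $\vec\mu(\mathbb R^n)=1$; $\mathfrak D_{[0,1]^n}(\mathcal A)$ is the set of those with $\vec\mu(\mathbb R^n\setminus[0,1]^n)=0$. The topology of weak convergence on it is the coarsest topology for which $\vec\mu\mapsto \mathbb E\bigl[Y\int\theta\,d\vec\mu\bigr]$ is continuous for all continuous $\theta\colon\mathbb R^n\to[0,1]$ and all $Y\in L_1(\mathcal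 A,[0,1])$. For an $n$-tuple $\bar X$ of random variables, $\operatorname{dist}(\bar X|\mathcal A)$ is the distribution $B\mapsto \mathbb P[\bar X\in B|\mathcal A]$ over $\mathcal A$. Theorem. Let $M$ be a model of $ARV$, $A\subseteq M$ and $n\in\mathbb N$. Let $S_n(A)$ be the space of types $\operatorname{tp}(\bar X/A)$ of $n$-tuples $\bar X$ in models $N\succeq M$ of $ARV$, with the logic topology (the coarsest one for which $p\mapsto\varphi^p$ is continuous for every formula $\varphi(\bar x)$ with parameters in $A$). For $\bar X$ in $N\succeq M$, identify the algebra $\sigma(A)$ computed in $N$ with $\sigma(A)$ computed in $M$ through the embedding $M\hookrightarrow N$. Then: 1. the joint conditional distribution $\operatorname{dist}(\bar X|\sigma(A))$ depends only on $\operatorname{tp}(\bar X/A)$; 2. the map $\zeta\colon\operatorname{tp}(\bar X/A)\mapsto\operatorname{dist}(\bar X|\sigma(A))$ is a homeomorphism from $S_n(A)$ with the logic topology onto $\mathfrak D_{[0,1]^n}(\sigma(A))$ with the topology of weak convergence. -/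

import Mathlib

open MeasureTheory Set
open scoped unitInterval symmDiff

universe u

namespace ARV

/-! ### Continuous logic in the language of random variable spaces -/

/-- Function symbols of the language: the constant `0`, the unary symbols `¬` and `½`, and the
binary symbol `∸` (truncated subtraction). -/
inductive Func : ℕ → Type
  | zero : Func 0
  | neg : Func 1
  | half : Func 1
  | tsub : Func 2

/-- The language of random variable spaces. Its only predicate symbol is the distance `d`, which is
built into the formulas of continuous logic below. -/
abbrev LRV : FirstOrder.Language := ⟨Func, fun _ => Empty⟩

/-- Formulas of continuous logic with free variables in `α`, together with `m` further variables
which are available for quantification: atomic formulas `d(s, t)`, continuous connectives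
`[0,1]^k → [0,1]`, and the quantifiers `sup` and `inf`. -/
inductive Formula (α : Type u) : ℕ → Type u
  | dist {m : ℕ} (s t : LRV.Term (α ⊕ Fin m)) : Formula α m
  | conn {m k : ℕ} (c : C(Fin k → I, I)) (φ : Fin k → Formula α m) : Formula α m
  | sup {m : ℕ} (φ : Formula α (m + 1)) : Formula α m
  | inf {m : ℕ} (φ : Formula α (m + 1)) : Formula α m

/-- The value in `[0,1]` of a formula in a metric structure `M` of diameter at most `1`. (The
projection to `[0,1]` changes nothing for such structures.) -/
noncomputable def Formula.eval {M : Type*} [LRV.Structure M] [MetricSpace M] {α : Type u}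
    (v : α → M) : {m : ℕ} → Formula α m → (Fin m → M) → I
  | _, .dist s t, x =>
      projIcc 0 1 zero_le_one (Dist.dist (s.realize (Sum.elim v x)) (t.realize (Sum.elim v x)))
  | _, .conn c φ, x => c fun i => (φ i).eval v x
  | _, .sup φ, x => ⨆ a : M, φ.eval v (Fin.snoc x a)
  | _, .inf φ, x => ⨅ a : M, φ.eval v (Fin.snoc x a)

/-- Elementary embeddings of metric structures. -/
structure ElemEmb (M N : Type*) [LRV.Structure M] [MetricSpace M] [LRV.Structure N]
    [MetricSpace N] where
  /-- The underlying map. -/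
  toFun : M → N
  elementary : ∀ (k : ℕ) (φ : Formula (Fin k) 0) (a : Fin k → M),
    φ.eval (fun i => toFun (a i)) Fin.elim0 = φ.eval a Fin.elim0

instance (M N : Type*) [LRV.Structure M] [MetricSpace M] [LRV.Structure N] [MetricSpace N] :
    CoeFun (ElemEmb M N) fun _ => M → N := ⟨ElemEmb.toFun⟩

/-! ### Spaces of random variables -/

/-- A measure is atomless if every measurable set of positive measure can be split into two
measurable pieces of positive measure. -/
def Atomless {Ω : Type*} [MeasurableSpace Ω] (P : Measure Ω) : Prop :=
  ∀ s, MeasurableSet s → 0 < P s → ∃ t ⊆ s, MeasurableSet t ∧ 0 < P t ∧ 0 < P (s \ t)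

section Space

variable {Ω : Type*} {𝒜 : MeasurableSpace Ω} [mΩ : MeasurableSpace Ω] (P : Measure Ω)
  [IsProbabilityMeasure P]

/-- The constant function `1` in `L₁(Ω)`. -/
noncomputable abbrev one : Lp ℝ 1 P := Lp.const 1 P 1

/-- The space `L₁(Ω,[0,1])` of all `[0,1]`-valued random variables up to almost sure equality, with
the `L₁` distance. (The order on `Lp` is the almost sure order.) -/
abbrev RVSpace : Type _ := {f : Lp ℝ 1 P // 0 ≤ f ∧ f ≤ one P}

theorem one_nonneg : (0 : Lp ℝ 1 P) ≤ one P := by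
  rw [← Lp.coeFn_le]
  filter_upwards [Lp.coeFn_zero ℝ 1 P, Lp.coeFn_const (p := 1) (μ := P) (1 : ℝ)] with ω h0 h1
  rw [h0, h1]
  simp

/-- The symbols are interpreted by pointwise composition: `¬x = 1 - x`, `½x = x / 2` and
`x ∸ y = max (x - y) 0`. -/
noncomputable instance : LRV.Structure (RVSpace P) where
  funMap
    | .zero, _ => ⟨0, le_rfl, one_nonneg P⟩
    | .neg, x => ⟨one P - (x 0).1, sub_nonneg.2 (x 0).2.2, sub_le_self _ (x 0).2.1⟩
    | .half, x => ⟨(1 / 2 : ℝ) • (x 0).1, by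
        have h0 := (x 0).2.1
        have h1 := (x 0).2.2
        rw [← Lp.coeFn_le] at h0 h1 ⊢
        rw [← Lp.coeFn_le]
        constructor
        · filter_upwards [h0, Lp.coeFn_zero ℝ 1 P, Lp.coeFn_smul (1 / 2 : ℝ) (x 0).1]
            with ω h0 hz hs
          simp only [hz, hs, Pi.smul_apply, smul_eq_mul, Pi.zero_apply] at h0 ⊢
          linarith
        · filter_upwards [h0, h1, Lp.coeFn_zero ℝ 1 P, Lp.coeFn_smul (1 / 2 : ℝ) (x 0).1]
            with ω h0 h1 hz hs
          simp only [hz, hs, Pi.smul_apply, smul_eq_mul, Pi.zero_apply] at h0 ⊢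
          linarith⟩
    | .tsub, x => ⟨((x 0).1 - (x 1).1) ⊔ 0, le_sup_right,
        sup_le ((sub_le_self _ (x 1).2.1).trans (x 0).2.2) (one_nonneg P)⟩
  RelMap r _ := r.elim

variable {P}

/-- The joint random variable `ω ↦ (X₀ ω, …, Xₙ₋₁ ω)` of a tuple. -/
noncomputable def joint {n : ℕ} (X : Fin n → RVSpace P) : Ω → Fin n → ℝ := fun ω i => (X i).1 ω

theorem measurable_joint {n : ℕ} (X : Fin n → RVSpace P) : Measurable (joint X) :=
  measurable_pi_lambda _ fun i => (Lp.stronglyMeasurable (X i).1).measurable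

/-- `σ(A)`: the least complete subalgebra of the probability algebra of `Ω` with respect to which
all `X ∈ A` are measurable. Complete subalgebras of the probability algebra are represented by
the `σ`-algebras of measurable sets that contain all measurable null sets. -/
@[reducible] def sigmaAlg (A : Set (RVSpace P)) : MeasurableSpace Ω :=
  MeasurableSpace.generateFrom
    ({s | MeasurableSet s ∧ P s = 0} ∪
      {s | ∃ X ∈ A, ∃ B : Set ℝ, MeasurableSet B ∧ s = X.1 ⁻¹' B})

theorem sigmaAlg_le (A : Set (RVSpace P)) : sigmaAlg A ≤ mΩ := by
  refine MeasurableSpace.generateFrom_le ?_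
  rintro s (hs | ⟨X, -, B, hB, rfl⟩)
  · exact hs.1
  · exact (Lp.stronglyMeasurable X.1).measurable hB

variable (P) (𝒜)

/-! ### Conditional distributions -/

/-- `𝔇_{ℝⁿ}(𝒜)`, the space of `n`-dimensional distributions over the subalgebra `𝒜` of the
probability algebra of `Ω`: Borel measures on `ℝⁿ` with values in `L₁(𝒜,[0,1])` that are
`σ`-additive in the `L₁` topology and have total mass `1`. -/
def CondDist (n : ℕ) : Type _ :=
  {μ : VectorMeasure (Fin n → ℝ) (Lp ℝ 1 P) //
    (∀ B, MeasurableSet B → (0 ≤ μ B ∧ μ B ≤ one P) ∧ AEStronglyMeasurable[𝒜] (μ B) P) ∧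
    μ univ = one P}

variable {P} {𝒜}

/-- The value `μ(B) ∈ L₁(Ω,[0,1])` of a conditional distribution at a set `B` (it is `0` if `B` is
not Borel). -/
noncomputable def CondDist.apply {n : ℕ} (μ : CondDist 𝒜 P n)
    (B : Set (Fin n → ℝ)) : RVSpace P :=
  ⟨μ.1 B, by
    by_cases hB : MeasurableSet B
    · exact (μ.2.1 B hB).1
    · rw [μ.1.not_measurable hB]
      exact ⟨le_rfl, one_nonneg P⟩⟩

/-- The topology of weak convergence: the coarsest topology for which all the maps
`μ ↦ E[Y ∫ θ dμ]` are continuous, where `θ : ℝⁿ → [0,1]` is continuous and `Y ∈ L₁(𝒜,[0,1])`. -/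
noncomputable instance {n : ℕ} : TopologicalSpace (CondDist 𝒜 P n) :=
  TopologicalSpace.induced
    (fun μ (p : C(Fin n → ℝ, I) × {Y : RVSpace P // AEStronglyMeasurable[𝒜] Y.1 P}) =>
      ∫ ω, p.2.1.1 ω * (∫ᵛ x, (p.1 x : ℝ) ∂•μ.1) ω ∂P)
    inferInstance

variable (P) (𝒜) in
/-- `𝔇_B(𝒜)`: the distributions over `𝒜` that are supported by `B`, as a subspace. -/
abbrev CondDistOn {n : ℕ} (B : Set (Fin n → ℝ)) : Type _ :=
  {μ : CondDist 𝒜 P n // μ.1 Bᶜ = 0}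

variable (𝒜) in
open ProbabilityTheory in
/-- The conditional probability `ℙ[S | 𝒜]` as an element of `L₁(Ω)`. -/
noncomputable def condProb (S : Set Ω) : Lp ℝ 1 P :=
  (integrable_condExp : Integrable (P⟦S | 𝒜⟧) P).toL1 _

variable (𝒜) in
open ProbabilityTheory in
theorem coeFn_condProb (S : Set Ω) :
    condProb (P := P) 𝒜 S =ᵐ[P] P⟦S | 𝒜⟧ := Integrable.coeFn_toL1 _

theorem condProb_eq (h𝒜 : 𝒜 ≤ mΩ) {S : Set Ω}
    (hS : MeasurableSet S) :
    condProb (P := P) 𝒜 S =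
      condExpL1CLM ℝ h𝒜 P (indicatorConstLp 1 hS (measure_ne_top P S) (1 : ℝ)) := by
  refine Lp.ext ((coeFn_condProb 𝒜 S).trans ?_)
  refine (condExp_congr_ae (indicatorConstLp_coeFn (p := 1) (hs := hS)
    (hμs := measure_ne_top P S)).symm).trans ?_
  refine (condExp_ae_eq_condExpL1 h𝒜 _).trans ?_
  rw [condExpL1_eq (L1.integrable_coeFn _), Integrable.toL1_coeFn]

theorem hasSum_indicator {f : ℕ → Set Ω} (hf : ∀ i, MeasurableSet (f i))
    (hd : Pairwise (Function.onFun Disjoint f)) :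
    HasSum (fun i => (indicatorConstLp 1 (hf i) (measure_ne_top P _) (1 : ℝ) : Lp ℝ 1 P))
      (indicatorConstLp 1 (MeasurableSet.iUnion hf) (measure_ne_top P _) (1 : ℝ)) := by
  have hm : ∀ s : Finset ℕ, MeasurableSet (⋃ i ∈ s, f i) := fun s =>
    s.measurableSet_biUnion fun i _ => hf i
  have key : ∀ s : Finset ℕ,
      ∑ i ∈ s, (indicatorConstLp 1 (hf i) (measure_ne_top P _) (1 : ℝ) : Lp ℝ 1 P) =
        indicatorConstLp 1 (hm s) (measure_ne_top P _) (1 : ℝ) := by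
    intro s
    induction s using Finset.induction_on with
    | empty => simp
    | insert a s ha ih =>
      rw [Finset.sum_insert ha, ih, ← indicatorConstLp_disjoint_union]
      · congr 1
        simp
      · rw [Set.disjoint_iUnion₂_right]
        intro i hi
        exact hd fun h => ha (h ▸ hi)
  unfold HasSum
  simp_rw [key]
  refine tendsto_indicatorConstLp_set ENNReal.one_ne_top ?_
  have hmono : Monotone fun s : Finset ℕ => ⋃ i ∈ s, f i := fun s t h =>
    biUnion_subset_biUnion_left h
  have hU : ⋃ s : Finset ℕ, ⋃ i ∈ s, f i = ⋃ i, f i := (iUnion_eq_iUnion_finset f).symm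
  have h1 := tendsto_measure_iUnion_atTop (μ := P) hmono
  rw [hU] at h1
  have h2 : ∀ s : Finset ℕ, P ((⋃ i ∈ s, f i) ∆ (⋃ i, f i)) = P (⋃ i, f i) - P (⋃ i ∈ s, f i) := by
    intro s
    have hsub : (⋃ i ∈ s, f i) ⊆ ⋃ i, f i := iUnion₂_subset fun i _ => subset_iUnion f i
    rw [symmDiff_of_le hsub, measure_sdiff hsub (hm s).nullMeasurableSet (measure_ne_top _ _)]
  simp_rw [h2]
  have h3 := ENNReal.Tendsto.sub (tendsto_const_nhds (x := P (⋃ i, f i))) h1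
    (Or.inl (measure_ne_top _ _))
  simpa using h3

/-- The joint conditional distribution `dist(X̄ | 𝒜)` of a tuple `X̄`, given by
`B ↦ ℙ[X̄ ∈ B | 𝒜]`. -/
noncomputable def condDist {n : ℕ} (X : Fin n → RVSpace P) (h𝒜 : 𝒜 ≤ mΩ) : CondDist 𝒜 P n := by
  classical
  exact ⟨{
    measureOf' := fun B => if MeasurableSet B then condProb 𝒜 (joint X ⁻¹' B) else 0
    empty' := by
      rw [if_pos MeasurableSet.empty, condProb_eq h𝒜 (measurable_joint X MeasurableSet.empty)]
      simp
    not_measurable' := fun B hB => if_neg hB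
    m_iUnion' := by
      intro f hf hd
      rw [if_pos (MeasurableSet.iUnion hf)]
      simp_rw [if_pos (hf _)]
      rw [condProb_eq h𝒜 (measurable_joint X (MeasurableSet.iUnion hf))]
      simp_rw [fun i => condProb_eq (P := P) h𝒜 (measurable_joint X (hf i)), preimage_iUnion]
      exact (hasSum_indicator (P := P) (fun i => measurable_joint X (hf i))
        (fun i j hij => (hd hij).preimage _)).mapL _ }, by
      refine ⟨fun B hB => ?_, ?_⟩
      · change (0 ≤ ite _ _ _ ∧ ite _ _ _ ≤ _) ∧ AEStronglyMeasurable[𝒜] (ite _ _ _ : Lp ℝ 1 P) P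
        simp only [if_pos hB]
        refine ⟨⟨?_, ?_⟩, ?_⟩
        · rw [← Lp.coeFn_le]
          have h := condExp_nonneg (μ := P) (m := 𝒜)
            (f := (joint X ⁻¹' B).indicator fun _ => (1 : ℝ))
            (Filter.Eventually.of_forall fun ω => indicator_nonneg (fun _ _ => zero_le_one) ω)
          filter_upwards [h, coeFn_condProb 𝒜 (joint X ⁻¹' B), Lp.coeFn_zero ℝ 1 P]
            with ω h1 h2 h3
          rw [h2, h3]
          exact h1
        · rw [← Lp.coeFn_le]
          have h := condExp_mono (μ := P) (m := 𝒜)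
            (f := (joint X ⁻¹' B).indicator fun _ => (1 : ℝ)) (g := fun _ => (1 : ℝ))
            ((integrable_const _).indicator (measurable_joint X hB)) (integrable_const _)
            (Filter.Eventually.of_forall fun ω =>
              indicator_le_self' (fun _ _ => zero_le_one) ω)
          rw [condExp_const h𝒜] at h
          filter_upwards [h, coeFn_condProb 𝒜 (joint X ⁻¹' B),
            Lp.coeFn_const (p := 1) (μ := P) (1 : ℝ)] with ω h1 h2 h3
          rw [h2, h3]
          exact h1
        · exact stronglyMeasurable_condExp.aestronglyMeasurable.congr (coeFn_condProb 𝒜 _).symm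
      · change ite _ _ _ = _
        rw [if_pos MeasurableSet.univ]
        refine Lp.ext ((coeFn_condProb 𝒜 _).trans ?_)
        rw [preimage_univ, indicator_univ, condExp_const h𝒜]
        exact (Lp.coeFn_const (p := 1) (μ := P) (1 : ℝ)).symm⟩

end Space

/-! ### Types -/

section Types

variable {Ω : Type u} [MeasurableSpace Ω] (P : Measure Ω) [IsProbabilityMeasure P]

/-- An elementary extension `N = L₁(Ω',[0,1])` of `M = L₁(Ω,[0,1])`, with `Ω'` an atomless
probability space. -/
structure Extension where
  /-- The underlying probability space of the extension. -/
  Ω' : Type u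
  [mΩ' : MeasurableSpace Ω']
  /-- Its probability measure. -/
  P' : Measure Ω'
  [prob : IsProbabilityMeasure P']
  atomless : Atomless P'
  /-- The elementary embedding. -/
  emb : ElemEmb (RVSpace P) (RVSpace P')

attribute [instance] Extension.mΩ' Extension.prob

variable {P}

/-- The type `tp(X̄/A)`, as the function that sends every formula `φ(x̄, ā)` with parameters in `A` to
its value `φ(X̄, ā)`. -/
noncomputable def tp (A : Set (RVSpace P)) (N : Extension P) {n : ℕ} (X : Fin n → RVSpace N.P') :
    Formula (A ⊕ Fin n) 0 → I :=
  fun φ => φ.eval (Sum.elim (fun a => N.emb a.1) X) Fin.elim0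

/-- The space `S_n(A)` of `n`-types over `A`: types of tuples in elementary extensions. Its topology
(the subspace topology of the product topology) is the logic topology, the coarsest one for which
`p ↦ φ^p` is continuous for every formula `φ` over `A`. -/
abbrev TypeSpace (A : Set (RVSpace P)) (n : ℕ) : Type _ :=
  {p : Formula (A ⊕ Fin n) 0 → I // ∃ (N : Extension P) (X : Fin n → RVSpace N.P'), tp A N X = p}

/-- The type of a tuple as a point of the type space. -/
noncomputable def tpPoint (A : Set (RVSpace P)) (N : Extension P) {n : ℕ}
    (X : Fin n → RVSpace N.P') : TypeSpace A n := ⟨tp A N X, N, X, rfl⟩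

/-- `dist(X̄ | σ(A))` for a tuple `X̄` in an elementary extension `N` of `M ⊇ A`, where `A` is viewed
as a subset of `N`. -/
noncomputable def distOver (A : Set (RVSpace P)) (N : Extension P) {n : ℕ}
    (X : Fin n → RVSpace N.P') : CondDist (sigmaAlg (N.emb '' A)) N.P' n :=
  condDist X (sigmaAlg_le _)

/-- A distribution over `σ(A)`, computed in `M`, and one over `σ(A)`, computed in an elementary
extension `N` of `M`, are the same: the embedding of `M` into `N` carries the values of the first to
the values of the second. -/
def SameDist {A : Set (RVSpace P)} {N : Extension P} {n : ℕ} (μ : CondDist (sigmaAlg A) P n)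
    (ν : CondDist (sigmaAlg (N.emb '' A)) N.P' n) : Prop :=
  ∀ B, N.emb (μ.apply B) = ν.apply B

end Types

end ARV

/-!
Write `L₁(𝒜)` for the set of `𝒜`-measurable elements of `L₁(Ω,[0,1])`. The proof compares types and
conditional distributions through the joint laws of finite tuples.

*Laws and formulas.* Terms are evaluated pointwise, and on the cube they approximate every
continuous function uniformly (`exists_term_approx`, from the lattice form of the Stone-Weierstrass
theorem). Hence expectations of terms, which are values of formulas, determine the joint law of a
tuple. Conversely, over atomless spaces the value of a formula depends only on the joint law
(`eval_eq_of_law_eq`). This quantifier elimination is a back-and-forth argument: a rounded copy of a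
tuple can be extended by a further random variable with any prescribed coupling
(`Atomless.exists_coupling`, `exists_extend_law`), and formulas are uniformly continuous. Thus
elementary embeddings preserve joint laws (`ElemEmb.lawPreserving`), and maps that preserve joint
laws are elementary.

*Parameters.* `L₁(σ(A))` is contained in every closed substructure that contains `A`
(`IsClosedSub.mem_of_sigmaAlg`). So an elementary embedding `f` identifies `L₁(σ(A))` with
`L₁(σ(f(A)))`, which transports distributions (`LawPreserving.exists_represents`), and the terms in
elements of `A` are dense in `L₁(σ(A))` (`mem_closure_range_realize`). A distribution `μ` over
`σ(A)` is handled through the scalar measures `B ↦ E[Y μ(B)]` with `Y` in `L₁(σ(A))`, see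
`weighted`. For the conditional distribution of `X̄` these are `B ↦ E[f(Y) 1_{X̄ ∈ B}]`, see
`Represents`.

*Bijectivity.* For continuous `θ` and `Y` in `L₁(σ(A))`, the function `tp(X̄/A) ↦ E[Y θ(X̄)]` is a
uniform limit of formulas (`exists_formula_approx`), so the type determines the conditional
distribution (`Represents.of_tp_eq`). Conversely, the conditional distribution determines the joint
law of `X̄` with finitely many parameters, and hence the type (`Represents.tp_eq`). Every
distribution on the cube occurs: the conditional quantile function, evaluated at an independent
uniform variable, realizes it in the extension `L₁(Ω × [0,1],[0,1])`
(`CondDist.exists_randomization`).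

*Bicontinuity.* Continuity of `ζ` is `exists_formula_approx` again. For the inverse, the parameters
and the variables are rounded to finitely many values, with cells whose boundaries are null for the
given tuple (`exists_rounding`). By the portmanteau argument the probabilities of the cells depend
continuously on the distribution (`eventually_abs_weighted_sub_le`). Tuples for which these
probabilities are close can be moved by little to tuples of the same law, by a maximal coupling
(`Atomless.exists_close`), so that formulas take close values at them
(`Represents.eventually_dist_tp_le`).
-/

universe v w

namespace ARV

/-! ### Random variables as functions to the unit interval -/

section Basic

variable {Ω : Type*} [mΩ : MeasurableSpace Ω] {P : Measure Ω} [IsProbabilityMeasure P]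

theorem ae_mem_Icc (x : RVSpace P) : ∀ᵐ ω ∂P, x.1 ω ∈ Icc (0 : ℝ) 1 := by
  have h0 := x.2.1
  have h1 := x.2.2
  rw [← Lp.coeFn_le] at h0 h1
  filter_upwards [h0, h1, Lp.coeFn_zero ℝ 1 P, Lp.coeFn_const (p := 1) (μ := P) (1 : ℝ)]
    with ω a b c d
  rw [c] at a
  rw [d] at b
  exact ⟨a, b⟩

/-- A representative of `x ∈ L₁(Ω,[0,1])` all of whose values lie in `[0,1]`. -/
noncomputable def rv (x : RVSpace P) (ω : Ω) : I := projIcc 0 1 zero_le_one (x.1 ω)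

@[fun_prop]
theorem measurable_rv (x : RVSpace P) : Measurable (rv x) :=
  continuous_projIcc.measurable.comp (Lp.stronglyMeasurable x.1).measurable

theorem coe_rv (x : RVSpace P) : ∀ᵐ ω ∂P, (rv x ω : ℝ) = x.1 ω := by
  filter_upwards [ae_mem_Icc x] with ω h
  rw [rv, projIcc_of_mem _ h]

theorem rv_ext {x y : RVSpace P} (h : rv x =ᵐ[P] rv y) : x = y := by
  refine Subtype.ext (Lp.ext ?_)
  filter_upwards [coe_rv x, coe_rv y, h] with ω a b c
  rw [← a, ← b, c]

theorem integrable_coe {f : Ω → I} (hf : Measurable f) : Integrable (fun ω => (f ω : ℝ)) P :=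
  Integrable.of_mem_Icc 0 1 (measurable_subtype_coe.comp hf).aemeasurable
    (Filter.Eventually.of_forall fun ω => (f ω).2)

/-- The element of `L₁(Ω,[0,1])` represented by a measurable function `Ω → [0,1]`. -/
noncomputable def ofRV (f : Ω → I) (hf : Measurable f) : RVSpace P :=
  ⟨(integrable_coe hf).toL1 _, by
    rw [← Lp.coeFn_le, ← Lp.coeFn_le]
    constructor
    · filter_upwards [Integrable.coeFn_toL1 (integrable_coe (P := P) hf), Lp.coeFn_zero ℝ 1 P]
        with ω a b
      rw [a, b]
      exact (f ω).2.1
    · filter_upwards [Integrable.coeFn_toL1 (integrable_coe (P := P) hf),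
        Lp.coeFn_const (p := 1) (μ := P) (1 : ℝ)] with ω a b
      rw [a, b]
      exact (f ω).2.2⟩

theorem coe_ofRV {f : Ω → I} (hf : Measurable f) :
    ∀ᵐ ω ∂P, (ofRV f hf : RVSpace P).1 ω = f ω :=
  Integrable.coeFn_toL1 (integrable_coe (P := P) hf)

theorem rv_ofRV {f : Ω → I} (hf : Measurable f) : rv (ofRV f hf : RVSpace P) =ᵐ[P] f := by
  filter_upwards [coe_ofRV (P := P) hf] with ω h
  rw [rv, h, projIcc_val]

theorem ofRV_congr {f g : Ω → I} {hf : Measurable f} {hg : Measurable g} (h : f =ᵐ[P] g) :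
    (ofRV f hf : RVSpace P) = ofRV g hg :=
  rv_ext (((rv_ofRV hf).trans h).trans (rv_ofRV hg).symm)

theorem dist_eq (x y : RVSpace P) : dist x y = ∫ ω, dist (rv x ω) (rv y ω) ∂P := by
  rw [Subtype.dist_eq, dist_eq_norm, L1.norm_eq_integral_norm]
  refine integral_congr_ae ?_
  filter_upwards [coe_rv x, coe_rv y, Lp.coeFn_sub x.1 y.1] with ω a b c
  rw [c, Subtype.dist_eq, a, b, Real.dist_eq]
  rfl

theorem integrable_dist {f g : Ω → I} (hf : Measurable f) (hg : Measurable g) :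
    Integrable (fun ω => dist (f ω) (g ω)) P :=
  Integrable.of_mem_Icc 0 1 (hf.dist hg).aemeasurable
    (Filter.Eventually.of_forall fun ω =>
      ⟨dist_nonneg, Real.dist_le_of_mem_Icc_01 (f ω).2 (g ω).2⟩)

theorem dist_le_of_ae {x y : RVSpace P} {c : ℝ} (h : ∀ᵐ ω ∂P, dist (rv x ω) (rv y ω) ≤ c) :
    dist x y ≤ c := by
  rw [dist_eq]
  refine (integral_mono_ae (integrable_dist (measurable_rv x) (measurable_rv y))
    (integrable_const c) h).trans ?_
  simp

theorem dist_le_one (x y : RVSpace P) : dist x y ≤ 1 :=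
  dist_le_of_ae <| Filter.Eventually.of_forall fun ω =>
    Real.dist_le_of_mem_Icc_01 (rv x ω).2 (rv y ω).2

/-- The unit interval as a structure in the language of random variable spaces; the space
`L₁(Ω,[0,1])` carries the pointwise operations. -/
noncomputable instance : LRV.Structure I where
  funMap
    | .zero, _ => 0
    | .neg, x => σ (x 0)
    | .half, x => ⟨(x 0 : ℝ) / 2, by
        have := (x 0).2.1; have := (x 0).2.2; constructor <;> linarith⟩
    | .tsub, x => ⟨max ((x 0 : ℝ) - x 1) 0, le_max_right _ _, by
        have := (x 0).2.2; have := (x 1).2.1; simp; linarith⟩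
  RelMap r _ := r.elim

/-- The constant symbol `0` as an element of a structure. -/
abbrev zeroOp {M : Type*} [LRV.Structure M] : M :=
  FirstOrder.Language.Structure.funMap (L := LRV) Func.zero Fin.elim0

theorem rv_funMap {k : ℕ} (f : Func k) (x : Fin k → RVSpace P) :
    ∀ᵐ ω ∂P, rv (FirstOrder.Language.Structure.funMap (L := LRV) f x) ω =
      FirstOrder.Language.Structure.funMap (L := LRV) f fun i => rv (x i) ω := by
  suffices h : ∀ᵐ ω ∂P, (FirstOrder.Language.Structure.funMap (L := LRV) f x : RVSpace P).1 ω =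
      (FirstOrder.Language.Structure.funMap (L := LRV) f fun i => rv (x i) ω : I) by
    filter_upwards [h] with ω h
    rw [rv, h, projIcc_val]
  cases f with
  | zero => exact Lp.coeFn_zero ℝ 1 P
  | neg =>
    filter_upwards [Lp.coeFn_sub (one P) (x 0).1, Lp.coeFn_const (p := 1) (μ := P) (1 : ℝ),
      coe_rv (x 0)] with ω a b c
    refine a.trans ?_
    rw [Pi.sub_apply, b, ← c]
    rfl
  | half =>
    filter_upwards [Lp.coeFn_smul (1 / 2 : ℝ) (x 0).1, coe_rv (x 0)] with ω a c
    refine a.trans ?_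
    rw [Pi.smul_apply, ← c]
    change (1 / 2 : ℝ) * _ = _ / 2
    ring
  | tsub =>
    filter_upwards [Lp.coeFn_sup ((x 0).1 - (x 1).1) 0, Lp.coeFn_sub (x 0).1 (x 1).1,
      Lp.coeFn_zero ℝ 1 P, coe_rv (x 0), coe_rv (x 1)] with ω a b c d e
    refine a.trans ?_
    rw [Pi.sup_apply, b, Pi.sub_apply, c, ← d, ← e]
    rfl

/-- Terms are evaluated pointwise in `L₁(Ω,[0,1])`. -/
theorem rv_realize {α : Type*} (t : LRV.Term α) (X : α → RVSpace P) :
    ∀ᵐ ω ∂P, rv (t.realize X) ω = t.realize fun i => rv (X i) ω := by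
  induction t with
  | var i => exact Filter.Eventually.of_forall fun ω => rfl
  | func f ts ih =>
    filter_upwards [rv_funMap f fun i => (ts i).realize X, ae_all_iff.2 ih] with ω a b
    refine a.trans ?_
    simp only [b]
    rfl

theorem continuous_funMap {k : ℕ} (f : Func k) :
    Continuous fun x : Fin k → I => FirstOrder.Language.Structure.funMap (L := LRV) f x := by
  cases f with
  | zero => exact continuous_const
  | neg => exact unitInterval.continuous_symm.comp (continuous_apply 0)
  | half =>
    exact Continuous.subtype_mk (f := fun x : Fin 1 → I => (x 0 : ℝ) / 2) (by fun_prop) _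
  | tsub =>
    exact Continuous.subtype_mk (f := fun x : Fin 2 → I => max ((x 0 : ℝ) - x 1) 0)
      (by fun_prop) _

@[fun_prop]
theorem continuous_realize {α : Type*} (t : LRV.Term α) :
    Continuous fun x : α → I => t.realize x := by
  induction t with
  | var i => exact continuous_apply i
  | func f ts ih => exact (continuous_funMap f).comp (continuous_pi ih)

/-- The distance of a random variable to `0` is its expectation. -/
theorem dist_zeroOp (x : RVSpace P) : dist x zeroOp = ∫ ω, (rv x ω : ℝ) ∂P := by
  rw [dist_eq]
  refine integral_congr_ae ?_
  filter_upwards [rv_funMap (P := P) Func.zero Fin.elim0] with ω h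
  rw [h, Subtype.dist_eq]
  change dist (rv x ω : ℝ) 0 = _
  rw [Real.dist_eq, sub_zero, abs_of_nonneg (rv x ω).2.1]

/-- The joint law of a tuple of random variables. -/
noncomputable def law {ι : Type*} (X : ι → RVSpace P) : Measure (ι → I) :=
  P.map fun ω i => rv (X i) ω

theorem measurable_rv_pi {ι : Type*} (X : ι → RVSpace P) : Measurable fun ω i => rv (X i) ω :=
  measurable_pi_lambda _ fun i => measurable_rv (X i)

instance {ι : Type*} (X : ι → RVSpace P) : IsProbabilityMeasure (law X) :=
  Measure.isProbabilityMeasure_map (measurable_rv_pi X).aemeasurable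

end Basic

/-! ### Uniform approximation of continuous functions by terms -/

section Approx

variable {ι : Type*}

/-- The real-valued function `f` on the cube is a uniform limit of functions given by terms. -/
def TermApprox (f : (ι → I) → ℝ) : Prop :=
  ∀ ε > 0, ∃ t : LRV.Term ι, ∀ x : ι → I, |((t.realize x : I) : ℝ) - f x| ≤ ε

theorem TermApprox.of_forall {f : (ι → I) → ℝ}
    (h : ∀ ε > 0, ∃ g, TermApprox g ∧ ∀ x, |g x - f x| ≤ ε) : TermApprox f := by
  intro ε hε
  obtain ⟨g, hg, hgf⟩ := h (ε / 2) (by positivity)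
  obtain ⟨t, ht⟩ := hg (ε / 2) (by positivity)
  refine ⟨t, fun x => (abs_sub_le _ (g x) _).trans ?_⟩
  linarith [ht x, hgf x]

theorem termApprox_coord (i : ι) : TermApprox fun x : ι → I => (x i : ℝ) :=
  fun ε hε => ⟨.var i, fun x => by simpa using hε.le⟩

theorem termApprox_zero : TermApprox fun _ : ι → I => 0 := fun ε hε =>
  ⟨.func Func.zero Fin.elim0, fun x => by
    change |((0 : I) : ℝ) - 0| ≤ ε
    simpa using hε.le⟩

theorem TermApprox.neg {f : (ι → I) → ℝ} (hf : TermApprox f) : TermApprox fun x => 1 - f x := by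
  intro ε hε
  obtain ⟨t, ht⟩ := hf ε hε
  refine ⟨FirstOrder.Language.Functions.apply₁ (L := LRV) Func.neg t, fun x => ?_⟩
  rw [FirstOrder.Language.Term.realize_functions_apply₁]
  have h := ht x
  change |(1 - ((t.realize x : I) : ℝ)) - (1 - f x)| ≤ ε
  rwa [sub_sub_sub_cancel_left, abs_sub_comm]

theorem TermApprox.half {f : (ι → I) → ℝ} (hf : TermApprox f) : TermApprox fun x => f x / 2 := by
  intro ε hε
  obtain ⟨t, ht⟩ := hf ε hε
  refine ⟨FirstOrder.Language.Functions.apply₁ (L := LRV) Func.half t, fun x => ?_⟩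
  rw [FirstOrder.Language.Term.realize_functions_apply₁]
  have h := ht x
  change |((t.realize x : I) : ℝ) / 2 - f x / 2| ≤ ε
  rw [abs_le] at h ⊢
  constructor <;> linarith

theorem TermApprox.tsub {f g : (ι → I) → ℝ} (hf : TermApprox f) (hg : TermApprox g) :
    TermApprox fun x => max (f x - g x) 0 := by
  intro ε hε
  obtain ⟨t, ht⟩ := hf (ε / 2) (by positivity)
  obtain ⟨s, hs⟩ := hg (ε / 2) (by positivity)
  refine ⟨FirstOrder.Language.Functions.apply₂ (L := LRV) Func.tsub t s, fun x => ?_⟩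
  rw [FirstOrder.Language.Term.realize_functions_apply₂]
  change |max (((t.realize x : I) : ℝ) - s.realize x) 0 - max (f x - g x) 0| ≤ ε
  refine (abs_max_sub_max_le_abs _ _ _).trans ?_
  have h1 := abs_le.1 (ht x)
  have h2 := abs_le.1 (hs x)
  rw [abs_le]
  constructor <;> linarith

/-- Truncation of a real number to `[0,1]`. -/
def clip (y : ℝ) : ℝ := max 0 (min 1 y)

theorem abs_clip_sub_clip_le (y z : ℝ) : |clip y - clip z| ≤ |y - z| := by
  unfold clip
  rw [max_comm 0, max_comm 0, min_comm 1, min_comm 1]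
  exact (abs_max_sub_max_le_abs _ _ _).trans (abs_min_sub_min_le_max _ _ _ _ |>.trans (by simp))

/-- All integer translates of `g`, truncated to `[0,1]`, are uniform limits of terms. As opposed to
`TermApprox` itself, this property passes to sums. -/
def TermApproxZ (g : (ι → I) → ℝ) : Prop :=
  ∀ j : ℤ, TermApprox fun x => clip (g x + j)

theorem termApproxZ_zero : TermApproxZ fun _ : ι → I => 0 := by
  intro j
  rcases le_or_gt j 0 with h | h
  · have : (j : ℝ) ≤ 0 := by exact_mod_cast h
    convert termApprox_zero (ι := ι) using 2
    rw [zero_add, clip, min_eq_right (by linarith), max_eq_left this]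
  · have : (1 : ℝ) ≤ j := by exact_mod_cast h
    convert (termApprox_zero (ι := ι)).neg using 2
    rw [zero_add, clip, min_eq_left this]
    norm_num

/-- The formula `(y + h)♯ = (y + 1)♯ ∸ (¬y♯ ∸ h)` for the truncation `♯`. -/
theorem clip_add {y h : ℝ} (h0 : 0 ≤ h) (h1 : h ≤ 1) :
    clip (y + h) = max (clip (y + 1) - max (1 - clip y - h) 0) 0 := by
  unfold clip
  rcases le_total y (-1) with a | a
  · rw [min_eq_right (by linarith : y + h ≤ 1), max_eq_left (by linarith : y + h ≤ 0),
      min_eq_right (by linarith : y + 1 ≤ 1), max_eq_left (by linarith : y + 1 ≤ 0)]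
    rw [max_eq_right]
    have := le_max_right (1 - max 0 (min 1 y) - h) 0
    linarith
  rcases le_total y 0 with b | b
  · rw [min_eq_right (by linarith : y + h ≤ 1), min_eq_right (by linarith : y + 1 ≤ 1),
      max_eq_right (by linarith : 0 ≤ y + 1), min_eq_right (by linarith : y ≤ 1),
      max_eq_left b, max_eq_left (by linarith : 0 ≤ 1 - 0 - h), max_comm]
    ring_nf
  rcases le_total y 1 with c | c
  · rw [min_eq_left (by linarith : 1 ≤ y + 1), min_eq_right c, max_eq_right b,
      max_eq_right zero_le_one]
    rcases le_total (y + h) 1 with d | d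
    · rw [min_eq_right d, max_eq_right (by linarith : 0 ≤ y + h),
        max_eq_left (by linarith : 0 ≤ 1 - y - h), max_eq_left (by linarith)]
      ring
    · rw [min_eq_left d, max_eq_right (by linarith : 1 - y - h ≤ 0)]
      norm_num
  · rw [min_eq_left (by linarith : 1 ≤ y + 1), min_eq_left c, max_eq_right zero_le_one,
      min_eq_left (by linarith : 1 ≤ y + h), max_eq_right (by linarith : 1 - 1 - h ≤ 0)]
    norm_num

theorem TermApproxZ.add {g h : (ι → I) → ℝ} (hg : TermApproxZ g) (hh : TermApprox h)
    (h01 : ∀ x, h x ∈ Icc (0 : ℝ) 1) : TermApproxZ fun x => g x + h x := by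
  intro j
  convert (hg (j + 1)).tsub ((hg j).neg.tsub hh) using 2 with x
  rw [add_right_comm, clip_add (h01 x).1 (h01 x).2]
  push_cast
  rw [add_assoc]

theorem TermApproxZ.sub {g h : (ι → I) → ℝ} (hg : TermApproxZ g) (hh : TermApprox h)
    (h01 : ∀ x, h x ∈ Icc (0 : ℝ) 1) : TermApproxZ fun x => g x - h x := by
  intro j
  convert hg.add hh.neg (fun x => ⟨sub_nonneg.2 (h01 x).2, sub_le_self _ (h01 x).1⟩) (j - 1)
    using 3 with x
  push_cast
  ring

theorem TermApproxZ.add_zsmul {g h : (ι → I) → ℝ} (hg : TermApproxZ g) (hh : TermApprox h)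
    (h01 : ∀ x, h x ∈ Icc (0 : ℝ) 1) (N : ℤ) : TermApproxZ fun x => g x + N * h x := by
  induction N using Int.induction_on with
  | zero => simpa using hg
  | succ n ih =>
    convert ih.add hh h01 using 2
    push_cast
    ring
  | pred n ih =>
    convert ih.sub hh h01 using 2
    push_cast
    ring

theorem TermApprox.div_two_pow {f : (ι → I) → ℝ} (hf : TermApprox f) (m : ℕ) :
    TermApprox fun x => f x / 2 ^ m := by
  induction m with
  | zero => simpa using hf
  | succ m ih =>
    convert ih.half using 2
    rw [pow_succ, div_div]

/-- The real coefficients `a` and `b` are replaced by dyadic ones, `⌊2ᵐ a⌋ / 2ᵐ` and `⌊2ᵐ b⌋ / 2ᵐ`.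
This turns `a + b h` into an integer combination of the functions `2⁻ᵐ` and `2⁻ᵐ h`, which are
obtained by repeated halving. -/
theorem TermApprox.clip_affine {h : (ι → I) → ℝ} (hh : TermApprox h)
    (h01 : ∀ x, h x ∈ Icc (0 : ℝ) 1) (a b : ℝ) : TermApprox fun x => clip (a + b * h x) := by
  refine TermApprox.of_forall fun ε hε => ?_
  obtain ⟨m, hm⟩ := exists_pow_lt_of_lt_one (half_pos hε) (by norm_num : (1 / 2 : ℝ) < 1)
  have hpos : (0 : ℝ) < 2 ^ m := by positivity
  have hle : (1 : ℝ) ≤ 2 ^ m := one_le_pow₀ one_le_two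
  have h1 := ((termApprox_zero (ι := ι)).neg.div_two_pow m)
  have h2 := hh.div_two_pow m
  have key := (termApproxZ_zero.add_zsmul h1 (fun x => ⟨by positivity, by
    rw [sub_zero]; exact div_le_one_of_le₀ hle hpos.le⟩) ⌊2 ^ m * a⌋).add_zsmul h2
    (fun x => ⟨div_nonneg (h01 x).1 hpos.le,
      div_le_one_of_le₀ ((h01 x).2.trans hle) hpos.le⟩) ⌊2 ^ m * b⌋ 0
  refine ⟨_, key, fun x => (abs_clip_sub_clip_le _ _).trans ?_⟩
  have hx0 := (h01 x).1
  have hx1 := (h01 x).2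
  have ha := Int.floor_le (2 ^ m * a)
  have ha' := Int.lt_floor_add_one (2 ^ m * a)
  have hb := Int.floor_le (2 ^ m * b)
  have hb' := Int.lt_floor_add_one (2 ^ m * b)
  have e : 0 + (⌊2 ^ m * a⌋ : ℝ) * ((1 - 0) / 2 ^ m) + ⌊2 ^ m * b⌋ * (h x / 2 ^ m)
      + ((0 : ℤ) : ℝ) - (a + b * h x)
      = -(((2 ^ m * a - ⌊2 ^ m * a⌋) + (2 ^ m * b - ⌊2 ^ m * b⌋) * h x) * (1 / 2) ^ m) := by
    rw [one_div, inv_pow]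
    field_simp
    push_cast
    ring
  rw [e, abs_neg, abs_of_nonneg]
  · have : (2 ^ m * a - ⌊2 ^ m * a⌋) + (2 ^ m * b - ⌊2 ^ m * b⌋) * h x ≤ 2 := by
      nlinarith
    calc _ ≤ 2 * (1 / 2 : ℝ) ^ m := by gcongr
      _ ≤ ε := by linarith
  · have : 0 ≤ (2 ^ m * b - ⌊2 ^ m * b⌋) * h x := mul_nonneg (by linarith) hx0
    refine mul_nonneg (by linarith) (by positivity)

theorem clip_mem (y : ℝ) : clip y ∈ Icc (0 : ℝ) 1 :=
  ⟨le_max_left _ _, max_le zero_le_one (min_le_left _ _)⟩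

theorem clip_of_mem {y : ℝ} (hy : y ∈ Icc (0 : ℝ) 1) : clip y = y := by
  rw [clip, min_eq_right hy.2, max_eq_right hy.1]

theorem clip_mono : Monotone clip := fun _ _ h => max_le_max le_rfl (min_le_min le_rfl h)

theorem TermApprox.clip_min {f g : (ι → I) → ℝ} (hf : TermApprox fun x => clip (f x))
    (hg : TermApprox fun x => clip (g x)) : TermApprox fun x => clip (min (f x) (g x)) := by
  convert hf.tsub (hf.tsub hg) using 2 with x
  have h1 := (clip_mem (f x)).1
  have h2 := (clip_mem (g x)).1
  rw [clip_mono.map_min]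
  rcases le_total (clip (f x)) (clip (g x)) with h | h
  · rw [min_eq_left h, max_eq_right (by linarith : clip (f x) - clip (g x) ≤ 0),
      max_eq_left (by linarith), sub_zero]
  · rw [min_eq_right h, max_eq_left (by linarith : 0 ≤ clip (f x) - clip (g x)),
      max_eq_left (by linarith)]
    ring

theorem TermApprox.clip_max {f g : (ι → I) → ℝ} (hf : TermApprox fun x => clip (f x))
    (hg : TermApprox fun x => clip (g x)) : TermApprox fun x => clip (max (f x) (g x)) := by
  have e : ∀ x : ι → I, clip (1 - clip (f x)) = 1 - clip (f x) := fun x => clip_of_mem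
    ⟨sub_nonneg.2 (clip_mem _).2, sub_le_self _ (clip_mem _).1⟩
  have e' : ∀ x : ι → I, clip (1 - clip (g x)) = 1 - clip (g x) := fun x => clip_of_mem
    ⟨sub_nonneg.2 (clip_mem _).2, sub_le_self _ (clip_mem _).1⟩
  have h1 : TermApprox fun x : ι → I => clip (1 - clip (f x)) := by simpa only [e] using hf.neg
  have h2 : TermApprox fun x : ι → I => clip (1 - clip (g x)) := by simpa only [e'] using hg.neg
  convert (h1.clip_min h2).neg using 2 with x
  rw [clip_mono.map_min, e, e', min_sub_sub_left, clip_mono.map_max]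
  ring

/-- Every continuous function `[0,1]^ι → [0,1]` is a uniform limit of terms. Since terms are closed
under the lattice operations, this follows from the lattice version of the Stone-Weierstrass
theorem once the truncations of all affine functions of one coordinate are approximated. -/
theorem exists_term_approx {θ : (ι → I) → I} (hθ : Continuous θ) {ε : ℝ} (hε : 0 < ε) :
    ∃ t : LRV.Term ι, ∀ x : ι → I, dist (t.realize x) (θ x) ≤ ε := by
  let L : Set C(ι → I, ℝ) := {g | TermApprox fun x => clip (g x)}
  have hsep : L.SeparatesPointsStrongly := by
    intro v x y
    by_cases hxy : x = y
    · subst hxy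
      have hc : TermApprox fun _ : ι → I => clip (v x) := by
        simpa using (termApprox_zero (ι := ι)).clip_affine (by simp) (v x) 0
      exact ⟨ContinuousMap.const _ (v x), hc, rfl, rfl⟩
    · obtain ⟨i, hi⟩ := Function.ne_iff.1 hxy
      have hi' : (x i : ℝ) - y i ≠ 0 := sub_ne_zero.2 fun h => hi (Subtype.ext h)
      refine ⟨⟨fun z => (v x - (v x - v y) / (x i - y i) * x i)
        + (v x - v y) / (x i - y i) * z i, by fun_prop⟩,
        (termApprox_coord i).clip_affine (fun x => (x i).2) _ _, ?_, ?_⟩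
      · simp
      · simp only [ContinuousMap.coe_mk]
        field_simp
        ring
  have htop := ContinuousMap.sublattice_closure_eq_top L
    ⟨0, by simpa [L, clip] using termApprox_zero (ι := ι)⟩ (fun f hf g hg => hf.clip_min hg)
    (fun f hf g hg => hf.clip_max hg) hsep
  let F : C(ι → I, ℝ) := ⟨fun x => θ x, by fun_prop⟩
  have hF : F ∈ closure L := htop ▸ mem_univ _
  obtain ⟨g, hg, hgF⟩ := Metric.mem_closure_iff.1 hF (ε / 2) (by positivity)
  obtain ⟨t, ht⟩ := hg (ε / 2) (by positivity)
  refine ⟨t, fun x => ?_⟩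
  have h1 : |clip (g x) - θ x| ≤ ε / 2 := by
    rw [← clip_of_mem (θ x).2]
    refine (abs_clip_sub_clip_le _ _).trans ?_
    have := (ContinuousMap.dist_apply_le_dist (f := F) (g := g) x).trans hgF.le
    rwa [dist_comm, Real.dist_eq] at this
  rw [Subtype.dist_eq, Real.dist_eq]
  refine (abs_sub_le _ (clip (g x)) _).trans ?_
  linarith [ht x]

open BoundedContinuousFunction in
/-- Every bounded continuous function is an affine image of one with values in the unit interval. -/
theorem exists_affine_eq {E : Type*} [TopologicalSpace E] (f : E →ᵇ ℝ) :
    ∃ c : ℝ, 0 < c ∧ ∃ θ : C(E, I), ∀ x, f x = 2 * c * θ x - c := by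
  have hc : 0 < ‖f‖ + 1 := by positivity
  have hb : ∀ x, f x ∈ Icc (-(‖f‖ + 1)) (‖f‖ + 1) := fun x => by
    have h := abs_le.1 ((Real.norm_eq_abs _).symm.trans_le (f.norm_coe_le_norm x))
    constructor <;> linarith [h.1, h.2]
  refine ⟨‖f‖ + 1, hc, ⟨fun x => ⟨(f x + (‖f‖ + 1)) / (2 * (‖f‖ + 1)),
    div_nonneg (by linarith [(hb x).1]) (by linarith),
    (div_le_one (by linarith)).2 (by linarith [(hb x).2])⟩, by fun_prop⟩, fun x => ?_⟩
  simp only [ContinuousMap.coe_mk]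
  field_simp
  ring

/-- A finite measure is determined by the integrals of continuous functions with values in the unit
interval. -/
theorem measure_eq_of_integral_eq {E : Type*} [TopologicalSpace E] [HasOuterApproxClosed E]
    [MeasurableSpace E] [BorelSpace E] {μ ν : Measure E} [IsFiniteMeasure μ] [IsFiniteMeasure ν]
    (h : ∀ θ : C(E, I), ∫ x, (θ x : ℝ) ∂μ = ∫ x, (θ x : ℝ) ∂ν) : μ = ν := by
  have huniv : μ.real univ = ν.real univ := by
    simpa using h (ContinuousMap.const _ 1)
  refine ext_of_forall_integral_eq_of_IsFiniteMeasure fun f => ?_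
  obtain ⟨c, hc0, θ, hθ⟩ := exists_affine_eq f
  have aux : ∀ ρ : Measure E, IsFiniteMeasure ρ →
      ∫ x, f x ∂ρ = 2 * c * ∫ x, (θ x : ℝ) ∂ρ - c * ρ.real univ := by
    intro ρ _
    simp only [hθ]
    rw [integral_sub ((Integrable.of_mem_Icc 0 1 (by fun_prop)
      (Filter.Eventually.of_forall fun x => (θ x).2)).const_mul _) (integrable_const _),
      integral_const_mul, integral_const, smul_eq_mul, mul_comm c]
  rw [aux μ inferInstance, aux ν inferInstance, h θ, huniv]

/-- The law of a finite tuple is determined by the expectations of terms. -/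
theorem measure_eq_of_terms [Finite ι] {μ ν : Measure (ι → I)} [IsProbabilityMeasure μ]
    [IsProbabilityMeasure ν]
    (h : ∀ t : LRV.Term ι, ∫ x, ((t.realize x : I) : ℝ) ∂μ = ∫ x, ((t.realize x : I) : ℝ) ∂ν) :
    μ = ν := by
  have key : ∀ θ : (ι → I) → I, Continuous θ → ∫ x, (θ x : ℝ) ∂μ = ∫ x, (θ x : ℝ) ∂ν := by
    intro θ hθ
    refine eq_of_forall_dist_le fun ε hε => ?_
    obtain ⟨t, ht⟩ := exists_term_approx hθ (half_pos hε)
    have aux : ∀ ρ : Measure (ι → I), IsProbabilityMeasure ρ →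
        |∫ x, (θ x : ℝ) ∂ρ - ∫ x, ((t.realize x : I) : ℝ) ∂ρ| ≤ ε / 2 := by
      intro ρ _
      rw [← integral_sub (integrable_coe hθ.measurable)
        (integrable_coe (continuous_realize t).measurable), ← Real.norm_eq_abs]
      refine (norm_integral_le_of_norm_le_const (μ := ρ) (C := ε / 2)
        (Filter.Eventually.of_forall fun x => ?_)).trans
        (by simp : ε / 2 * ρ.real univ ≤ ε / 2)
      have := ht x
      rwa [dist_comm, Subtype.dist_eq, Real.dist_eq, ← Real.norm_eq_abs] at this
    have h1 := aux μ inferInstance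
    have h2 := aux ν inferInstance
    rw [h t] at h1
    rw [Real.dist_eq]
    rw [abs_sub_comm] at h2
    refine (abs_sub_le _ _ _).trans (add_le_add h1 h2) |>.trans ?_
    linarith
  exact measure_eq_of_integral_eq fun θ => key θ θ.continuous

theorem integral_law {Ω : Type*} [MeasurableSpace Ω] {P : Measure Ω}
    [IsProbabilityMeasure P] (X : ι → RVSpace P) {θ : (ι → I) → I} (hθ : Measurable θ) :
    ∫ x, (θ x : ℝ) ∂(law X) = ∫ ω, (θ fun i => rv (X i) ω : ℝ) ∂P :=
  integral_map (measurable_rv_pi X).aemeasurable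
    (measurable_subtype_coe.comp hθ).aestronglyMeasurable

theorem dist_realize_zeroOp [Finite ι] {Ω : Type*} [MeasurableSpace Ω] {P : Measure Ω}
    [IsProbabilityMeasure P] (X : ι → RVSpace P) (t : LRV.Term ι) :
    dist (t.realize X) zeroOp = ∫ x, ((t.realize x : I) : ℝ) ∂(law X) := by
  rw [integral_law X (continuous_realize t).measurable, dist_zeroOp]
  refine integral_congr_ae ?_
  filter_upwards [rv_realize t X] with ω h
  rw [h]

/-- The joint law of a tuple in `L₁(Ω,[0,1])` is determined by the distances of terms to `0`, hence
by the quantifier-free formulas. -/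
theorem law_eq_of_terms [Finite ι] {Ω₁ Ω₂ : Type*} [MeasurableSpace Ω₁] [MeasurableSpace Ω₂]
    {P₁ : Measure Ω₁} {P₂ : Measure Ω₂} [IsProbabilityMeasure P₁] [IsProbabilityMeasure P₂]
    {X₁ : ι → RVSpace P₁} {X₂ : ι → RVSpace P₂}
    (h : ∀ t : LRV.Term ι, dist (t.realize X₁) zeroOp = dist (t.realize X₂) zeroOp) :
    law X₁ = law X₂ :=
  measure_eq_of_terms fun t => by rw [← dist_realize_zeroOp, ← dist_realize_zeroOp, h]

end Approx

/-! ### Atomless probability spaces -/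

section AtomlessSpace

variable {Ω : Type*} [mΩ : MeasurableSpace Ω] {P : Measure Ω} [IsProbabilityMeasure P]

/-- An atomless space has events of arbitrarily small positive probability: whenever an event is
split, one of the two parts has at most half of its probability. -/
theorem Atomless.exists_small (hP : Atomless P) {E : Set Ω} (hE : MeasurableSet E)
    (h : 0 < P.real E) {ε : ℝ} (hε : 0 < ε) :
    ∃ F ⊆ E, MeasurableSet F ∧ 0 < P.real F ∧ P.real F ≤ ε := by
  have halve : ∀ m : ℕ, ∃ F ⊆ E, MeasurableSet F ∧ 0 < P.real F ∧ P.real F ≤ (1 / 2) ^ m := by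
    intro m
    induction m with
    | zero => exact ⟨E, subset_rfl, hE, h, by simp⟩
    | succ m ih =>
      obtain ⟨F, hFE, hF, h0, hle⟩ := ih
      obtain ⟨t, htF, ht, ht0, ht1⟩ := hP F hF ((ENNReal.toReal_pos_iff.1 h0).1)
      have hadd := measureReal_inter_add_sdiff (μ := P) (s := F) ht
      rw [inter_eq_self_of_subset_right htF] at hadd
      rw [pow_succ]
      rcases le_total (P.real t) (P.real (F \ t)) with hc | hc
      · exact ⟨t, htF.trans hFE, ht, ENNReal.toReal_pos ht0.ne' (measure_ne_top P _), by linarith⟩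
      · exact ⟨F \ t, sdiff_subset.trans hFE, hF.diff ht,
          ENNReal.toReal_pos ht1.ne' (measure_ne_top P _), by linarith⟩
  obtain ⟨m, hm⟩ := exists_pow_lt_of_lt_one hε (by norm_num : (1 / 2 : ℝ) < 1)
  obtain ⟨F, h1, h2, h3, h4⟩ := halve m
  exact ⟨F, h1, h2, h3, h4.trans hm.le⟩

/-- Sierpiński's theorem: an atomless probability measure attains all intermediate values on the
subsets of a given set. The subset is exhausted greedily by pieces that are at least half as big
as possible. -/
theorem Atomless.exists_measureReal_eq (hP : Atomless P) {E : Set Ω} (hE : MeasurableSet E)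
    {p : ℝ} (hp0 : 0 ≤ p) (hp : p ≤ P.real E) :
    ∃ F ⊆ E, MeasurableSet F ∧ P.real F = p := by
  let V : Type _ := {F : Set Ω // F ⊆ E ∧ MeasurableSet F ∧ P.real F ≤ p}
  -- A set can be enlarged to one such that no admissible further piece is more than twice as big as
  -- the one that has been added.
  have step : ∀ F : V, ∃ F' : V, F.1 ⊆ F'.1 ∧ ∀ G ⊆ E \ F.1, MeasurableSet G →
      P.real F.1 + P.real G ≤ p → P.real G ≤ 2 * (P.real F'.1 - P.real F.1) := by
    rintro ⟨F, hFE, hF, hFp⟩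
    let S : Set ℝ := {r | ∃ G ⊆ E \ F, MeasurableSet G ∧ P.real F + P.real G ≤ p ∧ P.real G = r}
    have hbdd : BddAbove S := ⟨1, by rintro r ⟨G, -, -, -, rfl⟩; exact measureReal_le_one⟩
    have hmem : ∀ G ⊆ E \ F, MeasurableSet G → P.real F + P.real G ≤ p → P.real G ≤ sSup S :=
      fun G h1 h2 h3 => le_csSup hbdd ⟨G, h1, h2, h3, rfl⟩
    by_cases hS : sSup S ≤ 0
    · exact ⟨⟨F, hFE, hF, hFp⟩, subset_rfl, fun G h1 h2 h3 => by
        simpa using (hmem G h1 h2 h3).trans hS⟩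
    · have hne : S.Nonempty := ⟨0, ∅, empty_subset _, .empty, by simpa using hFp, by simp⟩
      obtain ⟨r, ⟨G, h1, h2, h3, rfl⟩, hr⟩ :=
        exists_lt_of_lt_csSup hne (half_lt_self (not_le.1 hS))
      have hd : Disjoint F G := (disjoint_sdiff_right.mono_right h1)
      have hU : P.real (F ∪ G) = P.real F + P.real G := measureReal_union hd h2
      refine ⟨⟨F ∪ G, union_subset hFE (h1.trans sdiff_subset), hF.union h2, hU.trans_le h3⟩,
        subset_union_left, fun G' h1' h2' h3' => ?_⟩
      have := hmem G' h1' h2' h3'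
      simp only [hU]
      linarith
  choose next hnext hgreedy using step
  let f : ℕ → V := fun n => next^[n] ⟨∅, empty_subset _, .empty, by simpa using hp0⟩
  have hf : ∀ n, f (n + 1) = next (f n) := fun n => Function.iterate_succ_apply' next n _
  have hmono : Monotone fun n => (f n).1 := monotone_nat_of_le_succ fun n => by
    rw [hf]; exact hnext _
  have hlim : Filter.Tendsto (fun n => P.real (f n).1) Filter.atTop
      (nhds (P.real (⋃ n, (f n).1))) :=
    (ENNReal.tendsto_toReal (measure_ne_top P _)).comp (tendsto_measure_iUnion_atTop hmono)
  have hUm : MeasurableSet (⋃ n, (f n).1) := .iUnion fun n => (f n).2.2.1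
  have hUE : (⋃ n, (f n).1) ⊆ E := iUnion_subset fun n => (f n).2.1
  have hUp : P.real (⋃ n, (f n).1) ≤ p := le_of_tendsto' hlim fun n => (f n).2.2.2
  refine ⟨_, hUE, hUm, le_antisymm hUp (not_lt.1 fun hlt => ?_)⟩
  have hpos : 0 < P.real (E \ ⋃ n, (f n).1) := by
    have := measureReal_inter_add_sdiff (μ := P) (s := E) hUm
    rw [inter_eq_self_of_subset_right hUE] at this
    linarith
  -- A small piece `G` outside of the union was available at each stage, so each stage added at
  -- least half of its measure.
  obtain ⟨G, hGE, hG, hG0, hGp⟩ := hP.exists_small (hE.diff hUm) hpos (sub_pos.2 hlt)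
  have hle : ∀ n, P.real G ≤ 2 * (P.real (f (n + 1)).1 - P.real (f n).1) := by
    intro n
    rw [hf]
    have hsub := subset_iUnion (fun n => (f n).1) n
    refine hgreedy (f n) G (hGE.trans (sdiff_subset_sdiff_right hsub)) hG ?_
    have : P.real (f n).1 ≤ P.real (⋃ n, (f n).1) := measureReal_mono hsub
    linarith
  have h0 := ((hlim.comp (Filter.tendsto_add_atTop_nat 1)).sub hlim).const_mul 2
  rw [sub_self, mul_zero] at h0
  exact absurd (ge_of_tendsto' h0 hle) (not_le.2 hG0)

/-- A set in an atomless space can be partitioned into finitely many pieces of prescribed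
measures. -/
theorem Atomless.exists_partition (hP : Atomless P) {J : Type*} [Fintype J] [Nonempty J]
    [MeasurableSpace J] {E : Set Ω} (hE : MeasurableSet E)
    (p : J → ℝ) (hp : ∀ j, 0 ≤ p j) (hsum : ∑ j, p j = P.real E) :
    ∃ H : Ω → J, Measurable H ∧ ∀ j, P.real (E ∩ H ⁻¹' {j}) = p j := by
  classical
  suffices h : ∀ (s : Finset J) (E : Set Ω) (p : J → ℝ), MeasurableSet E → (∀ j, 0 ≤ p j) →
      (∀ j ∉ s, p j = 0) → ∑ j, p j = P.real E →
      ∃ H : Ω → J, Measurable H ∧ ∀ j, P.real (E ∩ H ⁻¹' {j}) = p j from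
    h Finset.univ E p hE hp (by simp) hsum
  intro s
  induction s using Finset.induction_on with
  | empty =>
    intro E p hE hp hs hsum
    have hp0 : ∀ j, p j = 0 := fun j => hs j (Finset.notMem_empty j)
    simp only [hp0, Finset.sum_const_zero] at hsum
    obtain ⟨j₀⟩ := ‹Nonempty J›
    refine ⟨fun _ => j₀, measurable_const, fun j => le_antisymm ?_ ?_⟩
    · rw [hp0, hsum]
      exact measureReal_mono inter_subset_left
    · rw [hp0]
      exact measureReal_nonneg
  | insert a s ha ih =>
    intro E p hE hp hs hsum
    have hsplit : p a + ∑ j, Function.update p a 0 j = ∑ j, p j := by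
      rw [← Finset.add_sum_erase _ _ (Finset.mem_univ a), ← Finset.add_sum_erase _ p
        (Finset.mem_univ a), Function.update_self, zero_add]
      congr 1
      exact Finset.sum_congr rfl fun j hj => Function.update_of_ne (Finset.ne_of_mem_erase hj) _ _
    have hnn : ∀ j, 0 ≤ Function.update p a 0 j := fun j => by
      rcases eq_or_ne j a with rfl | h
      · simp
      · rw [Function.update_of_ne h]; exact hp j
    obtain ⟨F, hFE, hF, hFp⟩ := hP.exists_measureReal_eq hE (hp a) (by
      rw [← hsum, ← hsplit]
      exact le_add_of_nonneg_right (Finset.sum_nonneg fun j _ => hnn j))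
    have hdiff : P.real (E \ F) = P.real E - p a := by
      have := measureReal_inter_add_sdiff (μ := P) (s := E) hF
      rw [inter_eq_self_of_subset_right hFE] at this
      linarith
    obtain ⟨H, hH, hHp⟩ := ih (E \ F) (Function.update p a 0) (hE.diff hF) hnn (fun j hj => by
      rcases eq_or_ne j a with rfl | h
      · simp
      · rw [Function.update_of_ne h]
        exact hs j (by simp [h, hj])) (by linarith)
    refine ⟨F.piecewise (fun _ => a) H, measurable_const.piecewise hF hH, fun j => ?_⟩
    have hHj := hHp j
    rw [← measureReal_inter_add_sdiff (μ := P) (s := E ∩ _) hF]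
    have e2 : (E ∩ F.piecewise (fun _ => a) H ⁻¹' {j}) \ F = (E \ F) ∩ H ⁻¹' {j} := by
      ext ω
      by_cases hω : ω ∈ F <;> simp [hω]
    rw [e2, hHj]
    rcases eq_or_ne j a with rfl | h
    · have e1 : (E ∩ F.piecewise (fun _ => j) H ⁻¹' {j}) ∩ F = F := by
        ext ω
        by_cases hω : ω ∈ F
        · simp [hω, hFE hω]
        · simp [hω]
      rw [e1, hFp, Function.update_self, add_zero]
    · have e1 : (E ∩ F.piecewise (fun _ => a) H ⁻¹' {j}) ∩ F = ∅ := by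
        ext ω
        by_cases hω : ω ∈ F <;> simp [hω, h.symm]
      rw [e1, measureReal_empty, Function.update_of_ne h, zero_add]

/-- Over an atomless space every coupling `q` of the law of a finitely-valued `Z` with another
finitely supported law is realized by some random variable. -/
theorem Atomless.exists_coupling (hP : Atomless P) {V J : Type*} [Finite V] [MeasurableSpace V]
    [MeasurableSingletonClass V] [Fintype J] [Nonempty J] [MeasurableSpace J]
    {Z : Ω → V} (hZ : Measurable Z) (q : V → J → ℝ) (hq : ∀ v j, 0 ≤ q v j)
    (hsum : ∀ v, ∑ j, q v j = P.real (Z ⁻¹' {v})) :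
    ∃ H : Ω → J, Measurable H ∧ ∀ v j, P.real (Z ⁻¹' {v} ∩ H ⁻¹' {j}) = q v j := by
  choose H hH hHp using fun v => hP.exists_partition (hZ (measurableSet_singleton v)) (q v) (hq v)
    (hsum v)
  refine ⟨fun ω => H (Z ω) ω, ?_, fun v j => ?_⟩
  · exact (measurable_from_prod_countable_right (f := fun z : V × Ω => H z.1 z.2) hH).comp
      (hZ.prodMk measurable_id)
  · rw [← hHp v j]
    congr 1
    ext ω
    simp only [mem_inter_iff, mem_preimage, mem_singleton_iff]
    constructor <;> rintro ⟨rfl, h⟩ <;> exact ⟨rfl, h⟩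

/-- The product of a probability space with the unit interval is atomless: the measure of
`s ∩ {u ≤ c}` is a continuous function of `c`, and so takes the value half the measure of `s`. -/
theorem atomless_prod : Atomless (P.prod (volume : Measure I)) := by
  intro s hs hpos
  set Q := P.prod (volume : Measure I) with hQ
  let f : I → ℝ := fun c => Q.real (s ∩ Prod.snd ⁻¹' Iic c)
  have hm : ∀ c : I, MeasurableSet (Prod.snd ⁻¹' Iic c : Set (Ω × I)) := fun c =>
    measurable_snd measurableSet_Iic
  have hf : LipschitzWith 1 f := LipschitzWith.of_le_add fun x y => by
    rcases le_total x y with h | h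
    · exact (measureReal_mono (inter_subset_inter_right _
        (preimage_mono (Iic_subset_Iic.2 h)))).trans (le_add_of_nonneg_right dist_nonneg)
    · have hsub : s ∩ Prod.snd ⁻¹' Iic x ⊆ (s ∩ Prod.snd ⁻¹' Iic y) ∪ univ ×ˢ Ioc y x := by
        rintro z ⟨hz, hzx⟩
        by_cases hzy : z.2 ≤ y
        · exact Or.inl ⟨hz, hzy⟩
        · exact Or.inr ⟨mem_univ _, not_le.1 hzy, hzx⟩
      have hvol : Q.real (univ ×ˢ Ioc y x) = dist x y := by
        rw [hQ, measureReal_prod_prod, probReal_univ, one_mul, measureReal_def,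
          unitInterval.volume_Ioc, ENNReal.toReal_ofReal (sub_nonneg.2 h), Subtype.dist_eq,
          Real.dist_eq, abs_of_nonneg (sub_nonneg.2 (by exact_mod_cast h))]
      exact (measureReal_mono hsub).trans ((measureReal_union_le _ _).trans_eq (by rw [hvol]))
  have hQs : 0 < Q.real s := ENNReal.toReal_pos hpos.ne' (measure_ne_top Q s)
  have h0 : f 0 = 0 := by
    have : Q.real (univ ×ˢ Iic (0 : I)) = 0 := by
      rw [hQ, measureReal_prod_prod, measureReal_def (μ := volume), unitInterval.volume_Iic]
      simp
    exact le_antisymm ((measureReal_mono (by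
      rintro z ⟨-, hz⟩
      exact ⟨mem_univ _, hz⟩)).trans_eq this) measureReal_nonneg
  have h1 : f 1 = Q.real s := by
    have : (Prod.snd ⁻¹' Iic (1 : I) : Set (Ω × I)) = univ :=
      eq_univ_of_forall fun z => unitInterval.le_one'
    simp only [f, this, inter_univ]
  obtain ⟨c, hc⟩ := intermediate_value_univ (0 : I) 1 hf.continuous
    (show Q.real s / 2 ∈ Icc (f 0) (f 1) by rw [h0, h1]; constructor <;> linarith)
  have hadd := measureReal_inter_add_sdiff (μ := Q) (s := s) (hm c)
  have hsd : s \ (s ∩ Prod.snd ⁻¹' Iic c) = s \ Prod.snd ⁻¹' Iic c := sdiff_self_inter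
  refine ⟨_, inter_subset_left, hs.inter (hm c), ?_, ?_⟩
  · exact (ENNReal.toReal_pos_iff.1 (show 0 < f c by rw [hc]; linarith)).1
  · rw [hsd]
    change f c + _ = _ at hadd
    exact (ENNReal.toReal_pos_iff.1 (show 0 < Q.real (s \ Prod.snd ⁻¹' Iic c) by linarith)).1

/-- Rounding of the unit interval to finitely many values such that the boundaries of the
rounding cells avoid a given countable set. -/
theorem exists_rounding {C : Set I} (hC : C.Countable) {ε : ℝ} (hε : 0 < ε) :
    ∃ (K : ℕ) (r : I → Fin (K + 1)) (s : Fin (K + 1) → I), Measurable r ∧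
      (∀ x, dist (s (r x)) x ≤ ε) ∧
      ∀ k, (frontier (r ⁻¹' {k})).Countable ∧ Disjoint (frontier (r ⁻¹' {k})) C := by
  obtain ⟨m, hm⟩ := exists_nat_gt (1 / ε)
  have hm0 : (0 : ℝ) < m := (by positivity : 0 < 1 / ε).trans hm
  -- The rounding is `x ↦ ⌊m x + u⌋`. Each point of `C` excludes only countably many shifts `u` for
  -- which it is a jump of this function.
  obtain ⟨u, hu, huC⟩ : ∃ u ∈ Ioo (0 : ℝ) 1, ∀ x ∈ C, ∀ k : ℕ, m * (x : ℝ) + u ≠ k := by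
    have hc : (⋃ k : ℕ, (fun x : I => k - m * (x : ℝ)) '' C).Countable :=
      countable_iUnion fun k => hC.image _
    by_contra! hcon
    refine absurd (hc.mono ?_) (Cardinal.Real.Ioo_countable_iff.not.2 (not_le.2 one_pos) :
      ¬ (Ioo (0 : ℝ) 1).Countable)
    intro u hu
    obtain ⟨x, hx, k, hk⟩ := hcon u hu
    exact mem_iUnion.2 ⟨k, x, hx, by simp only; linarith⟩
  have hfloor : ∀ x : I, ⌊m * (x : ℝ) + u⌋₊ < m + 1 + 1 := fun x => by
    rw [Nat.floor_lt (add_nonneg (mul_nonneg hm0.le x.2.1) hu.1.le)]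
    push_cast
    nlinarith [x.2.2, hu.2]
  have hset : ∀ k : Fin (m + 1 + 1),
      (fun x : I => (⟨⌊m * (x : ℝ) + u⌋₊, hfloor x⟩ : Fin (m + 1 + 1))) ⁻¹' {k} =
        (fun x : I => m * (x : ℝ) + u) ⁻¹' Ico (k : ℝ) (k + 1) := by
    intro k
    ext y
    rw [mem_preimage, mem_singleton_iff, Fin.ext_iff, mem_preimage, mem_Ico,
      Nat.floor_eq_iff (add_nonneg (mul_nonneg hm0.le y.2.1) hu.1.le)]
  refine ⟨m + 1, fun x => ⟨⌊m * (x : ℝ) + u⌋₊, hfloor x⟩,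
    fun k => projIcc 0 1 zero_le_one ((k : ℝ) / m), ?_, fun x => ?_, fun k => ?_⟩
  · refine measurable_to_countable' fun k => ?_
    rw [hset]
    exact (by fun_prop : Measurable fun x : I => m * (x : ℝ) + u) measurableSet_Ico
  · have h1 : ((⌊m * (x : ℝ) + u⌋₊ : ℕ) : ℝ) ≤ m * x + u :=
      Nat.floor_le (add_nonneg (mul_nonneg hm0.le x.2.1) hu.1.le)
    have h2 := Nat.lt_floor_add_one (m * (x : ℝ) + u)
    have h3 : 1 < m * ε := by rwa [div_lt_iff₀ hε] at hm
    rw [← projIcc_val zero_le_one x, Subtype.dist_eq, Real.dist_eq, projIcc_val]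
    nth_rw 2 [← projIcc_val zero_le_one x]
    refine (abs_projIcc_sub_projIcc zero_le_one).trans ?_
    simp only
    rw [show ((⌊m * (x : ℝ) + u⌋₊ : ℕ) : ℝ) / m - x = ((⌊m * (x : ℝ) + u⌋₊ : ℕ) - m * x) / m by
      field_simp, abs_div, abs_of_pos hm0, div_le_iff₀ hm0, abs_le]
    constructor <;> linarith [hu.1, hu.2]
  · have hsub : frontier
        ((fun x : I => (⟨⌊m * (x : ℝ) + u⌋₊, hfloor x⟩ : Fin (m + 1 + 1))) ⁻¹' {k}) ⊆
          (fun x : I => m * (x : ℝ) + u) ⁻¹' {(k : ℝ), (k : ℝ) + 1} := by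
      rw [hset, ← frontier_Ico (by linarith : (k : ℝ) < k + 1)]
      exact Continuous.frontier_preimage_subset (by fun_prop) _
    have hinj : Function.Injective fun x : I => m * (x : ℝ) + u := fun x y h =>
      Subtype.ext (mul_left_cancel₀ hm0.ne' (add_right_cancel h))
    refine ⟨(((toFinite {(k : ℝ), (k : ℝ) + 1}).preimage hinj.injOn).countable).mono hsub,
      Set.disjoint_left.2 fun x hx hxC => ?_⟩
    rcases hsub hx with h | h
    · exact huC x hxC k h
    · exact huC x hxC (k + 1) (by push_cast; exact h)

/-- Over an atomless space, a finitely-valued random variable can be changed to have a prescribed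
law `p`, on an event whose probability is at most the `ℓ¹`-distance of the laws. This is the maximal
coupling of the two laws. -/
theorem Atomless.exists_close (hP : Atomless P) {V : Type*} [Fintype V] [MeasurableSpace V]
    [MeasurableSingletonClass V] {D : Ω → V} (hD : Measurable D) (p : V → ℝ) (hp : ∀ v, 0 ≤ p v)
    (hsum : ∑ v, p v = 1) :
    ∃ Z : Ω → V, Measurable Z ∧ (∀ v, P.real (Z ⁻¹' {v}) = p v) ∧
      P.real {ω | Z ω ≠ D ω} ≤ ∑ v, |P.real (D ⁻¹' {v}) - p v| := by
  classical
  let d : V → ℝ := fun v => P.real (D ⁻¹' {v})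
  have hd0 : ∀ v, 0 ≤ d v := fun v => measureReal_nonneg
  have hfib : ∀ (Z : Ω → V), Measurable Z → ∀ E, MeasurableSet E →
      ∑ v, P.real (Z ⁻¹' {v} ∩ E) = P.real E := by
    intro Z hZ E hE
    rw [← measureReal_biUnion_finset]
    · congr 1
      ext ω
      simp
    · intro i _ j _ hij
      exact (Disjoint.preimage _ (disjoint_singleton.2 hij)).mono inter_subset_left
        inter_subset_left
    · exact fun v _ => (hZ (measurableSet_singleton v)).inter hE
  have hdsum : ∑ v, d v = 1 := by
    have := hfib D hD univ .univ
    simpa using this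
  let T : ℝ := ∑ v, max (d v - p v) 0
  have hT : ∑ v, max (p v - d v) 0 = T := by
    have h : ∀ v, max (d v - p v) 0 - max (p v - d v) 0 = d v - p v := fun v => by
      rcases le_total (d v) (p v) with h | h
      · rw [max_eq_right (sub_nonpos.2 h), max_eq_left (sub_nonneg.2 h)]; ring
      · rw [max_eq_left (sub_nonneg.2 h), max_eq_right (sub_nonpos.2 h)]; ring
    have h2 := Finset.sum_congr (rfl : (Finset.univ : Finset V) = Finset.univ) fun v _ => h v
    rw [Finset.sum_sub_distrib, Finset.sum_sub_distrib, hdsum, hsum] at h2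
    linarith
  have hT0 : 0 ≤ T := Finset.sum_nonneg fun v _ => le_max_right _ _
  have hle1 : ∀ v, max (d v - p v) 0 ≤ T := fun v =>
    Finset.single_le_sum (f := fun v => max (d v - p v) 0) (fun v _ => le_max_right _ _)
      (Finset.mem_univ v)
  have hle2 : ∀ v, max (p v - d v) 0 ≤ T := fun v => hT ▸
    Finset.single_le_sum (f := fun v => max (p v - d v) 0) (fun v _ => le_max_right _ _)
      (Finset.mem_univ v)
  have hcancel : ∀ x : ℝ, 0 ≤ x → x ≤ T → x * T / T = x := fun x hx hxT => by
    rcases eq_or_ne T 0 with h | h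
    · rw [h] at hxT
      rw [le_antisymm hxT hx]
      simp
    · exact mul_div_cancel_right₀ x h
  -- As much mass as possible is put on the diagonal. The excesses of `d` over `p` and of `p` over
  -- `d`, which have the same total `T`, are coupled independently. For `T = 0` there is no excess,
  -- and the division by zero does no harm.
  let q : V → V → ℝ := fun v w =>
    (if v = w then min (d v) (p v) else 0) + max (d v - p v) 0 * max (p w - d w) 0 / T
  have hmin : ∀ a b : ℝ, min a b + max (a - b) 0 = a := fun a b => by
    rcases le_total a b with h | h
    · rw [min_eq_left h, max_eq_right (sub_nonpos.2 h), add_zero]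
    · rw [min_eq_right h, max_eq_left (sub_nonneg.2 h)]; ring
  have hrow : ∀ v, ∑ w, q v w = d v := fun v => by
    simp only [q]
    rw [Finset.sum_add_distrib, Finset.sum_ite_eq, if_pos (Finset.mem_univ v), ← Finset.sum_div,
      ← Finset.mul_sum, hT, hcancel _ (le_max_right _ _) (hle1 v), hmin]
  have hcol : ∀ w, ∑ v, q v w = p w := fun w => by
    simp only [q]
    rw [Finset.sum_add_distrib, Finset.sum_ite_eq', if_pos (Finset.mem_univ w), ← Finset.sum_div,
      ← Finset.sum_mul, mul_comm T, hcancel _ (le_max_right _ _) (hle2 w), min_comm, hmin]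
  have hne : Nonempty V := ⟨D (nonempty_of_isProbabilityMeasure P).some⟩
  obtain ⟨Z, hZ, hZq⟩ := hP.exists_coupling hD q (fun v w => add_nonneg
    (by split_ifs; exacts [le_min (hd0 v) (hp v), le_rfl])
    (div_nonneg (mul_nonneg (le_max_right _ _) (le_max_right _ _)) hT0)) hrow
  refine ⟨Z, hZ, fun w => ?_, ?_⟩
  · rw [← hcol w, ← hfib D hD _ (hZ (measurableSet_singleton w))]
    exact Finset.sum_congr rfl fun v _ => hZq v w
  · have hE : MeasurableSet {ω | Z ω ≠ D ω} := (measurableSet_eq_fun hZ hD).compl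
    rw [← hfib D hD _ hE]
    refine Finset.sum_le_sum fun v _ => ?_
    have h1 : D ⁻¹' {v} ∩ {ω | Z ω ≠ D ω} = D ⁻¹' {v} \ (D ⁻¹' {v} ∩ Z ⁻¹' {v}) := by
      ext ω
      simp only [mem_inter_iff, mem_preimage, mem_singleton_iff, mem_ofPred_eq, mem_sdiff]
      constructor
      · rintro ⟨rfl, h⟩
        exact ⟨rfl, fun h' => h h'.2⟩
      · rintro ⟨rfl, h⟩
        exact ⟨rfl, fun h' => h ⟨rfl, h'⟩⟩
    rw [h1, measureReal_sdiff inter_subset_left ((hD (measurableSet_singleton v)).inter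
      (hZ (measurableSet_singleton v))), hZq]
    simp only [q, if_true]
    have h2 : 0 ≤ max (d v - p v) 0 * max (p v - d v) 0 / T :=
      div_nonneg (mul_nonneg (le_max_right _ _) (le_max_right _ _)) hT0
    have h3 := hmin (d v) (p v)
    have h4 : max (d v - p v) 0 ≤ |d v - p v| := max_le (le_abs_self _) (abs_nonneg _)
    change d v - _ ≤ |d v - p v|
    linarith

end AtomlessSpace

/-! ### Uniform continuity of formulas -/

section Modulus

variable {Ω : Type*} [mΩ : MeasurableSpace Ω] {P : Measure Ω} [IsProbabilityMeasure P]

theorem dist_funMap_unitInterval_le {k : ℕ} (f : Func k) (x y : Fin k → I) :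
    dist (FirstOrder.Language.Structure.funMap (L := LRV) f x)
      (FirstOrder.Language.Structure.funMap (L := LRV) f y) ≤ ∑ i, dist (x i) (y i) := by
  simp only [Subtype.dist_eq, Real.dist_eq]
  cases f with
  | zero =>
    change |((0 : I) : ℝ) - (0 : I)| ≤ _
    simp
  | neg =>
    change |(1 - (x 0 : ℝ)) - (1 - (y 0 : ℝ))| ≤ _
    rw [sub_sub_sub_cancel_left, abs_sub_comm]
    simp
  | half =>
    change |(x 0 : ℝ) / 2 - (y 0 : ℝ) / 2| ≤ _
    rw [← sub_div, abs_div, abs_two, Fin.sum_univ_one]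
    linarith [abs_nonneg ((x 0 : ℝ) - y 0)]
  | tsub =>
    change |max ((x 0 : ℝ) - x 1) 0 - max ((y 0 : ℝ) - y 1) 0| ≤ _
    refine (abs_max_sub_max_le_abs _ _ _).trans ?_
    rw [Fin.sum_univ_two, show (x 0 : ℝ) - x 1 - (y 0 - y 1) = (x 0 - y 0) - (x 1 - y 1) by ring]
    exact abs_sub _ _

theorem dist_funMap_le {k : ℕ} (f : Func k) (x y : Fin k → RVSpace P) :
    dist (FirstOrder.Language.Structure.funMap (L := LRV) f x)
      (FirstOrder.Language.Structure.funMap (L := LRV) f y) ≤ ∑ i, dist (x i) (y i) := by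
  simp only [dist_eq]
  rw [← integral_finsetSum _ fun i _ => integrable_dist (measurable_rv _) (measurable_rv _)]
  refine integral_mono_ae (integrable_dist (measurable_rv _) (measurable_rv _))
    (integrable_finsetSum _ fun i _ => integrable_dist (measurable_rv _) (measurable_rv _)) ?_
  filter_upwards [rv_funMap f x, rv_funMap f y] with ω h1 h2
  rw [h1, h2]
  exact dist_funMap_unitInterval_le f _ _

theorem continuous_funMap_rvSpace {k : ℕ} (f : Func k) : Continuous fun x : Fin k → RVSpace P =>
    FirstOrder.Language.Structure.funMap (L := LRV) f x := by
  refine (LipschitzWith.of_dist_le_mul (K := k) fun x y => ?_).continuous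
  refine (dist_funMap_le f x y).trans ?_
  refine (Finset.sum_le_card_nsmul _ _ _ fun i _ => dist_le_pi_dist x y i).trans ?_
  simp

/-- Terms are Lipschitz, with a constant that does not depend on the structure. -/
theorem exists_lipschitz_term {β : Type v} (t : LRV.Term β) :
    ∃ C : ℝ, 0 ≤ C ∧ ∀ {Ω : Type w} [MeasurableSpace Ω] {P : Measure Ω} [IsProbabilityMeasure P]
      (X Y : β → RVSpace P) (δ : ℝ), (∀ i, dist (X i) (Y i) ≤ δ) →
        dist (t.realize X) (t.realize Y) ≤ C * δ := by
  induction t with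
  | var i => exact ⟨1, zero_le_one, fun X Y δ h => by simpa using h i⟩
  | func f ts ih =>
    choose C hC0 hC using ih
    refine ⟨∑ i, C i, Finset.sum_nonneg fun i _ => hC0 i, fun X Y δ h => ?_⟩
    refine (dist_funMap_le f _ _).trans ?_
    rw [Finset.sum_mul]
    exact Finset.sum_le_sum fun i _ => hC i X Y δ h

theorem iSup_le_iSup_add {ι κ : Type*} {f : ι → I} {g : κ → I} {ε : ℝ} (hε : 0 ≤ ε)
    (h : ∀ a, ∃ b, (f a : ℝ) ≤ g b + ε) : ((⨆ a, f a : I) : ℝ) ≤ (⨆ b, g b : I) + ε := by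
  by_cases h1 : ((⨆ b, g b : I) : ℝ) + ε ≤ 1
  · have : (⨆ a, f a) ≤ (⟨(⨆ b, g b : I) + ε, add_nonneg (⨆ b, g b : I).2.1 hε, h1⟩ : I) := by
      refine iSup_le fun a => ?_
      obtain ⟨b, hb⟩ := h a
      have hgb : (g b : ℝ) ≤ (⨆ b, g b : I) := le_iSup g b
      exact Subtype.mk_le_mk.2 (hb.trans (by linarith))
    exact this
  · exact (⨆ a, f a : I).2.2.trans (not_le.1 h1).le

theorem iInf_le_iInf_add {ι κ : Type*} {f : ι → I} {g : κ → I} {ε : ℝ} (hε : 0 ≤ ε)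
    (h : ∀ b, ∃ a, (f a : ℝ) ≤ g b + ε) : ((⨅ a, f a : I) : ℝ) ≤ (⨅ b, g b : I) + ε := by
  by_cases h1 : 0 ≤ ((⨅ a, f a : I) : ℝ) - ε
  · have : (⟨(⨅ a, f a : I) - ε, h1, (sub_le_self _ hε).trans (⨅ a, f a : I).2.2⟩ : I) ≤
        ⨅ b, g b := by
      refine le_iInf fun b => ?_
      obtain ⟨a, ha⟩ := h b
      have hfa : ((⨅ a, f a : I) : ℝ) ≤ f a := iInf_le f a
      exact Subtype.mk_le_mk.2 (by linarith)
    have h2 : ((⨅ a, f a : I) : ℝ) - ε ≤ (⨅ b, g b : I) := this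
    linarith
  · have := (⨅ b, g b : I).2.1
    linarith

theorem dist_le_iff_le_add {a b : I} {ε : ℝ} :
    dist a b ≤ ε ↔ (a : ℝ) ≤ b + ε ∧ (b : ℝ) ≤ a + ε := by
  rw [Subtype.dist_eq, Real.dist_eq, abs_le]
  constructor <;> rintro ⟨h1, h2⟩ <;> constructor <;> linarith

/-- Formulas are uniformly continuous, with a modulus that does not depend on the structure. -/
theorem exists_modulus_formula {α : Type v} {m : ℕ} (φ : Formula α m) :
    ∀ ε : ℝ, 0 < ε → ∃ δ : ℝ, 0 < δ ∧
    ∀ {Ω : Type w} [MeasurableSpace Ω] {P : Measure Ω} [IsProbabilityMeasure P]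
      (v w : α → RVSpace P) (x y : Fin m → RVSpace P), (∀ i, dist (v i) (w i) ≤ δ) →
      (∀ j, dist (x j) (y j) ≤ δ) → dist (φ.eval v x) (φ.eval w y) ≤ ε := by
  induction φ with
  | dist s t =>
    intro ε hε
    obtain ⟨C, hC0, hC⟩ := exists_lipschitz_term.{v, w} s
    obtain ⟨D, hD0, hD⟩ := exists_lipschitz_term.{v, w} t
    refine ⟨ε / (C + D + 1), by positivity, fun v w x y hv hx => ?_⟩
    have hvx : ∀ i, dist (Sum.elim v x i) (Sum.elim w y i) ≤ ε / (C + D + 1) := by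
      rintro (i | j)
      · exact hv i
      · exact hx j
    have h1 := hC _ _ _ hvx
    have h2 := hD _ _ _ hvx
    simp only [Formula.eval]
    rw [Subtype.dist_eq, Real.dist_eq]
    refine (abs_projIcc_sub_projIcc zero_le_one).trans ((Real.dist_eq _ _).symm.trans_le ?_)
    refine (dist_dist_dist_le _ _ _ _).trans ((add_le_add h1 h2).trans ?_)
    rw [← add_mul, mul_div_assoc', div_le_iff₀ (by positivity)]
    nlinarith
  | conn c φ ih =>
    intro ε hε
    obtain ⟨η, hη, hc⟩ := Metric.uniformContinuous_iff.1
      (CompactSpace.uniformContinuous_of_continuous c.continuous) ε hε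
    choose δ hδ0 hδ using fun i => ih i (η / 2) (by positivity)
    obtain ⟨δ₀, hδ₀, hle⟩ : ∃ δ₀ > 0, ∀ i, δ₀ ≤ δ i := by
      rcases isEmpty_or_nonempty (Fin _) with h | h
      · exact ⟨1, one_pos, fun i => h.elim i⟩
      · obtain ⟨i₀, hi₀⟩ := Finite.exists_min δ
        exact ⟨δ i₀, hδ0 i₀, hi₀⟩
    refine ⟨δ₀, hδ₀, fun v w x y hv hx => ?_⟩
    simp only [Formula.eval]
    refine (hc ((dist_pi_lt_iff hη).2 fun i => ?_)).le
    exact (hδ i v w x y (fun j => (hv j).trans (hle i)) fun j => (hx j).trans (hle i)).trans_lt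
      (half_lt_self hη)
  | sup φ ih =>
    intro ε hε
    obtain ⟨δ, hδ, h⟩ := ih ε hε
    refine ⟨δ, hδ, fun v w x y hv hx => ?_⟩
    have key := fun a => dist_le_iff_le_add.1 <| h v w (Fin.snoc x a) (Fin.snoc y a) hv fun j => by
      refine Fin.lastCases ?_ (fun j => ?_) j
      · simpa using hδ.le
      · simpa using hx j
    simp only [Formula.eval]
    exact dist_le_iff_le_add.2 ⟨iSup_le_iSup_add hε.le fun a => ⟨a, (key a).1⟩,
      iSup_le_iSup_add hε.le fun a => ⟨a, (key a).2⟩⟩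
  | inf φ ih =>
    intro ε hε
    obtain ⟨δ, hδ, h⟩ := ih ε hε
    refine ⟨δ, hδ, fun v w x y hv hx => ?_⟩
    have key := fun a => dist_le_iff_le_add.1 <| h v w (Fin.snoc x a) (Fin.snoc y a) hv fun j => by
      refine Fin.lastCases ?_ (fun j => ?_) j
      · simpa using hδ.le
      · simpa using hx j
    simp only [Formula.eval]
    exact dist_le_iff_le_add.2 ⟨iInf_le_iInf_add hε.le fun a => ⟨a, (key a).1⟩,
      iInf_le_iInf_add hε.le fun a => ⟨a, (key a).2⟩⟩

end Modulus

/-! ### Quantifier elimination -/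

section QE

/-- The law of a finitely-valued random variable is determined by the probabilities of its
values. -/
theorem map_eq_map_of_real_eq {Ω₁ Ω₂ V : Type*} [MeasurableSpace Ω₁] [MeasurableSpace Ω₂]
    {P₁ : Measure Ω₁} {P₂ : Measure Ω₂} [IsProbabilityMeasure P₁] [IsProbabilityMeasure P₂]
    [Countable V] [MeasurableSpace V] [MeasurableSingletonClass V] {f₁ : Ω₁ → V} {f₂ : Ω₂ → V}
    (h₁ : Measurable f₁) (h₂ : Measurable f₂)
    (h : ∀ v, P₁.real (f₁ ⁻¹' {v}) = P₂.real (f₂ ⁻¹' {v})) : P₁.map f₁ = P₂.map f₂ := by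
  refine Measure.ext_of_singleton fun v => ?_
  rw [Measure.map_apply h₁ (measurableSet_singleton v),
    Measure.map_apply h₂ (measurableSet_singleton v)]
  exact (ENNReal.toReal_eq_toReal_iff' (measure_ne_top _ _) (measure_ne_top _ _)).1 (h v)

variable {Ω : Type*} [MeasurableSpace Ω] {P : Measure Ω} [IsProbabilityMeasure P]

/-- The random variable `s ∘ D`, for a finitely-valued `D`. -/
noncomputable def ofFinite {V : Type*} [Finite V] [MeasurableSpace V] [MeasurableSingletonClass V]
    (s : V → I) {D : Ω → V} (hD : Measurable D) : RVSpace P :=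
  ofRV (fun ω => s (D ω)) ((measurable_of_finite s).comp hD)

theorem rv_ofFinite {V : Type*} [Finite V] [MeasurableSpace V] [MeasurableSingletonClass V]
    (s : V → I) {D : Ω → V} (hD : Measurable D) :
    ∀ᵐ ω ∂P, rv (ofFinite (P := P) s hD) ω = s (D ω) := rv_ofRV _

theorem dist_ofFinite_le {V : Type*} [Finite V] [MeasurableSpace V] [MeasurableSingletonClass V]
    {s : V → I} {r : I → V} (hr : Measurable r) {δ : ℝ} (h : ∀ x, dist (s (r x)) x ≤ δ)
    (x : RVSpace P) : dist x (ofFinite s (hr.comp (measurable_rv x))) ≤ δ := by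
  refine dist_le_of_ae ?_
  filter_upwards [rv_ofFinite (P := P) s (hr.comp (measurable_rv x))] with ω h1
  rw [h1, dist_comm]
  exact h _

theorem law_ofFinite {ι V : Type*} [Countable ι] [Finite V] [MeasurableSpace V]
    [MeasurableSingletonClass V] (s : ι → V → I) {D : Ω → V} (hD : Measurable D) :
    law (fun i => ofFinite (P := P) (s i) hD) = (P.map D).map fun v i => s i v := by
  rw [Measure.map_map (measurable_of_finite _) hD]
  refine Measure.map_congr ?_
  filter_upwards [ae_all_iff.2 fun i => rv_ofFinite (P := P) (s i) hD] with ω h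
  funext i
  exact h i

variable {Ω₁ Ω₂ : Type*} [MeasurableSpace Ω₁] [MeasurableSpace Ω₂]
    {P₁ : Measure Ω₁} {P₂ : Measure Ω₂} [IsProbabilityMeasure P₁] [IsProbabilityMeasure P₂]

/-- The back-and-forth step: if two tuples have the same law, then, after moving everything by an
arbitrarily small amount, the first tuple together with `c` has the same law as the second one
together with some `d`. -/
theorem exists_extend_law (hP₂ : Atomless P₂) {ι : Type*} [Finite ι] {X₁ : ι → RVSpace P₁}
    {X₂ : ι → RVSpace P₂} (h : law X₁ = law X₂) (c : RVSpace P₁) {δ : ℝ} (hδ : 0 < δ) :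
    ∃ (Y₁ : ι → RVSpace P₁) (c' : RVSpace P₁) (Y₂ : ι → RVSpace P₂) (d : RVSpace P₂),
      (∀ i, dist (X₁ i) (Y₁ i) ≤ δ) ∧ dist c c' ≤ δ ∧ (∀ i, dist (X₂ i) (Y₂ i) ≤ δ) ∧
      law (fun o : Option ι => o.elim c' Y₁) = law (fun o : Option ι => o.elim d Y₂) := by
  cases nonempty_fintype ι
  obtain ⟨K, r, s, hr, hrs, -⟩ := exists_rounding (C := ∅) countable_empty hδ
  let R : (ι → I) → ι → Fin (K + 1) := fun z i => r (z i)
  have hR : Measurable R := measurable_pi_lambda _ fun i => hr.comp (measurable_pi_apply i)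
  have hZ₁ : Measurable fun ω => R fun i => rv (X₁ i) ω := hR.comp (measurable_rv_pi X₁)
  have hZ₂ : Measurable fun ω => R fun i => rv (X₂ i) ω := hR.comp (measurable_rv_pi X₂)
  have hc : Measurable fun ω => r (rv c ω) := hr.comp (measurable_rv c)
  obtain ⟨H, hH, hHp⟩ := hP₂.exists_coupling hZ₂ (J := Fin (K + 1))
    (fun v j => P₁.real ((fun ω => R fun i => rv (X₁ i) ω) ⁻¹' {v} ∩
      (fun ω => r (rv c ω)) ⁻¹' {j})) (fun v j => measureReal_nonneg) (fun v => by
      have e1 : P₂.real ((fun ω => R fun i => rv (X₂ i) ω) ⁻¹' {v}) =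
          P₁.real ((fun ω => R fun i => rv (X₁ i) ω) ⁻¹' {v}) := by
        have hm := hR (measurableSet_singleton v)
        have := congrArg (fun μ => μ.real (R ⁻¹' {v})) h
        simp only [law, map_measureReal_apply (measurable_rv_pi X₁) hm,
          map_measureReal_apply (measurable_rv_pi X₂) hm] at this
        exact this.symm
      rw [e1, ← measureReal_biUnion_finset]
      · congr 1
        ext ω
        simp
      · intro i _ j _ hij
        exact (Disjoint.preimage _ (disjoint_singleton.2 hij)).mono inter_subset_right
          inter_subset_right
      · exact fun j _ => (hZ₁ (measurableSet_singleton v)).inter (hc (measurableSet_singleton j)))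
  have hD₁ := hZ₁.prodMk hc
  have hD₂ := hZ₂.prodMk hH
  have hmap := map_eq_map_of_real_eq hD₁ hD₂ (P₁ := P₁) (P₂ := P₂) (by
    rintro ⟨v, j⟩
    rw [← singleton_prod_singleton, mk_preimage_prod, mk_preimage_prod]
    exact (hHp v j).symm)
  let S : Option ι → (ι → Fin (K + 1)) × Fin (K + 1) → I := fun o p =>
    o.elim (s p.2) fun i => s (p.1 i)
  refine ⟨fun i => ofFinite (S (some i)) hD₁, ofFinite (S none) hD₁,
    fun i => ofFinite (S (some i)) hD₂, ofFinite (S none) hD₂,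
    fun i => dist_ofFinite_le hr hrs (X₁ i), dist_ofFinite_le hr hrs c,
    fun i => dist_ofFinite_le hr hrs (X₂ i), ?_⟩
  have e₁ : (fun o : Option ι => o.elim (ofFinite (P := P₁) (S none) hD₁) fun i =>
      ofFinite (S (some i)) hD₁) = fun o => ofFinite (S o) hD₁ := by
    funext o; cases o <;> rfl
  have e₂ : (fun o : Option ι => o.elim (ofFinite (P := P₂) (S none) hD₂) fun i =>
      ofFinite (S (some i)) hD₂) = fun o => ofFinite (S o) hD₂ := by
    funext o; cases o <;> rfl
  rw [e₁, e₂, law_ofFinite, law_ofFinite, hmap]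

theorem law_comp {ι κ : Type*} (X : ι → RVSpace P) (f : κ → ι) :
    law (fun k => X (f k)) = (law X).map fun z k => z (f k) := by
  rw [law, law, Measure.map_map (measurable_pi_lambda _ fun k => measurable_pi_apply _)
    (measurable_rv_pi X)]
  rfl

theorem law_comp_eq {ι κ : Type*} {X₁ : ι → RVSpace P₁} {X₂ : ι → RVSpace P₂}
    (h : law X₁ = law X₂) (f : κ → ι) :
    law (fun k => X₁ (f k)) = law (fun k => X₂ (f k)) := by
  rw [law_comp X₁, law_comp X₂, h]

theorem dist_realize {ι : Type*} [Finite ι] (X : ι → RVSpace P) (s t : LRV.Term ι) :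
    dist (s.realize X) (t.realize X) =
      ∫ z, dist (s.realize z : I) (t.realize z) ∂(law X) := by
  rw [law, integral_map (measurable_rv_pi X).aemeasurable (by
    exact (continuous_realize s).dist (continuous_realize t) |>.aestronglyMeasurable), dist_eq]
  refine integral_congr_ae ?_
  filter_upwards [rv_realize s X, rv_realize t X] with ω h1 h2
  rw [h1, h2]

end QE

/-- Quantifier elimination: in atomless spaces, the value of a formula at a finite tuple depends
only on the law of the tuple. For a quantifier, each candidate on one side is matched up to `ε` by a
candidate on the other side, since formulas are uniformly continuous and since the tuples can be
extended to tuples of the same law after a small perturbation. -/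
theorem eval_eq_of_law_eq {α : Type v} [Finite α] {m : ℕ} (φ : Formula α m) :
    ∀ {Ω₁ Ω₂ : Type w} [MeasurableSpace Ω₁] [MeasurableSpace Ω₂] {P₁ : Measure Ω₁}
      {P₂ : Measure Ω₂} [IsProbabilityMeasure P₁] [IsProbabilityMeasure P₂],
      Atomless P₁ → Atomless P₂ → ∀ (v₁ : α → RVSpace P₁) (x₁ : Fin m → RVSpace P₁)
      (v₂ : α → RVSpace P₂) (x₂ : Fin m → RVSpace P₂),
      law (Sum.elim v₁ x₁) = law (Sum.elim v₂ x₂) → φ.eval v₁ x₁ = φ.eval v₂ x₂ := by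
  have step : ∀ {m : ℕ} (φ : Formula α (m + 1)),
    (∀ {Ω₁ Ω₂ : Type w} [MeasurableSpace Ω₁] [MeasurableSpace Ω₂] {P₁ : Measure Ω₁}
      {P₂ : Measure Ω₂} [IsProbabilityMeasure P₁] [IsProbabilityMeasure P₂],
      Atomless P₁ → Atomless P₂ → ∀ (v₁ : α → RVSpace P₁) (x₁ : Fin (m + 1) → RVSpace P₁)
      (v₂ : α → RVSpace P₂) (x₂ : Fin (m + 1) → RVSpace P₂),
      law (Sum.elim v₁ x₁) = law (Sum.elim v₂ x₂) → φ.eval v₁ x₁ = φ.eval v₂ x₂) →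
    ∀ ε > 0, ∀ {Ω₁ Ω₂ : Type w} [MeasurableSpace Ω₁] [MeasurableSpace Ω₂] {P₁ : Measure Ω₁}
      {P₂ : Measure Ω₂} [IsProbabilityMeasure P₁] [IsProbabilityMeasure P₂],
      Atomless P₁ → Atomless P₂ → ∀ (v₁ : α → RVSpace P₁) (x₁ : Fin m → RVSpace P₁)
      (v₂ : α → RVSpace P₂) (x₂ : Fin m → RVSpace P₂),
      law (Sum.elim v₁ x₁) = law (Sum.elim v₂ x₂) → ∀ c, ∃ d,
        dist (φ.eval v₁ (Fin.snoc x₁ c)) (φ.eval v₂ (Fin.snoc x₂ d)) ≤ ε := by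
    intro m φ ih ε hε Ω₁ Ω₂ _ _ P₁ P₂ _ _ hP₁ hP₂ v₁ x₁ v₂ x₂ h c
    obtain ⟨δ, hδ, hmod⟩ := exists_modulus_formula.{v, w} φ (ε / 2) (by positivity)
    obtain ⟨Y₁, c', Y₂, d, h1, h2, h3, h4⟩ := exists_extend_law hP₂ h c hδ
    refine ⟨d, ?_⟩
    have hsnoc : ∀ {Ω : Type w} [MeasurableSpace Ω] {P : Measure Ω} [IsProbabilityMeasure P]
        (Y : α ⊕ Fin m → RVSpace P) (c : RVSpace P),
        Sum.elim (fun a => Y (.inl a)) (Fin.snoc (fun j => Y (.inr j)) c) =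
        fun i : α ⊕ Fin (m + 1) => (Option.elim · c Y : Option (α ⊕ Fin m) → RVSpace P)
          (i.elim (fun a => some (.inl a))
            (Fin.snoc (α := fun _ => Option (α ⊕ Fin m)) (fun j => some (.inr j)) none)) := by
      intro Ω _ P _ Y c
      funext i
      rcases i with a | j
      · rfl
      · refine Fin.lastCases ?_ (fun j => ?_) j <;> simp
    have heq := ih hP₁ hP₂ (fun a => Y₁ (.inl a)) (Fin.snoc (fun j => Y₁ (.inr j)) c')
      (fun a => Y₂ (.inl a)) (Fin.snoc (fun j => Y₂ (.inr j)) d) (by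
        rw [hsnoc, hsnoc]
        exact law_comp_eq h4 _)
    have a1 := hmod v₁ (fun a => Y₁ (.inl a)) (Fin.snoc x₁ c)
      (Fin.snoc (fun j => Y₁ (.inr j)) c') (fun a => h1 (.inl a)) (fun j => by
        refine Fin.lastCases ?_ (fun j => ?_) j
        · simpa using h2
        · simpa using h1 (.inr j))
    have a2 := hmod v₂ (fun a => Y₂ (.inl a)) (Fin.snoc x₂ d)
      (Fin.snoc (fun j => Y₂ (.inr j)) d) (fun a => h3 (.inl a)) (fun j => by
        refine Fin.lastCases ?_ (fun j => ?_) j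
        · simpa using hδ.le
        · simpa using h3 (.inr j))
    rw [heq] at a1
    rw [dist_comm] at a2
    exact (dist_triangle _ _ _).trans ((add_le_add a1 a2).trans_eq (add_halves ε))
  induction φ with
  | dist s t =>
    intro Ω₁ Ω₂ _ _ P₁ P₂ _ _ hP₁ hP₂ v₁ x₁ v₂ x₂ h
    simp only [Formula.eval]
    rw [dist_realize, dist_realize, h]
  | conn c φ ih =>
    intro Ω₁ Ω₂ _ _ P₁ P₂ _ _ hP₁ hP₂ v₁ x₁ v₂ x₂ h
    simp only [Formula.eval]
    exact congrArg c (funext fun i => ih i hP₁ hP₂ v₁ x₁ v₂ x₂ h)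
  | sup φ ih =>
    intro Ω₁ Ω₂ _ _ P₁ P₂ _ _ hP₁ hP₂ v₁ x₁ v₂ x₂ h
    refine eq_of_forall_dist_le fun ε hε => dist_le_iff_le_add.2 ⟨?_, ?_⟩ <;>
      refine iSup_le_iSup_add hε.le fun c => ?_
    · obtain ⟨d, hd⟩ := step φ ih ε hε hP₁ hP₂ v₁ x₁ v₂ x₂ h c
      exact ⟨d, (dist_le_iff_le_add.1 hd).1⟩
    · obtain ⟨d, hd⟩ := step φ ih ε hε hP₂ hP₁ v₂ x₂ v₁ x₁ h.symm c
      exact ⟨d, (dist_le_iff_le_add.1 hd).1⟩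
  | inf φ ih =>
    intro Ω₁ Ω₂ _ _ P₁ P₂ _ _ hP₁ hP₂ v₁ x₁ v₂ x₂ h
    refine eq_of_forall_dist_le fun ε hε => dist_le_iff_le_add.2 ⟨?_, ?_⟩ <;>
      refine iInf_le_iInf_add hε.le fun c => ?_
    · obtain ⟨d, hd⟩ := step φ ih ε hε hP₂ hP₁ v₂ x₂ v₁ x₁ h.symm c
      exact ⟨d, (dist_le_iff_le_add.1 hd).2⟩
    · obtain ⟨d, hd⟩ := step φ ih ε hε hP₁ hP₂ v₁ x₁ v₂ x₂ h c
      exact ⟨d, (dist_le_iff_le_add.1 hd).2⟩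

/-! ### Finitely many parameters -/

section Relabel

/-- Renaming the free variables of a formula. -/
def relabelFormula {α : Type v} {β : Type w} (g : α → β) : {m : ℕ} → Formula α m → Formula β m
  | _, .dist s t => .dist (s.relabel (Sum.map g id)) (t.relabel (Sum.map g id))
  | _, .conn c φ => .conn c fun i => relabelFormula g (φ i)
  | _, .sup φ => .sup (relabelFormula g φ)
  | _, .inf φ => .inf (relabelFormula g φ)

theorem eval_relabelFormula {α : Type v} {β : Type w} (g : α → β) {M : Type*} [LRV.Structure M]
    [MetricSpace M] {m : ℕ} (φ : Formula α m) (v : β → M) (x : Fin m → M) :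
    (relabelFormula g φ).eval v x = φ.eval (fun a => v (g a)) x := by
  induction φ with
  | dist s t =>
    simp only [relabelFormula, Formula.eval, FirstOrder.Language.Term.realize_relabel,
      Sum.elim_comp_map, Function.comp_id]
    rfl
  | conn c φ ih => simp only [relabelFormula, Formula.eval, ih]
  | sup φ ih => simp only [relabelFormula, Formula.eval, ih]
  | inf φ ih => simp only [relabelFormula, Formula.eval, ih]

theorem exists_finite_support_term {β : Type*} (t : LRV.Term β) : ∃ S : Set β, S.Finite ∧
    ∀ {M : Type w} [LRV.Structure M] (v w : β → M), (∀ i ∈ S, v i = w i) →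
      t.realize v = t.realize w := by
  induction t with
  | var i => exact ⟨{i}, finite_singleton i, fun v w h => h i rfl⟩
  | func f ts ih =>
    choose S hS h using ih
    refine ⟨⋃ i, S i, finite_iUnion hS, fun v w hvw => ?_⟩
    simp only [FirstOrder.Language.Term.realize_func]
    congr 1
    exact funext fun i => h i v w fun j hj => hvw j (mem_iUnion.2 ⟨i, hj⟩)

theorem exists_finite_support {α : Type v} {m : ℕ} (φ : Formula α m) : ∃ S : Set α, S.Finite ∧
    ∀ {M : Type w} [LRV.Structure M] [MetricSpace M] (v w : α → M) (x : Fin m → M),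
      (∀ i ∈ S, v i = w i) → φ.eval v x = φ.eval w x := by
  induction φ with
  | dist s t =>
    obtain ⟨S, hS, hs⟩ := exists_finite_support_term.{w} s
    obtain ⟨T, hT, ht⟩ := exists_finite_support_term.{w} t
    refine ⟨Sum.inl ⁻¹' S ∪ Sum.inl ⁻¹' T, (hS.preimage Sum.inl_injective.injOn).union
      (hT.preimage Sum.inl_injective.injOn), fun v w x h => ?_⟩
    simp only [Formula.eval]
    rw [hs (Sum.elim v x) (Sum.elim w x), ht (Sum.elim v x) (Sum.elim w x)]
    · rintro (i | j) hi
      · exact h i (Or.inr hi)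
      · rfl
    · rintro (i | j) hi
      · exact h i (Or.inl hi)
      · rfl
  | conn c φ ih =>
    choose S hS h using ih
    refine ⟨⋃ i, S i, finite_iUnion hS, fun v w x hvw => ?_⟩
    simp only [Formula.eval]
    exact congrArg c (funext fun i => h i v w x fun j hj => hvw j (mem_iUnion.2 ⟨i, hj⟩))
  | sup φ ih =>
    obtain ⟨S, hS, h⟩ := ih
    exact ⟨S, hS, fun v w x hvw => by simp only [Formula.eval, h v w _ hvw]⟩
  | inf φ ih =>
    obtain ⟨S, hS, h⟩ := ih
    exact ⟨S, hS, fun v w x hvw => by simp only [Formula.eval, h v w _ hvw]⟩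

/-- Every formula is equivalent to one with finitely many free variables. -/
theorem exists_finite_relabel {α : Type v} (φ : Formula α 0) :
    ∃ (S : Set α) (ψ : Formula S 0), S.Finite ∧
      ∀ {M : Type w} [LRV.Structure M] [MetricSpace M] (v : α → M),
        φ.eval v Fin.elim0 = ψ.eval (fun i : S => v i) Fin.elim0 := by
  classical
  obtain ⟨S, hS, h⟩ := exists_finite_support.{v, w} φ
  rcases isEmpty_or_nonempty α with hα | ⟨⟨a₀⟩⟩
  · exact ⟨∅, relabelFormula (fun a => hα.elim a) φ, finite_empty, fun v => by
      rw [eval_relabelFormula]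
      exact h _ _ _ fun i => hα.elim i⟩
  · refine ⟨insert a₀ S, relabelFormula (fun a => if h : a ∈ S then ⟨a, Or.inr h⟩ else
      ⟨a₀, Or.inl rfl⟩) φ, hS.insert a₀, fun v => ?_⟩
    rw [eval_relabelFormula]
    refine h _ _ _ fun i hi => ?_
    rw [dif_pos hi]

/-- A formula with parameters in `A` and the free variables `x̄` involves finitely many parameters
only. -/
theorem exists_finite_parameters {α : Type v} {n : ℕ} (φ : Formula (α ⊕ Fin n) 0) :
    ∃ (S : Set α) (ψ : Formula (S ⊕ Fin n) 0), S.Finite ∧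
      ∀ {M : Type w} [LRV.Structure M] [MetricSpace M] (v : α → M) (X : Fin n → M),
        φ.eval (Sum.elim v X) Fin.elim0 = ψ.eval (Sum.elim (fun i : S => v i) X) Fin.elim0 := by
  obtain ⟨S, ψ, hS, hψ⟩ := exists_finite_relabel.{v, w} φ
  let g : S → (Sum.inl ⁻¹' S : Set α) ⊕ Fin n := fun i =>
    match i with
    | ⟨.inl a, h⟩ => .inl ⟨a, h⟩
    | ⟨.inr j, _⟩ => .inr j
  refine ⟨Sum.inl ⁻¹' S, relabelFormula g ψ, hS.preimage Sum.inl_injective.injOn, fun v X => ?_⟩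
  rw [hψ, eval_relabelFormula]
  congr 1
  funext i
  rcases i with ⟨a | j, h⟩ <;> rfl

theorem eval_elim0_eq_of_law_eq {α : Type v} [Finite α] (φ : Formula α 0) {Ω₁ Ω₂ : Type w}
    [MeasurableSpace Ω₁] [MeasurableSpace Ω₂] {P₁ : Measure Ω₁}
    {P₂ : Measure Ω₂} [IsProbabilityMeasure P₁] [IsProbabilityMeasure P₂]
    (hP₁ : Atomless P₁) (hP₂ : Atomless P₂) (v₁ : α → RVSpace P₁) (v₂ : α → RVSpace P₂)
    (h : law v₁ = law v₂) : φ.eval v₁ Fin.elim0 = φ.eval v₂ Fin.elim0 := by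
  refine eval_eq_of_law_eq φ hP₁ hP₂ _ _ _ _ ?_
  have e : ∀ {Ω : Type w} [MeasurableSpace Ω] {P : Measure Ω} [IsProbabilityMeasure P]
      (v : α → RVSpace P), Sum.elim v (Fin.elim0 (α := RVSpace P)) =
        fun j => v (j.elim id (fun k => k.elim0)) := by
    intro Ω _ P _ v
    funext j
    rcases j with i | k
    · rfl
    · exact k.elim0
  rw [e, e]
  exact law_comp_eq h _

end Relabel

/-! ### Law-preserving maps -/

section LawPreserving

variable {Ω : Type*} [mΩ : MeasurableSpace Ω] {P : Measure Ω} [IsProbabilityMeasure P]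
variable {Ω' : Type*} [mΩ' : MeasurableSpace Ω'] {P' : Measure Ω'} [IsProbabilityMeasure P']

/-- The formula whose value is the expectation of a term. -/
def expFormula {α : Type v} (t : LRV.Term α) : Formula α 0 :=
  .dist (t.relabel Sum.inl) (.func Func.zero Fin.elim0)

theorem coe_eval_expFormula {α : Type v} (t : LRV.Term α) (v : α → RVSpace P) :
    ((expFormula t).eval v Fin.elim0 : ℝ) = dist (t.realize v) zeroOp := by
  simp only [expFormula, Formula.eval, FirstOrder.Language.Term.realize_relabel, Sum.elim_comp_inl]
  have : (FirstOrder.Language.Term.func Func.zero Fin.elim0 : LRV.Term (α ⊕ Fin 0)).realize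
      (Sum.elim v Fin.elim0) = (zeroOp : RVSpace P) := by
    rw [FirstOrder.Language.Term.realize_func]
    exact congrArg _ (funext fun i => i.elim0)
  rw [this, projIcc_of_mem _ ⟨dist_nonneg, dist_le_one _ _⟩]

/-- The map `f` preserves the joint laws of finite tuples. -/
def LawPreserving (f : RVSpace P → RVSpace P') : Prop :=
  ∀ (k : ℕ) (a : Fin k → RVSpace P), law (fun i => f (a i)) = law a

/-- Expectations of terms are values of formulas, and they determine joint laws. -/
theorem ElemEmb.lawPreserving (f : ElemEmb (RVSpace P) (RVSpace P')) : LawPreserving f := by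
  intro k a
  refine law_eq_of_terms fun t => ?_
  rw [← coe_eval_expFormula, ← coe_eval_expFormula, f.elementary]

variable {f : RVSpace P → RVSpace P'}

theorem LawPreserving.law_eq (hf : LawPreserving f) {ι : Type*} [Finite ι] (a : ι → RVSpace P) :
    law (fun i => f (a i)) = law a := by
  obtain ⟨k, ⟨e⟩⟩ := Finite.exists_equiv_fin ι
  have h := law_comp_eq (hf k fun i => a (e.symm i)) e
  simpa only [Equiv.symm_apply_apply] using h

theorem LawPreserving.integral_eq (hf : LawPreserving f) {ι : Type*} [Finite ι]
    (a : ι → RVSpace P) {θ : (ι → I) → ℝ} (hθ : Measurable θ) :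
    ∫ ω, θ (fun i => rv (f (a i)) ω) ∂P' = ∫ ω, θ (fun i => rv (a i) ω) ∂P := by
  rw [← integral_map (measurable_rv_pi _).aemeasurable hθ.aestronglyMeasurable,
    ← integral_map (measurable_rv_pi _).aemeasurable hθ.aestronglyMeasurable]
  exact congrArg (fun μ => ∫ z, θ z ∂μ) (hf.law_eq a)

theorem LawPreserving.isometry (hf : LawPreserving f) : Isometry f := by
  refine Isometry.of_dist_eq fun x y => ?_
  rw [dist_eq, dist_eq]
  exact hf.integral_eq ![x, y] (θ := fun z => dist (z 0) (z 1)) (by fun_prop)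

/-- The random variable `g(X)`, for a Borel function `g`. -/
noncomputable def comp {ι : Type*} {g : (ι → I) → I} (hg : Measurable g) (X : ι → RVSpace P) :
    RVSpace P :=
  ofRV (fun ω => g fun i => rv (X i) ω) (hg.comp (measurable_rv_pi X))

theorem rv_comp {ι : Type*} {g : (ι → I) → I} (hg : Measurable g) (X : ι → RVSpace P) :
    ∀ᵐ ω ∂P, rv (comp hg X) ω = g fun i => rv (X i) ω := rv_ofRV _

/-- Law-preserving maps commute with all Borel functions: `y = g(x)` is an almost sure property of
the joint law of `x` and `y`. -/
theorem LawPreserving.map_comp (hf : LawPreserving f) {ι : Type*} [Finite ι] {g : (ι → I) → I}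
    (hg : Measurable g) (X : ι → RVSpace P) : f (comp hg X) = comp hg fun i => f (X i) := by
  refine rv_ext (Filter.EventuallyEq.trans ?_ (Filter.EventuallyEq.symm (rv_comp hg _)))
  have hlaw := hf.law_eq fun o : Option ι => o.elim (comp hg X) X
  have hS : MeasurableSet {z : Option ι → I | z none = g fun i => z (some i)} :=
    measurableSet_eq_fun (measurable_pi_apply _)
      (hg.comp (measurable_pi_lambda _ fun i => measurable_pi_apply _))
  have h1 : ∀ᵐ z ∂law (fun o : Option ι => o.elim (comp hg X) X),
      z none = g fun i => z (some i) :=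
    (ae_map_iff (measurable_rv_pi _).aemeasurable hS).2 (rv_comp hg X)
  rw [← hlaw] at h1
  exact (ae_map_iff (measurable_rv_pi _).aemeasurable hS).1 h1

theorem funMap_eq_comp {k : ℕ} (F : Func k) (x : Fin k → RVSpace P) :
    FirstOrder.Language.Structure.funMap (L := LRV) F x = comp (continuous_funMap F).measurable x :=
  rv_ext (Filter.EventuallyEq.trans (rv_funMap F x) (Filter.EventuallyEq.symm (rv_comp _ x)))

theorem LawPreserving.map_funMap (hf : LawPreserving f) {k : ℕ} (F : Func k)
    (x : Fin k → RVSpace P) : f (FirstOrder.Language.Structure.funMap (L := LRV) F x) =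
      FirstOrder.Language.Structure.funMap (L := LRV) F fun i => f (x i) := by
  rw [funMap_eq_comp, hf.map_comp, ← funMap_eq_comp]

end LawPreserving

/-! ### Closed substructures and `σ(A)` -/

section ClosedSub

/-- Measurability of the class `Z` with respect to `m` only concerns some representative; `rv Z`
itself need not be `m`-measurable. -/
theorem aestronglyMeasurable_iff {Ω : Type*} {m : MeasurableSpace Ω} [mΩ : MeasurableSpace Ω]
    {P : Measure Ω} [IsProbabilityMeasure P] {Z : RVSpace P} :
    AEStronglyMeasurable[m] Z.1 P ↔ ∃ g : Ω → I, Measurable[m] g ∧ rv Z =ᵐ[P] g := by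
  constructor
  · rintro ⟨g, hg, h⟩
    refine ⟨fun ω => projIcc 0 1 zero_le_one (g ω),
      continuous_projIcc.measurable.comp hg.measurable, ?_⟩
    filter_upwards [h] with ω h
    rw [rv, h]
  · rintro ⟨g, hg, h⟩
    refine ⟨fun ω => g ω, (measurable_subtype_coe.comp hg).stronglyMeasurable, ?_⟩
    filter_upwards [h, coe_rv Z] with ω h h'
    rw [← h', h]

variable {Ω : Type*} [mΩ : MeasurableSpace Ω] {P : Measure Ω} [IsProbabilityMeasure P]

theorem tendsto_of_ae {F : ℕ → RVSpace P} {f : RVSpace P}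
    (h : ∀ᵐ ω ∂P, Filter.Tendsto (fun n => rv (F n) ω) Filter.atTop (nhds (rv f ω))) :
    Filter.Tendsto F Filter.atTop (nhds f) := by
  rw [tendsto_iff_dist_tendsto_zero]
  simp only [dist_eq]
  have := tendsto_integral_of_dominated_convergence (μ := P)
    (F := fun n ω => dist (rv (F n) ω) (rv f ω)) (f := fun _ => (0 : ℝ)) (fun _ => 1)
    (fun n => (integrable_dist (measurable_rv _) (measurable_rv _)).1) (integrable_const _)
    (fun n => Filter.Eventually.of_forall fun ω => by
      rw [Real.norm_of_nonneg dist_nonneg]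
      exact Real.dist_le_of_mem_Icc_01 (rv (F n) ω).2 (rv f ω).2)
    (h.mono fun ω hω => tendsto_iff_dist_tendsto_zero.1 hω)
  simpa using this

/-- The indicator function of an event. -/
noncomputable def ind {E : Set Ω} (hE : MeasurableSet E) : RVSpace P :=
  ofRV (E.indicator fun _ => 1) (measurable_const.indicator hE)

theorem rv_ind {E : Set Ω} (hE : MeasurableSet E) :
    rv (ind hE : RVSpace P) =ᵐ[P] E.indicator fun _ => 1 := rv_ofRV _

theorem ind_congr {E F : Set Ω} {hE : MeasurableSet E} {hF : MeasurableSet F} (h : E =ᵐ[P] F) :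
    (ind hE : RVSpace P) = ind hF :=
  ofRV_congr (indicator_ae_eq_of_ae_eq_set h)

/-- Closed subsets of `L₁(Ω,[0,1])` that are closed under the operations. -/
structure IsClosedSub (D : Set (RVSpace P)) : Prop where
  isClosed : IsClosed D
  funMap_mem : ∀ {k : ℕ} (F : Func k) (x : Fin k → RVSpace P), (∀ i, x i ∈ D) →
    FirstOrder.Language.Structure.funMap (L := LRV) F x ∈ D

variable {D : Set (RVSpace P)}

theorem IsClosedSub.realize_mem (hD : IsClosedSub D) {α : Type*} (t : LRV.Term α)
    {X : α → RVSpace P} (hX : ∀ i, X i ∈ D) : t.realize X ∈ D := by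
  induction t with
  | var i => exact hX i
  | func F ts ih => exact hD.funMap_mem F _ ih

/-- Continuous functions are limits of terms, so closed substructures are closed under them. -/
theorem IsClosedSub.comp_mem (hD : IsClosedSub D) {ι : Type*} [Finite ι] {θ : (ι → I) → I}
    (hθ : Continuous θ) {X : ι → RVSpace P} (hX : ∀ i, X i ∈ D) : comp hθ.measurable X ∈ D := by
  refine hD.isClosed.closure_subset (Metric.mem_closure_iff.2 fun ε hε => ?_)
  obtain ⟨t, ht⟩ := exists_term_approx hθ (half_pos hε)
  refine ⟨_, hD.realize_mem t hX, (dist_le_of_ae ?_).trans_lt (half_lt_self hε)⟩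
  filter_upwards [rv_comp hθ.measurable X, rv_realize t X] with ω h1 h2
  rw [h1, h2, dist_comm]
  exact ht _

theorem IsClosedSub.zero_mem (hD : IsClosedSub D) : (zeroOp : RVSpace P) ∈ D :=
  hD.funMap_mem _ _ fun i => i.elim0

theorem IsClosedSub.ind_compl_mem (hD : IsClosedSub D) {E : Set Ω} {hE : MeasurableSet E}
    (h : ind hE ∈ D) : ind hE.compl ∈ D := by
  have h1 := hD.comp_mem (θ := fun z : Unit → I => σ (z ()))
    (by fun_prop) (X := fun _ => ind hE) fun _ => h
  convert h1 using 1
  refine rv_ext ?_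
  filter_upwards [rv_ind (P := P) hE, rv_ind (P := P) hE.compl, rv_comp (P := P)
    (g := fun z : Unit → I => σ (z ())) (by fun_prop) fun _ => ind hE] with ω a b c
  rw [b, c, a]
  by_cases hω : ω ∈ E <;> simp [hω]

theorem IsClosedSub.ind_union_mem (hD : IsClosedSub D) {E F : Set Ω} {hE : MeasurableSet E}
    {hF : MeasurableSet F} (h : ind hE ∈ D) (h' : ind hF ∈ D) : ind (hE.union hF) ∈ D := by
  have h1 := hD.comp_mem (θ := fun z : Fin 2 → I => max (z 0) (z 1))
    (by fun_prop) (X := ![ind hE, ind hF]) fun i => by fin_cases i <;> assumption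
  convert h1 using 1
  refine rv_ext ?_
  filter_upwards [rv_ind (P := P) hE, rv_ind (P := P) hF, rv_ind (P := P) (hE.union hF), rv_comp
    (P := P) (g := fun z : Fin 2 → I => max (z 0) (z 1)) (by fun_prop) ![ind hE, ind hF]]
    with ω a b c d
  rw [c, d]
  change _ = max (rv (ind hE) ω) (rv (ind hF) ω)
  rw [a, b]
  by_cases hω : ω ∈ E <;> by_cases hω' : ω ∈ F <;> simp [hω, hω']

/-- The events whose indicator functions belong to a closed substructure form a `σ`-algebra. -/
@[reducible] def IsClosedSub.events (hD : IsClosedSub D) : MeasurableSpace Ω where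
  MeasurableSet' E := ∃ hE : MeasurableSet[mΩ] E, ind hE ∈ D
  measurableSet_empty := ⟨.empty, by
    convert hD.zero_mem using 1
    refine rv_ext ?_
    filter_upwards [rv_ind (P := P) MeasurableSet.empty, rv_funMap (P := P) Func.zero Fin.elim0]
      with ω a b
    rw [a, b, indicator_empty]
    rfl⟩
  measurableSet_compl E := by
    rintro ⟨hE, h⟩
    exact ⟨hE.compl, hD.ind_compl_mem h⟩
  measurableSet_iUnion E hE := by
    choose hE h using hE
    refine ⟨.iUnion hE, ?_⟩
    have hm : ∀ n, MeasurableSet (partialSups E n) := fun n => by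
      induction n with
      | zero => simpa using hE 0
      | succ n ih => rw [partialSups_add_one]; exact ih.union (hE _)
    have hmem : ∀ n, ind (hm n) ∈ D := fun n => by
      induction n with
      | zero =>
        have := h 0
        simpa only [partialSups_zero] using this
      | succ n ih =>
        have := hD.ind_union_mem ih (h (n + 1))
        simpa only [partialSups_add_one] using! this
    refine hD.isClosed.mem_of_tendsto (tendsto_of_ae ?_) (Filter.Eventually.of_forall hmem)
    filter_upwards [rv_ind (P := P) (.iUnion hE), ae_all_iff.2 fun n => rv_ind (P := P) (hm n)]
      with ω a b
    rw [a]
    simp only [b]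
    have := (partialSups E).monotone.tendsto_indicator _ (fun _ => (1 : I)) ω
    rw [show (⋃ i, partialSups E i) = ⋃ i, E i from iSup_partialSups_eq E] at this
    exact this.mono_right (pure_le_nhds _)

/-- The indicator of `{X > r}` is the limit of the truncations of `n (X - r)`, which are continuous
functions of `X`. -/
theorem IsClosedSub.measurable_of_mem (hD : IsClosedSub D) {X : RVSpace P} (hX : X ∈ D) :
    Measurable[hD.events] X.1 := by
  refine measurable_of_Ioi (mδ := hD.events) fun r => ?_
  have hE : MeasurableSet (X.1 ⁻¹' Ioi r) :=
    (Lp.stronglyMeasurable X.1).measurable measurableSet_Ioi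
  refine ⟨hE, ?_⟩
  let θ : ℕ → (Unit → I) → I := fun n z => ⟨clip (n * ((z () : ℝ) - r)), clip_mem _⟩
  have hθ : ∀ n, Continuous (θ n) := fun n => Continuous.subtype_mk
    (f := fun z : Unit → I => clip (n * ((z () : ℝ) - r))) (by unfold clip; fun_prop) _
  refine hD.isClosed.mem_of_tendsto (tendsto_of_ae ?_)
    (Filter.Eventually.of_forall fun n => hD.comp_mem (hθ n) (X := fun _ => X) fun _ => hX)
  filter_upwards [rv_ind (P := P) hE, ae_all_iff.2 fun n => rv_comp (hθ n).measurable fun _ => X,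
    coe_rv X] with ω a b c
  rw [a]
  simp only [b, θ]
  by_cases h : r < X.1 ω
  · rw [indicator_of_mem (show ω ∈ X.1 ⁻¹' Ioi r from h)]
    refine tendsto_const_nhds.congr' ?_
    obtain ⟨n₀, hn₀⟩ := exists_nat_gt (1 / (X.1 ω - r))
    filter_upwards [Filter.eventually_ge_atTop n₀] with n hn
    refine Subtype.ext ?_
    have hpos := sub_pos.2 h
    rw [div_lt_iff₀ hpos] at hn₀
    have : (n₀ : ℝ) ≤ n := by exact_mod_cast hn
    have h1 : 1 ≤ (n : ℝ) * (X.1 ω - r) := by nlinarith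
    simp only [c, clip]
    rw [min_eq_left h1, max_eq_right zero_le_one]
    rfl
  · rw [indicator_of_notMem (show ω ∉ X.1 ⁻¹' Ioi r from h)]
    refine tendsto_const_nhds.congr fun n => Subtype.ext ?_
    have h1 : (n : ℝ) * (X.1 ω - r) ≤ 0 :=
      mul_nonpos_of_nonneg_of_nonpos n.cast_nonneg (sub_nonpos.2 (not_lt.1 h))
    simp only [c, clip]
    rw [min_eq_right (h1.trans zero_le_one), max_eq_left h1]
    rfl

/-- The number of levels `1, …, m` that are at most `m y`. -/
theorem sum_ite_le_eq_floor {m : ℕ} {y : ℝ} (hy : y ∈ Icc (0 : ℝ) 1) :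
    ∑ j : Fin m, (if ((j : ℕ) + 1 : ℝ) ≤ m * y then (1 : ℝ) else 0) = ⌊m * y⌋₊ := by
  have h0 : 0 ≤ m * y := mul_nonneg m.cast_nonneg hy.1
  have hle : ⌊m * y⌋₊ ≤ m := Nat.floor_le_of_le (mul_le_of_le_one_right m.cast_nonneg hy.2)
  have : ∀ j : ℕ, ((j : ℝ) + 1 ≤ m * y) ↔ j < ⌊m * y⌋₊ := fun j => by
    rw [← Nat.add_one_le_iff, Nat.le_floor_iff h0]
    push_cast
    rfl
  simp only [this]
  rw [Fin.sum_univ_eq_sum_range (fun j => if j < ⌊m * y⌋₊ then (1 : ℝ) else 0) m]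
  rw [Finset.sum_ite, Finset.sum_const_zero, add_zero, Finset.sum_const, nsmul_one]
  congr 1
  rw [show (Finset.range m).filter (fun j => j < ⌊m * y⌋₊) = Finset.range ⌊m * y⌋₊ by
    ext j; simp; omega, Finset.card_range]

/-- A closed substructure contains every random variable that is measurable with respect to its
`σ`-algebra of events: the average of the indicators of `{m g ≥ 1}, …, {m g ≥ m}` is `⌊m g⌋ / m`,
which is within `1 / m` of `g`. -/
theorem IsClosedSub.mem_of_aestronglyMeasurable (hD : IsClosedSub D) {Z : RVSpace P}
    (hZ : AEStronglyMeasurable[hD.events] Z.1 P) : Z ∈ D := by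
  obtain ⟨g, hg, h⟩ := aestronglyMeasurable_iff.1 hZ
  refine hD.isClosed.closure_subset (Metric.mem_closure_iff.2 fun ε hε => ?_)
  obtain ⟨m, hm⟩ := exists_nat_gt (2 / ε)
  have hm0 : (0 : ℝ) < m := (by positivity : 0 < 2 / ε).trans hm
  have hE : ∀ j : Fin m, MeasurableSet[hD.events] {ω | ((j : ℕ) + 1 : ℝ) ≤ m * (g ω : ℝ)} :=
    fun j => by
      let := hD.events
      exact measurableSet_le measurable_const ((measurable_subtype_coe.comp hg).const_mul (m : ℝ))
  choose hE hED using hE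
  let θ : (Fin m → I) → I := fun z => ⟨(∑ j, (z j : ℝ)) / m,
    div_nonneg (Finset.sum_nonneg fun j _ => (z j).2.1) hm0.le, by
      rw [div_le_one hm0]
      refine (Finset.sum_le_card_nsmul _ _ 1 fun j _ => (z j).2.2).trans (by simp)⟩
  have hθ : Continuous θ := Continuous.subtype_mk (by fun_prop) _
  refine ⟨_, hD.comp_mem hθ hED, (dist_le_of_ae (c := ε / 2) ?_).trans_lt (half_lt_self hε)⟩
  filter_upwards [h, rv_comp hθ.measurable fun j => ind (hE j),
    ae_all_iff.2 fun j => rv_ind (P := P) (hE j)] with ω a b c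
  rw [a, b]
  simp only [c, θ]
  rw [Subtype.dist_eq, Real.dist_eq]
  have hsum : ∑ j : Fin m, (({ω | ((j : ℕ) + 1 : ℝ) ≤ m * (g ω : ℝ)}.indicator
      (fun _ => (1 : I)) ω : I) : ℝ) = ⌊m * (g ω : ℝ)⌋₊ := by
    rw [← sum_ite_le_eq_floor (g ω).2]
    refine Finset.sum_congr rfl fun j _ => ?_
    by_cases hj : ((j : ℕ) + 1 : ℝ) ≤ m * (g ω : ℝ) <;> simp [indicator, hj]
  simp only [hsum]
  have h1 : ((⌊m * (g ω : ℝ)⌋₊ : ℕ) : ℝ) ≤ m * g ω :=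
    Nat.floor_le (mul_nonneg hm0.le (g ω).2.1)
  have h2 := Nat.lt_floor_add_one (m * (g ω : ℝ))
  rw [div_lt_iff₀ hε] at hm
  rw [show (g ω : ℝ) - (⌊m * (g ω : ℝ)⌋₊ : ℕ) / m = (m * g ω - (⌊m * (g ω : ℝ)⌋₊ : ℕ)) / m by
    field_simp, abs_div, abs_of_pos hm0, div_le_iff₀ hm0, abs_le]
  constructor <;> linarith

theorem IsClosedSub.sigmaAlg_le_events (hD : IsClosedSub D) {A : Set (RVSpace P)} (hA : A ⊆ D) :
    sigmaAlg A ≤ hD.events := by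
  refine MeasurableSpace.generateFrom_le ?_
  rintro s (⟨hs, h0⟩ | ⟨X, hX, B, hB, rfl⟩)
  · refine ⟨hs, ?_⟩
    have h := @MeasurableSet.empty Ω hD.events
    obtain ⟨h1, h2⟩ := h
    rwa [ind_congr (ae_eq_empty.2 h0 : s =ᵐ[P] (∅ : Set Ω))]
  · exact hD.measurable_of_mem (hA hX) hB

/-- `L₁(σ(A),[0,1])` is contained in every closed substructure that contains `A`. -/
theorem IsClosedSub.mem_of_sigmaAlg (hD : IsClosedSub D) {A : Set (RVSpace P)} (hA : A ⊆ D)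
    {Z : RVSpace P} (hZ : AEStronglyMeasurable[sigmaAlg A] Z.1 P) : Z ∈ D :=
  hD.mem_of_aestronglyMeasurable (hZ.mono (hD.sigmaAlg_le_events hA))

end ClosedSub

/-! ### Measurability with respect to `σ(A)` under law-preserving maps -/

section Pullback

theorem aestronglyMeasurable_comp {Ω : Type*} {m : MeasurableSpace Ω} [mΩ : MeasurableSpace Ω]
    {P : Measure Ω} [IsProbabilityMeasure P] {ι : Type*} [Countable ι] {g : (ι → I) → I}
    (hg : Measurable g) {X : ι → RVSpace P} (hX : ∀ i, AEStronglyMeasurable[m] (X i).1 P) :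
    AEStronglyMeasurable[m] (comp hg X).1 P := by
  choose F hF h using fun i => aestronglyMeasurable_iff.1 (hX i)
  refine aestronglyMeasurable_iff.2 ⟨fun ω => g fun i => F i ω,
    hg.comp (@measurable_pi_lambda _ _ _ m _ _ hF), ?_⟩
  filter_upwards [rv_comp hg X, ae_all_iff.2 h] with ω a b
  rw [a]
  simp only [b]

theorem isClosedSub_aestronglyMeasurable {Ω : Type*} {m : MeasurableSpace Ω}
    [mΩ : MeasurableSpace Ω] {P : Measure Ω} [IsProbabilityMeasure P] (hm : m ≤ mΩ) :
    IsClosedSub {Z : RVSpace P | AEStronglyMeasurable[m] Z.1 P} where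
  isClosed := (isClosed_aestronglyMeasurable (F := ℝ) (p := 1) (μ := P) hm).preimage
    continuous_subtype_val
  funMap_mem F x hx := by
    rw [funMap_eq_comp]
    exact aestronglyMeasurable_comp _ hx

theorem aestronglyMeasurable_ind {Ω : Type*} {m : MeasurableSpace Ω} [mΩ : MeasurableSpace Ω]
    {P : Measure Ω} [IsProbabilityMeasure P] (hm : m ≤ mΩ) {E : Set Ω}
    (hE : MeasurableSet[m] E) :
    AEStronglyMeasurable[m] (ind (P := P) (hm E hE)).1 P :=
  aestronglyMeasurable_iff.2 ⟨_, (@measurable_const _ _ _ m _).indicator hE, rv_ind _⟩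

variable {Ω : Type*} [mΩ : MeasurableSpace Ω] {P : Measure Ω} [IsProbabilityMeasure P]
variable {Ω' : Type*} [mΩ' : MeasurableSpace Ω'] {P' : Measure Ω'} [IsProbabilityMeasure P']

theorem aestronglyMeasurable_of_mem {A : Set (RVSpace P)} {X : RVSpace P} (hX : X ∈ A) :
    AEStronglyMeasurable[sigmaAlg A] X.1 P := by
  have h : Measurable[sigmaAlg A] X.1 := fun B hB =>
    MeasurableSpace.measurableSet_generateFrom (Or.inr ⟨X, hX, B, hB, rfl⟩)
  exact h.stronglyMeasurable.aestronglyMeasurable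

instance : CompleteSpace (RVSpace P) := by
  have : IsClosed {f : Lp ℝ 1 P | 0 ≤ f ∧ f ≤ one P} := isClosed_Icc
  exact this.completeSpace_coe

variable {f : RVSpace P → RVSpace P'}

theorem LawPreserving.preimage_isClosedSub (hf : LawPreserving f) {D : Set (RVSpace P')}
    (hD : IsClosedSub D) : IsClosedSub (f ⁻¹' D) where
  isClosed := hD.isClosed.preimage hf.isometry.continuous
  funMap_mem F x hx := by
    rw [mem_preimage, hf.map_funMap]
    exact hD.funMap_mem F _ hx

theorem LawPreserving.image_isClosedSub (hf : LawPreserving f) {D : Set (RVSpace P)}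
    (hD : IsClosedSub D) : IsClosedSub (f '' D) where
  isClosed := hf.isometry.isClosedEmbedding.isClosedMap _ hD.isClosed
  funMap_mem F x hx := by
    choose y hy hyx using hx
    exact ⟨_, hD.funMap_mem F y hy, by rw [hf.map_funMap]; simp only [hyx]⟩

/-- The random variables whose images are `σ(f(A))`-measurable form a closed substructure that
contains `A`. -/
theorem LawPreserving.aestronglyMeasurable_map (hf : LawPreserving f) {A : Set (RVSpace P)}
    {Z : RVSpace P} (hZ : AEStronglyMeasurable[sigmaAlg A] Z.1 P) :
    AEStronglyMeasurable[sigmaAlg (f '' A)] (f Z).1 P' :=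
  (hf.preimage_isClosedSub (isClosedSub_aestronglyMeasurable (sigmaAlg_le _))).mem_of_sigmaAlg
    (fun _ hX => aestronglyMeasurable_of_mem (mem_image_of_mem f hX)) hZ

/-- The map `f` identifies `L₁(σ(A),[0,1])` with `L₁(σ(f(A)),[0,1])`: the image of the former is
closed, as `f` is an isometry of complete spaces, and so it is a closed substructure that contains
`f(A)`. -/
theorem LawPreserving.exists_map_eq (hf : LawPreserving f) {A : Set (RVSpace P)}
    {Z : RVSpace P'} (hZ : AEStronglyMeasurable[sigmaAlg (f '' A)] Z.1 P') :
    ∃ Y : RVSpace P, AEStronglyMeasurable[sigmaAlg A] Y.1 P ∧ f Y = Z :=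
  (hf.image_isClosedSub (isClosedSub_aestronglyMeasurable (sigmaAlg_le A))).mem_of_sigmaAlg
    (image_mono fun _ hX => aestronglyMeasurable_of_mem hX) hZ

end Pullback

/-! ### Conditional distributions as families of scalar measures -/

section Weighted

variable {Ω : Type*} {𝒜 : MeasurableSpace Ω} [mΩ : MeasurableSpace Ω] {P : Measure Ω}
  [IsProbabilityMeasure P]

theorem integrable_rv_mul (Y : RVSpace P) (f : Lp ℝ 1 P) :
    Integrable (fun ω => (rv Y ω : ℝ) * f ω) P :=
  (L1.integrable_coeFn f).bdd_mul (c := 1)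
    (measurable_subtype_coe.comp (measurable_rv Y)).aestronglyMeasurable
    (Filter.Eventually.of_forall fun ω => by
      rw [Real.norm_of_nonneg (rv Y ω).2.1]
      exact (rv Y ω).2.2)

/-- The functional `f ↦ E[Y f]` on `L₁(Ω)`, for a `[0,1]`-valued random variable `Y`. -/
noncomputable def pairing (Y : RVSpace P) : Lp ℝ 1 P →L[ℝ] ℝ :=
  LinearMap.mkContinuous
    { toFun := fun f => ∫ ω, (rv Y ω : ℝ) * f ω ∂P
      map_add' := fun f g => by
        rw [← integral_add (integrable_rv_mul Y f) (integrable_rv_mul Y g)]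
        refine integral_congr_ae ?_
        filter_upwards [Lp.coeFn_add f g] with ω h
        rw [h, Pi.add_apply, mul_add]
      map_smul' := fun c f => by
        rw [RingHom.id_apply, smul_eq_mul, ← integral_const_mul]
        refine integral_congr_ae ?_
        filter_upwards [Lp.coeFn_smul c f] with ω h
        rw [h, Pi.smul_apply, smul_eq_mul, mul_left_comm] } 1 fun f => by
    rw [one_mul, L1.norm_eq_integral_norm]
    refine norm_integral_le_of_norm_le (L1.integrable_coeFn f).norm
      (Filter.Eventually.of_forall fun ω => ?_)
    rw [norm_mul, Real.norm_of_nonneg (rv Y ω).2.1]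
    exact mul_le_of_le_one_left (norm_nonneg _) (rv Y ω).2.2

theorem pairing_apply (Y : RVSpace P) (f : Lp ℝ 1 P) :
    pairing Y f = ∫ ω, (rv Y ω : ℝ) * f ω ∂P := rfl

theorem abs_pairing_le (Y : RVSpace P) (f : Lp ℝ 1 P) : |pairing Y f| ≤ ‖f‖ := by
  have := (pairing Y).le_of_opNorm_le (LinearMap.mkContinuous_norm_le _ zero_le_one _) f
  rwa [one_mul] at this

theorem pairing_coe (Y Z : RVSpace P) :
    pairing Y Z.1 = ∫ ω, (rv Y ω : ℝ) * rv Z ω ∂P := by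
  refine integral_congr_ae ?_
  filter_upwards [coe_rv Z] with ω h
  rw [h]

theorem pairing_coe_nonneg (Y Z : RVSpace P) : 0 ≤ pairing Y Z.1 := by
  rw [pairing_coe]
  exact integral_nonneg fun ω => mul_nonneg (rv Y ω).2.1 (rv Z ω).2.1

variable {n : ℕ}

theorem CondDist.apply_of_not_measurable (μ : CondDist 𝒜 P n) {B : Set (Fin n → ℝ)}
    (hB : ¬ MeasurableSet B) : (μ.apply B).1 = 0 := μ.1.not_measurable hB

/-- The finite Borel measure `B ↦ E[Y μ(B)]`. The measures for all `𝒜`-measurable `Y` together carry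
the same information as `μ`. -/
noncomputable def weighted (μ : CondDist 𝒜 P n) (Y : RVSpace P) : Measure (Fin n → ℝ) :=
  SignedMeasure.toMeasureOfZeroLE
    (μ.1.mapRange (pairing Y : Lp ℝ 1 P →+ ℝ) (pairing Y).continuous) univ .univ
    ((VectorMeasure.le_restrict_univ_iff_le _ _).2 fun B _ => pairing_coe_nonneg Y (μ.apply B))

instance (μ : CondDist 𝒜 P n) (Y : RVSpace P) : IsFiniteMeasure (weighted μ Y) := by
  unfold weighted
  infer_instance

theorem weighted_real (μ : CondDist 𝒜 P n) (Y : RVSpace P) {B : Set (Fin n → ℝ)}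
    (hB : MeasurableSet B) : (weighted μ Y).real B = pairing Y (μ.apply B).1 := by
  rw [weighted, SignedMeasure.toMeasureOfZeroLE_real_apply _ _ _ hB, univ_inter]
  rfl

/-- The constant random variable `1`. -/
noncomputable def oneRV : RVSpace P := ofRV (fun _ => 1) measurable_const

theorem rv_oneRV : ∀ᵐ ω ∂P, rv (oneRV : RVSpace P) ω = 1 := rv_ofRV _

theorem aestronglyMeasurable_oneRV : AEStronglyMeasurable[𝒜] (oneRV : RVSpace P).1 P :=
  aestronglyMeasurable_iff.2 ⟨fun _ => 1, @measurable_const _ _ _ 𝒜 _, rv_ofRV _⟩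

theorem norm_eq_pairing_oneRV (Z : RVSpace P) : ‖Z.1‖ = pairing oneRV Z.1 := by
  rw [L1.norm_eq_integral_norm, pairing_apply]
  refine integral_congr_ae ?_
  filter_upwards [rv_oneRV (P := P), ae_mem_Icc Z] with ω a b
  rw [a, Icc.coe_one, one_mul, Real.norm_of_nonneg b.1]

theorem variation_le_weighted_oneRV (μ : CondDist 𝒜 P n) :
    μ.1.variation ≤ weighted μ oneRV := by
  refine VectorMeasure.variation_le_of_forall_enorm_le fun B hB => ?_
  rw [← ofReal_measureReal, weighted_real μ _ hB, ← ofReal_norm]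
  exact ENNReal.ofReal_le_ofReal (norm_eq_pairing_oneRV (μ.apply B)).le

/-- As `μ` takes positive values in `L₁`, its variation is finite: it is at most `B ↦ E[μ(B)]`. -/
instance (μ : CondDist 𝒜 P n) : IsFiniteMeasure μ.1.variation :=
  isFiniteMeasure_of_le (weighted μ oneRV) (variation_le_weighted_oneRV μ)

theorem weighted_le (μ : CondDist 𝒜 P n) (Y : RVSpace P) : weighted μ Y ≤ μ.1.variation := by
  refine Measure.le_iff.2 fun B hB => ?_
  rw [← ofReal_measureReal, weighted_real μ Y hB]
  refine le_trans ?_ (μ.1.enorm_measure_le_variation B)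
  rw [← ofReal_norm]
  exact ENNReal.ofReal_le_ofReal ((le_abs_self _).trans (abs_pairing_le Y _))

/-- The functional `E[Y ·]` commutes with integration: this is clear for simple functions, and both
sides are continuous in `L₁` of the variation of `μ`. -/
theorem pairing_integral_of_integrable (μ : CondDist 𝒜 P n) (Y : RVSpace P)
    {f : (Fin n → ℝ) → ℝ} (hf : Integrable f μ.1.variation) :
    pairing Y (∫ᵛ x, f x ∂•μ.1) = ∫ x, f x ∂(weighted μ Y) := by
  have hle := weighted_le μ Y
  apply hf.induction (P := fun f => pairing Y (∫ᵛ x, f x ∂•μ.1) = ∫ x, f x ∂(weighted μ Y))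
  · intro c s hs _
    rw [VectorMeasure.integral_indicator_const _ hs, integral_indicator_const _ hs,
      weighted_real μ Y hs, ContinuousLinearMap.lsmul_apply, map_smul, smul_eq_mul, smul_eq_mul,
      mul_comm]
    rfl
  · intro f g _ hf hg hf' hg'
    simp only [Pi.add_apply]
    rw [VectorMeasure.integral_fun_add hf hg, map_add, hf', hg',
      integral_add (hf.mono_measure hle) (hg.mono_measure hle)]
  · refine isClosed_eq ((pairing Y).continuous.comp VectorMeasure.continuous_integral) ?_
    refine (LipschitzWith.of_dist_le_mul (K := 1) fun f g => ?_).continuous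
    have hf := L1.integrable_coeFn f
    have hg := L1.integrable_coeFn g
    rw [Real.dist_eq, ← integral_sub (hf.mono_measure hle) (hg.mono_measure hle), NNReal.coe_one,
      one_mul, dist_eq_norm, L1.norm_eq_integral_norm]
    refine (abs_integral_le_integral_abs).trans ?_
    have h1 : ∫ x, ‖(f - g) x‖ ∂μ.1.variation = ∫ x, |f x - g x| ∂μ.1.variation := by
      refine integral_congr_ae ?_
      filter_upwards [Lp.coeFn_sub f g] with x h
      rw [h, Real.norm_eq_abs, Pi.sub_apply]
    rw [h1]
    exact integral_mono_measure hle (Filter.Eventually.of_forall fun x => abs_nonneg _)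
      (hf.sub hg).abs
  · intro f g hfg _ hf
    rw [← VectorMeasure.integral_congr_ae hfg, hf]
    exact integral_congr_ae (hle.absolutelyContinuous.ae_eq hfg)

/-- The functions `μ ↦ E[Y ∫ θ dμ]` that define the topology of weak convergence are integrals
with respect to scalar measures. -/
theorem integral_mul_integral (μ : CondDist 𝒜 P n) (Y : RVSpace P) (θ : C(Fin n → ℝ, I)) :
    ∫ ω, Y.1 ω * (∫ᵛ x, (θ x : ℝ) ∂•μ.1) ω ∂P = ∫ x, (θ x : ℝ) ∂(weighted μ Y) := by
  rw [← pairing_integral_of_integrable μ Y (Integrable.of_mem_Icc 0 1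
    (by fun_prop) (Filter.Eventually.of_forall fun x => (θ x).2)), pairing_apply]
  refine integral_congr_ae ?_
  filter_upwards [coe_rv Y] with ω h
  rw [h]

end Weighted

/-! ### Conditional distributions of tuples in an extension -/

theorem condDist_apply {Ω : Type*} {𝒜 : MeasurableSpace Ω} [mΩ : MeasurableSpace Ω]
    {P : Measure Ω} [IsProbabilityMeasure P] {n : ℕ} (X : Fin n → RVSpace P) (h𝒜 : 𝒜 ≤ mΩ)
    {B : Set (Fin n → ℝ)} (hB : MeasurableSet B) :
    ((condDist X h𝒜).apply B).1 = condProb 𝒜 (joint X ⁻¹' B) := by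
  classical
  exact if_pos hB

section Represents

variable {Ω : Type*} [mΩ : MeasurableSpace Ω] {P : Measure Ω} [IsProbabilityMeasure P]
variable {Ω' : Type*} [mΩ' : MeasurableSpace Ω'] {P' : Measure Ω'} [IsProbabilityMeasure P']
variable {f : RVSpace P → RVSpace P'} {n : ℕ} {A : Set (RVSpace P)}

/-- `μ` is the conditional distribution of `X̄` over `σ(A)`, transported along `f`, in its scalar
form `E[Y μ(B)] = E[f(Y) 1_{X̄ ∈ B}]` for all `σ(A)`-measurable `Y`. -/
def Represents (f : RVSpace P → RVSpace P') (μ : CondDist (sigmaAlg A) P n)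
    (X : Fin n → RVSpace P') : Prop :=
  ∀ Y : RVSpace P, AEStronglyMeasurable[sigmaAlg A] Y.1 P → ∀ B, MeasurableSet B →
    pairing Y (μ.apply B).1 = ∫ ω in joint X ⁻¹' B, (rv (f Y) ω : ℝ) ∂P'

theorem integrable_coe_rv (Y : RVSpace P) : Integrable (fun ω => (rv Y ω : ℝ)) P :=
  integrable_coe (measurable_rv Y)

/-- The defining property `E[Z P[X̄ ∈ B | 𝒜]] = E[Z 1_{X̄ ∈ B}]` of the conditional distribution. -/
theorem integral_mul_condDist {Ω : Type*} {𝒜 : MeasurableSpace Ω} [mΩ : MeasurableSpace Ω]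
    {P : Measure Ω} [IsProbabilityMeasure P] {n : ℕ} (X : Fin n → RVSpace P) (h𝒜 : 𝒜 ≤ mΩ)
    {Z : RVSpace P} (hZ : AEStronglyMeasurable[𝒜] Z.1 P) {B : Set (Fin n → ℝ)}
    (hB : MeasurableSet B) :
    ∫ ω, (rv Z ω : ℝ) * rv ((condDist X h𝒜).apply B) ω ∂P =
      ∫ ω in joint X ⁻¹' B, (rv Z ω : ℝ) ∂P := by
  have hS := measurable_joint X hB
  set S := joint X ⁻¹' B
  have h1 : Integrable (S.indicator fun _ => (1 : ℝ)) P := (integrable_const _).indicator hS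
  have h2 : (Z.1 : Ω → ℝ) * S.indicator (fun _ => (1 : ℝ)) = S.indicator Z.1 := by
    funext ω
    by_cases hω : ω ∈ S <;> simp [hω]
  have h3 := condExp_mul_of_aestronglyMeasurable_left hZ
    (by rw [h2]; exact (L1.integrable_coeFn Z.1).indicator hS) h1
  calc ∫ ω, (rv Z ω : ℝ) * rv ((condDist X h𝒜).apply B) ω ∂P
      = ∫ ω, ((Z.1 : Ω → ℝ) * P[S.indicator fun _ => (1 : ℝ) | 𝒜]) ω ∂P := by
        refine integral_congr_ae ?_
        filter_upwards [coe_rv Z, coe_rv ((condDist X h𝒜).apply B), coeFn_condProb (P := P) 𝒜 S]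
          with ω a b c
        rw [a, b, condDist_apply X h𝒜 hB, c]
        rfl
    _ = ∫ ω, (P[(Z.1 : Ω → ℝ) * S.indicator fun _ => (1 : ℝ) | 𝒜]) ω ∂P :=
        integral_congr_ae h3.symm
    _ = ∫ ω, S.indicator Z.1 ω ∂P := by rw [integral_condExp h𝒜, h2]
    _ = ∫ ω in S, Z.1 ω ∂P := integral_indicator hS
    _ = _ := by
      refine integral_congr_ae (ae_restrict_of_ae ?_)
      filter_upwards [coe_rv Z] with ω h
      rw [h]

theorem LawPreserving.pairing_eq (hf : LawPreserving f) (Y Z : RVSpace P) :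
    pairing Y Z.1 = ∫ ω, (rv (f Y) ω : ℝ) * rv (f Z) ω ∂P' := by
  rw [pairing_coe]
  exact (hf.integral_eq ![Y, Z] (θ := fun z => (z 0 : ℝ) * z 1) (by fun_prop)).symm

theorem LawPreserving.map_zero (hf : LawPreserving f) : f zeroOp = zeroOp := by
  rw [hf.map_funMap]
  exact congrArg _ (funext fun i => i.elim0)

/-- The scalar form agrees with equality of the values in `L₁`, as `f` maps the `σ(A)`-measurable
`Y` onto the `σ(f(A))`-measurable random variables, which suffice to test a conditional expectation.
-/
theorem LawPreserving.represents_iff (hf : LawPreserving f) (μ : CondDist (sigmaAlg A) P n)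
    (X : Fin n → RVSpace P') : Represents f μ X ↔
      ∀ B, f (μ.apply B) = (condDist X (sigmaAlg_le (f '' A))).apply B := by
  constructor
  · intro h B
    by_cases hB : MeasurableSet B
    · refine Subtype.ext (Lp.ext ?_)
      rw [condDist_apply X _ hB]
      refine Filter.EventuallyEq.trans ?_ (coeFn_condProb (P := P') (sigmaAlg (f '' A)) _).symm
      have hS := measurable_joint X hB
      refine ae_eq_condExp_of_forall_setIntegral_eq (sigmaAlg_le (f '' A))
        ((integrable_const _).indicator hS)
        (fun _ _ _ => (L1.integrable_coeFn _).integrableOn) (fun E hE _ => ?_)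
        (hf.aestronglyMeasurable_map (μ.2.1 B hB).2)
      have hE' := sigmaAlg_le (f '' A) E hE
      obtain ⟨Y, hY, hYE⟩ := hf.exists_map_eq
        (aestronglyMeasurable_ind (P := P') (sigmaAlg_le (f '' A)) hE)
      have key := h Y hY B hB
      rw [hf.pairing_eq, hYE] at key
      rw [setIntegral_indicator hS, setIntegral_const, smul_eq_mul, mul_one,
        ← integral_indicator hE']
      have e1 : ∫ ω, E.indicator (f (μ.apply B)).1 ω ∂P' =
          ∫ ω, (rv (ind hE' : RVSpace P') ω : ℝ) * rv (f (μ.apply B)) ω ∂P' := by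
        refine integral_congr_ae ?_
        filter_upwards [rv_ind (P := P') hE', coe_rv (f (μ.apply B))] with ω a b
        rw [a, b]
        by_cases hω : ω ∈ E <;> simp [hω]
      rw [e1, key]
      have e2 : ∫ ω in joint X ⁻¹' B, (rv (ind hE' : RVSpace P') ω : ℝ) ∂P' =
          ∫ ω in joint X ⁻¹' B, E.indicator (fun _ => (1 : ℝ)) ω ∂P' := by
        refine integral_congr_ae (ae_restrict_of_ae ?_)
        filter_upwards [rv_ind (P := P') hE'] with ω a
        rw [a]
        by_cases hω : ω ∈ E <;> simp [hω]
      rw [e2, setIntegral_indicator hE', setIntegral_const, smul_eq_mul, mul_one, inter_comm]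
    · have h0 : ∀ {Z : RVSpace P'}, Z.1 = 0 → Z = zeroOp := fun h => Subtype.ext h
      have h1 : μ.apply B = zeroOp := Subtype.ext (μ.apply_of_not_measurable hB)
      rw [h1, hf.map_zero, h0 (CondDist.apply_of_not_measurable _ hB)]
  · intro h Y hY B hB
    rw [hf.pairing_eq, h B]
    exact integral_mul_condDist X _ (hf.aestronglyMeasurable_map hY) hB

/-- The conditional distribution of a tuple over `σ(f(A))` is the image of a distribution over
`σ(A)`. Its values `ν(B)` are in the range of `f`; finite additivity of the preimages is an almost
sure property of a joint law, and `σ`-additivity follows as the `L₁` norm of the preimage of `ν(B)`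
is `P[X̄ ∈ B]`. -/
theorem LawPreserving.exists_represents (hf : LawPreserving f) (A : Set (RVSpace P))
    (X : Fin n → RVSpace P') : ∃ μ : CondDist (sigmaAlg A) P n, Represents f μ X := by
  classical
  let ν := condDist X (sigmaAlg_le (f '' A))
  have hex : ∀ B, ∃ Y : RVSpace P, AEStronglyMeasurable[sigmaAlg A] Y.1 P ∧ f Y = ν.apply B := by
    intro B
    by_cases hB : MeasurableSet B
    · exact hf.exists_map_eq (ν.2.1 B hB).2
    · refine ⟨zeroOp, IsClosedSub.zero_mem (isClosedSub_aestronglyMeasurable (sigmaAlg_le A)), ?_⟩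
      rw [hf.map_zero]
      exact (Subtype.ext (ν.apply_of_not_measurable hB)).symm
  choose Z hZ hfZ using hex
  have hrv : ∀ B, MeasurableSet B → ∀ Y : RVSpace P, AEStronglyMeasurable[sigmaAlg A] Y.1 P →
      pairing Y (Z B).1 = ∫ ω in joint X ⁻¹' B, (rv (f Y) ω : ℝ) ∂P' := by
    intro B hB Y hY
    rw [hf.pairing_eq, hfZ B]
    exact integral_mul_condDist X _ (hf.aestronglyMeasurable_map hY) hB
  -- the constant `1` is a Borel function of the empty tuple
  have hf1 : ∀ᵐ ω ∂P', rv (f (oneRV : RVSpace P)) ω = 1 := by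
    have e : (oneRV : RVSpace P) =
        comp (g := fun _ : Fin 0 → I => 1) measurable_const Fin.elim0 := rfl
    rw [e, hf.map_comp]
    exact rv_comp _ _
  have hnorm : ∀ B, MeasurableSet B → ‖(Z B).1‖ = P'.real (joint X ⁻¹' B) := by
    intro B hB
    have h1 := hrv B hB oneRV aestronglyMeasurable_oneRV
    have h2 : ∫ ω in joint X ⁻¹' B, (rv (f (oneRV : RVSpace P)) ω : ℝ) ∂P' =
        ∫ ω in joint X ⁻¹' B, (1 : ℝ) ∂P' := by
      refine integral_congr_ae (ae_restrict_of_ae ?_)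
      filter_upwards [hf1] with ω h
      rw [h, Icc.coe_one]
    rw [h2, setIntegral_const, smul_eq_mul, mul_one] at h1
    rw [norm_eq_pairing_oneRV, h1]
  have hadd : ∀ s t, MeasurableSet s → MeasurableSet t → Disjoint s t →
      (Z (s ∪ t)).1 = (Z s).1 + (Z t).1 := by
    intro s t hs ht hst
    have hν : ∀ᵐ ω ∂P', (rv (f (Z (s ∪ t))) ω : ℝ) = rv (f (Z s)) ω + rv (f (Z t)) ω := by
      have h1 : (ν.apply (s ∪ t)).1 = (ν.apply s).1 + (ν.apply t).1 := ν.1.of_union hst hs ht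
      rw [hfZ, hfZ, hfZ]
      filter_upwards [coe_rv (ν.apply (s ∪ t)), coe_rv (ν.apply s), coe_rv (ν.apply t),
        Lp.coeFn_add (ν.apply s).1 (ν.apply t).1] with ω a b c d
      rw [a, b, c, h1, d, Pi.add_apply]
    have h0 := hf.integral_eq ![Z (s ∪ t), Z s, Z t]
      (θ := fun z => |(z 0 : ℝ) - (z 1 + z 2)|) (by fun_prop)
    have h1 : ∫ ω, |(rv (f (Z (s ∪ t))) ω : ℝ) - (rv (f (Z s)) ω + rv (f (Z t)) ω)| ∂P' = 0 := by
      refine integral_eq_zero_of_ae ?_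
      filter_upwards [hν] with ω h
      rw [h, sub_self, abs_zero]
      rfl
    have h2 : ∫ ω, |(rv (Z (s ∪ t)) ω : ℝ) - (rv (Z s) ω + rv (Z t) ω)| ∂P = 0 :=
      h0.symm.trans h1
    have h3 := (integral_eq_zero_iff_of_nonneg (fun ω => abs_nonneg _)
      ((integrable_coe_rv (Z (s ∪ t))).sub
        ((integrable_coe_rv (Z s)).add (integrable_coe_rv (Z t)))).abs).1 h2
    refine Lp.ext ?_
    filter_upwards [h3, coe_rv (Z (s ∪ t)), coe_rv (Z s), coe_rv (Z t),
      Lp.coeFn_add (Z s).1 (Z t).1] with ω a b c d e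
    rw [e, Pi.add_apply, ← b, ← c, ← d]
    exact sub_eq_zero.1 (abs_eq_zero.1 a)
  have hprob : IsProbabilityMeasure (P'.map (joint X)) :=
    Measure.isProbabilityMeasure_map (measurable_joint X).aemeasurable
  let m : VectorMeasure (Fin n → ℝ) (Lp ℝ 1 P) := VectorMeasure.of_additive_of_le_measure
    (μ := P'.map (joint X)) (fun B => if MeasurableSet B then (Z B).1 else 0) (fun B => by
      by_cases hB : MeasurableSet B
      · rw [if_pos hB, ← ofReal_norm, hnorm B hB, Measure.map_apply (measurable_joint X) hB,
          ofReal_measureReal]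
      · rw [if_neg hB]
        simp) (fun s t hs ht hst => by
      rw [if_pos hs, if_pos ht, if_pos (hs.union ht), hadd s t hs ht hst])
    (fun B hB => if_neg hB)
  have hm : ∀ B, MeasurableSet B → m B = (Z B).1 := fun B hB => if_pos hB
  have hZ1 : Z univ = oneRV := by
    refine hf.isometry.injective ?_
    rw [hfZ]
    refine rv_ext ?_
    have h1 : (ν.apply univ).1 = one P' := ν.2.2
    filter_upwards [coe_rv (ν.apply univ), hf1, Lp.coeFn_const (p := 1) (μ := P') (1 : ℝ)]
      with ω a b c
    refine Subtype.ext ?_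
    rw [a, b, h1, c]
    rfl
  refine ⟨⟨m, fun B hB => ?_, ?_⟩, fun Y hY B hB => ?_⟩
  · rw [hm B hB]
    exact ⟨(Z B).2, hZ B⟩
  · rw [hm univ .univ, hZ1]
    refine Lp.ext ?_
    filter_upwards [coe_rv (oneRV : RVSpace P), rv_oneRV (P := P),
      Lp.coeFn_const (p := 1) (μ := P) (1 : ℝ)] with ω a b c
    rw [← a, b, c]
    rfl
  · rw [← hrv B hB Y hY]
    exact congrArg _ (hm B hB)

/-- A tuple is represented by at most one distribution. -/
theorem Represents.unique {μ ν : CondDist (sigmaAlg A) P n} {X : Fin n → RVSpace P'}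
    (hf : LawPreserving f) (hμ : Represents f μ X) (hν : Represents f ν X) : μ = ν := by
  refine Subtype.ext (VectorMeasure.ext fun B _ => ?_)
  have h1 := (hf.represents_iff μ X).1 hμ B
  have h2 := (hf.represents_iff ν X).1 hν B
  exact congrArg Subtype.val (hf.isometry.injective (h1.trans h2.symm))

end Represents

/-! ### Types determine conditional distributions, and conversely -/

section Represents

variable {Ω : Type*} [mΩ : MeasurableSpace Ω] {P : Measure Ω} [IsProbabilityMeasure P]
variable {Ω' : Type*} [mΩ' : MeasurableSpace Ω'] {P' : Measure Ω'} [IsProbabilityMeasure P']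
variable {f : RVSpace P → RVSpace P'} {n : ℕ} {A : Set (RVSpace P)}

theorem LawPreserving.map_realize (hf : LawPreserving f) {α : Type*} (t : LRV.Term α)
    (X : α → RVSpace P) : f (t.realize X) = t.realize fun i => f (X i) := by
  induction t with
  | var i => rfl
  | func F ts ih =>
    simp only [FirstOrder.Language.Term.realize_func]
    rw [hf.map_funMap]
    exact congrArg _ (funext ih)

/-- The terms in the elements of `A` are dense in `L₁(σ(A),[0,1])`. -/
theorem mem_closure_range_realize {Y : RVSpace P} (hY : AEStronglyMeasurable[sigmaAlg A] Y.1 P) :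
    Y ∈ closure (range fun t : LRV.Term A => t.realize (Subtype.val : A → RVSpace P)) := by
  refine IsClosedSub.mem_of_sigmaAlg (D := closure _) ⟨isClosed_closure, fun {k} F x hx => ?_⟩
    (fun X hX => subset_closure (mem_range.2 ⟨.var ⟨X, hX⟩, rfl⟩)) hY
  refine map_mem_closure (s := univ.pi fun _ : Fin k =>
    range fun t : LRV.Term A => t.realize (Subtype.val : A → RVSpace P))
    (continuous_funMap_rvSpace F) ?_ fun y hy => ?_
  · rw [closure_pi_set]
    exact fun i _ => hx i
  · choose t ht using fun i => hy i (mem_univ i)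
    refine ⟨.func F t, ?_⟩
    simp only [FirstOrder.Language.Term.realize_func]
    exact congrArg _ (funext ht)

theorem Represents.weighted_eq {μ : CondDist (sigmaAlg A) P n} {X : Fin n → RVSpace P'}
    (h : Represents f μ X) {Y : RVSpace P} (hY : AEStronglyMeasurable[sigmaAlg A] Y.1 P) :
    weighted μ Y = (P'.withDensity fun ω => ENNReal.ofReal (rv (f Y) ω)).map (joint X) := by
  refine Measure.ext fun B hB => ?_
  rw [Measure.map_apply (measurable_joint X) hB, withDensity_apply _ (measurable_joint X hB),
    ← ofReal_integral_eq_lintegral_ofReal (integrable_coe_rv _).integrableOn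
      (Filter.Eventually.of_forall fun ω => (rv (f Y) ω).2.1), ← h Y hY B hB,
    ← weighted_real μ Y hB, ofReal_measureReal]

theorem Represents.integral_weighted {μ : CondDist (sigmaAlg A) P n} {X : Fin n → RVSpace P'}
    (h : Represents f μ X) {Y : RVSpace P} (hY : AEStronglyMeasurable[sigmaAlg A] Y.1 P)
    (θ : C(Fin n → ℝ, I)) :
    ∫ x, (θ x : ℝ) ∂(weighted μ Y) = ∫ ω, (rv (f Y) ω : ℝ) * θ (joint X ω) ∂P' := by
  rw [h.weighted_eq hY, integral_map (measurable_joint X).aemeasurable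
    (by fun_prop : Continuous fun x => (θ x : ℝ)).aestronglyMeasurable,
    integral_withDensity_eq_integral_toReal_smul (f := fun ω => ENNReal.ofReal (rv (f Y) ω))
      (measurable_subtype_coe.comp (measurable_rv _)).ennreal_ofReal
      (Filter.Eventually.of_forall fun ω => ENNReal.ofReal_lt_top)]
  refine integral_congr_ae (Filter.Eventually.of_forall fun ω => ?_)
  simp only [ENNReal.toReal_ofReal (rv (f Y) ω).2.1, smul_eq_mul]

/-- The weighted measures over `σ(A)` determine a distribution that represents a tuple. -/
theorem Represents.of_weighted_eq {μ ν : CondDist (sigmaAlg A) P n} {X : Fin n → RVSpace P'}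
    (h : Represents f ν X) (hμ : ∀ Y : RVSpace P, AEStronglyMeasurable[sigmaAlg A] Y.1 P →
      weighted μ Y = weighted ν Y) : Represents f μ X := by
  intro Y hY B hB
  rw [← h Y hY B hB, ← weighted_real μ Y hB, ← weighted_real ν Y hB, hμ Y hY]

end Represents

section Types

variable {Ω : Type u} [mΩ : MeasurableSpace Ω] {P : Measure Ω} [IsProbabilityMeasure P]
variable {A : Set (RVSpace P)} {n : ℕ}

/-- The function `tp(X̄/A) ↦ E[Y θ(X̄)]`, for `Y` in `L₁(σ(A),[0,1])` and `θ` continuous, is a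
uniform limit of formulas over `A`. -/
theorem exists_formula_approx {Y : RVSpace P} (hY : AEStronglyMeasurable[sigmaAlg A] Y.1 P)
    (θ : C(Fin n → ℝ, I)) {ε : ℝ} (hε : 0 < ε) :
    ∃ φ : Formula (A ⊕ Fin n) 0, ∀ (N : Extension P) (X : Fin n → RVSpace N.P'),
      |(tp A N X φ : ℝ) - ∫ ω, (rv (N.emb Y) ω : ℝ) * θ (joint X ω) ∂N.P'| ≤ ε := by
  -- `Y` is within `ε / 2` of a term `t` in the elements of `A`, and the continuous function `t θ`
  -- of the parameters and of `X̄` is within `ε / 2` of a term `s`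
  obtain ⟨_, ⟨t, rfl⟩, ht⟩ := Metric.mem_closure_iff.1 (mem_closure_range_realize hY) _
    (half_pos hε)
  have hη : Continuous fun z : A ⊕ Fin n → I =>
      t.realize (fun a => z (.inl a)) * θ fun i => (z (.inr i) : ℝ) :=
    ((continuous_realize t).comp (by fun_prop)).mul (by fun_prop)
  obtain ⟨s, hs⟩ := exists_term_approx hη (half_pos hε)
  refine ⟨expFormula s, fun N X => ?_⟩
  have hN := N.emb.lawPreserving
  set v : A ⊕ Fin n → RVSpace N.P' := Sum.elim (fun a => N.emb a.1) X
  have h1 : (tp A N X (expFormula s) : ℝ) = ∫ ω, (rv (s.realize v) ω : ℝ) ∂N.P' := by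
    rw [← dist_zeroOp, ← coe_eval_expFormula]
    rfl
  have h2 : Integrable (fun ω => (rv (N.emb Y) ω : ℝ) * θ (joint X ω)) N.P' :=
    Integrable.of_mem_Icc 0 1
      ((measurable_subtype_coe.comp (measurable_rv _)).mul (measurable_subtype_coe.comp
        (θ.continuous.measurable.comp (measurable_joint X)))).aemeasurable
      (Filter.Eventually.of_forall fun ω =>
        ⟨mul_nonneg (rv (N.emb Y) ω).2.1 (θ (joint X ω)).2.1,
          mul_le_one₀ (rv (N.emb Y) ω).2.2 (θ (joint X ω)).2.1 (θ (joint X ω)).2.2⟩)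
  have h3 := integrable_dist (P := N.P') (measurable_rv (N.emb Y))
    (measurable_rv (N.emb (t.realize Subtype.val)))
  rw [h1, ← integral_sub (integrable_coe_rv _) h2]
  refine abs_integral_le_integral_abs.trans ?_
  calc ∫ ω, |(rv (s.realize v) ω : ℝ) - rv (N.emb Y) ω * θ (joint X ω)| ∂N.P'
      ≤ ∫ ω, (dist (rv (N.emb Y) ω) (rv (N.emb (t.realize Subtype.val)) ω) + ε / 2) ∂N.P' := by
        refine integral_mono_ae ((integrable_coe_rv _).sub h2).abs
          (h3.add (integrable_const _)) ?_
        rw [hN.map_realize]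
        filter_upwards [rv_realize s v, rv_realize t fun a : A => N.emb a.1,
          ae_all_iff.2 fun i => coe_rv (X i)] with ω a b c
        have e1 : joint X ω = fun i => (rv (v (.inr i)) ω : ℝ) := funext fun i => (c i).symm
        have e2 := hs fun i => rv (v i) ω
        rw [Subtype.dist_eq, Real.dist_eq] at e2
        rw [a, b, Subtype.dist_eq, Real.dist_eq, e1]
        set p : I := s.realize fun i => rv (v i) ω
        set q : I := t.realize fun i : A => rv (N.emb i.1) ω
        set r : I := θ fun i => (rv (v (.inr i)) ω : ℝ)
        change |(p : ℝ) - ((q * r : I) : ℝ)| ≤ ε / 2 at e2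
        rw [Set.Icc.coe_mul] at e2
        have e3 : |((q : ℝ) - rv (N.emb Y) ω) * r| ≤ |(rv (N.emb Y) ω : ℝ) - q| := by
          rw [abs_mul, abs_sub_comm, abs_of_nonneg r.2.1]
          exact mul_le_of_le_one_right (abs_nonneg _) r.2.2
        calc |(p : ℝ) - rv (N.emb Y) ω * r|
            = |((q : ℝ) - rv (N.emb Y) ω) * r + (p - q * r)| := by ring_nf
          _ ≤ _ := (abs_add_le _ _).trans (add_le_add e3 e2)
    _ = dist Y (t.realize Subtype.val) + ε / 2 := by
        rw [integral_add h3 (integrable_const _), ← dist_eq, hN.isometry.dist_eq]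
        simp
    _ ≤ ε := by linarith

/-- The indicator of the event that `ā` lies in `C`. -/
noncomputable def indPreimage {Ω : Type*} [MeasurableSpace Ω] {P : Measure Ω}
    [IsProbabilityMeasure P] {ι : Type*} {C : Set (ι → I)} (hC : MeasurableSet C)
    (a : ι → RVSpace P) : RVSpace P :=
  comp (g := C.indicator fun _ => 1) (measurable_const.indicator hC) a

theorem aestronglyMeasurable_indPreimage {ι : Type*} [Countable ι] {C : Set (ι → I)}
    (hC : MeasurableSet C) {a : ι → RVSpace P}
    (ha : ∀ i, AEStronglyMeasurable[sigmaAlg A] (a i).1 P) :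
    AEStronglyMeasurable[sigmaAlg A] (indPreimage hC a).1 P :=
  aestronglyMeasurable_comp _ ha

/-- The joint law of `σ(A)`-measurable random variables and of `X̄`, in terms of the conditional
distribution of `X̄`. -/
theorem Represents.real_inter {N : Extension P} {X : Fin n → RVSpace N.P'}
    {μ : CondDist (sigmaAlg A) P n} (h : Represents N.emb μ X) {ι : Type*} [Finite ι]
    {a : ι → RVSpace P} (ha : ∀ i, AEStronglyMeasurable[sigmaAlg A] (a i).1 P)
    {C : Set (ι → I)} (hC : MeasurableSet C) {B : Set (Fin n → ℝ)} (hB : MeasurableSet B) :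
    N.P'.real {ω | (fun i => rv (N.emb (a i)) ω) ∈ C ∧ joint X ω ∈ B} =
      (weighted μ (indPreimage hC a)).real B := by
  have hE := measurable_rv_pi (fun i => N.emb (a i)) hC
  rw [weighted_real _ _ hB, h _ (aestronglyMeasurable_indPreimage hC ha) _ hB, indPreimage,
    N.emb.lawPreserving.map_comp]
  have e : ∫ ω in joint X ⁻¹' B, (rv (comp (g := C.indicator fun _ => 1)
        (measurable_const.indicator hC) fun i => N.emb (a i)) ω : ℝ) ∂N.P' =
      ∫ ω in joint X ⁻¹' B, ((fun ω i => rv (N.emb (a i)) ω) ⁻¹' C).indicator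
        (fun _ => (1 : ℝ)) ω ∂N.P' := by
    refine integral_congr_ae (ae_restrict_of_ae ?_)
    filter_upwards [rv_comp (g := C.indicator fun _ => 1)
        (measurable_const.indicator hC) fun i => N.emb (a i)] with ω h
    rw [h]
    by_cases hω : (fun i => rv (N.emb (a i)) ω) ∈ C <;> simp [hω]
  rw [e, setIntegral_indicator hE, setIntegral_const, smul_eq_mul, mul_one, inter_comm]
  rfl

/-- Tuples with the same conditional distribution over `σ(A)` have the same type over `A`: a formula
involves finitely many parameters only, and the joint law of these and of the tuple is determined by
the conditional distribution. -/
theorem Represents.tp_eq {N₁ N₂ : Extension P} {X₁ : Fin n → RVSpace N₁.P'}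
    {X₂ : Fin n → RVSpace N₂.P'} {μ : CondDist (sigmaAlg A) P n} (h₁ : Represents N₁.emb μ X₁)
    (h₂ : Represents N₂.emb μ X₂) : tp A N₁ X₁ = tp A N₂ X₂ := by
  funext φ
  obtain ⟨S, ψ, hS, hψ⟩ := exists_finite_parameters.{u, u} φ
  have := hS.to_subtype
  simp only [tp]
  rw [hψ, hψ]
  refine eval_elim0_eq_of_law_eq ψ N₁.atomless N₂.atomless _ _ ?_
  have hS' : ∀ s : S, AEStronglyMeasurable[sigmaAlg A] (s : A).1.1 P := fun s =>
    aestronglyMeasurable_of_mem (s : A).2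
  have hc : Measurable fun (x : Fin n → ℝ) (i : Fin n) => projIcc (0 : ℝ) 1 zero_le_one (x i) :=
    measurable_pi_lambda _ fun i => continuous_projIcc.measurable.comp (measurable_pi_apply i)
  have hm : ∀ (N : Extension P) (X : Fin n → RVSpace N.P'), Measurable fun ω =>
      (((fun s : S => rv (N.emb (s : A).1) ω), fun i => rv (X i) ω) : (S → I) × (Fin n → I)) :=
    fun N X => (measurable_rv_pi _).prodMk (measurable_rv_pi _)
  have key : N₁.P'.map (fun ω =>
        (((fun s : S => rv (N₁.emb (s : A).1) ω), fun i => rv (X₁ i) ω) : (S → I) × (Fin n → I))) =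
      N₂.P'.map (fun ω =>
        (((fun s : S => rv (N₂.emb (s : A).1) ω), fun i => rv (X₂ i) ω) :
          (S → I) × (Fin n → I))) := by
    have := Measure.isProbabilityMeasure_map (hm N₁ X₁).aemeasurable (μ := N₁.P')
    refine Measure.ext_prod fun {C B} hC hB => ?_
    rw [Measure.map_apply (hm N₁ X₁) (hC.prod hB), Measure.map_apply (hm N₂ X₂) (hC.prod hB)]
    refine (ENNReal.toReal_eq_toReal_iff' (measure_ne_top _ _) (measure_ne_top _ _)).1 ?_
    exact (h₁.real_inter hS' hC (hc hB)).trans (h₂.real_inter hS' hC (hc hB)).symm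
  have hl : ∀ (N : Extension P) (X : Fin n → RVSpace N.P'),
      law (Sum.elim (fun s : S => N.emb (s : A).1) X) = (N.P'.map fun ω =>
        (((fun s : S => rv (N.emb (s : A).1) ω), fun i => rv (X i) ω) :
          (S → I) × (Fin n → I))).map fun z => Sum.elim z.1 z.2 := by
    intro N X
    rw [Measure.map_map (measurable_pi_lambda _ ?_) (hm N X)]
    · refine congrArg N.P'.map (funext fun ω => funext fun i => ?_)
      rcases i with i | i <;> rfl
    · rintro (i | i)
      · exact (measurable_pi_apply i).comp measurable_fst
      · exact (measurable_pi_apply i).comp measurable_snd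
  rw [hl, hl, key]

/-- The type of `X̄` over `A` determines `E[Y θ(X̄)]`, a limit of values of formulas. -/
theorem integral_eq_of_tp_eq {N₁ N₂ : Extension P} {X₁ : Fin n → RVSpace N₁.P'}
    {X₂ : Fin n → RVSpace N₂.P'} (h : tp A N₁ X₁ = tp A N₂ X₂) {Y : RVSpace P}
    (hY : AEStronglyMeasurable[sigmaAlg A] Y.1 P) (θ : C(Fin n → ℝ, I)) :
    ∫ ω, (rv (N₁.emb Y) ω : ℝ) * θ (joint X₁ ω) ∂N₁.P' =
      ∫ ω, (rv (N₂.emb Y) ω : ℝ) * θ (joint X₂ ω) ∂N₂.P' := by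
  refine eq_of_forall_dist_le fun ε hε => ?_
  obtain ⟨φ, hφ⟩ := exists_formula_approx hY θ (half_pos hε)
  have h1 := hφ N₁ X₁
  have h2 := hφ N₂ X₂
  rw [h] at h1
  rw [Real.dist_eq]
  rw [abs_le] at *
  constructor <;> linarith

/-- Tuples of the same type over `A` have the same conditional distribution over `σ(A)`. -/
theorem Represents.of_tp_eq {N₁ N₂ : Extension P} {X₁ : Fin n → RVSpace N₁.P'}
    {X₂ : Fin n → RVSpace N₂.P'} (h : tp A N₁ X₁ = tp A N₂ X₂)
    {μ : CondDist (sigmaAlg A) P n} (hμ : Represents N₁.emb μ X₁) : Represents N₂.emb μ X₂ := by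
  obtain ⟨ν, hν⟩ := N₂.emb.lawPreserving.exists_represents A X₂
  refine hν.of_weighted_eq fun Y hY => measure_eq_of_integral_eq fun θ => ?_
  rw [hμ.integral_weighted hY, hν.integral_weighted hY, integral_eq_of_tp_eq h hY]

end Types

/-! ### Realizing distributions -/

section Realize

variable {Ω : Type*} {𝒜 : MeasurableSpace Ω} [mΩ : MeasurableSpace Ω] {P : Measure Ω}
  [IsProbabilityMeasure P] {n : ℕ}

theorem CondDist.apply_mono (μ : CondDist 𝒜 P n) {B C : Set (Fin n → ℝ)} (hB : MeasurableSet B)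
    (hC : MeasurableSet C) (h : B ⊆ C) :
    ∀ᵐ ω ∂P, rv (μ.apply B) ω ≤ rv (μ.apply C) ω := by
  have h1 : μ.1 B ≤ μ.1 C := by
    have h2 := μ.1.of_union disjoint_sdiff_right hB (hC.diff hB)
    rw [union_sdiff_cancel h] at h2
    rw [h2]
    exact le_add_of_nonneg_right (μ.2.1 _ (hC.diff hB)).1.1
  filter_upwards [(Lp.coeFn_le _ _).2 h1] with ω h
  exact monotone_projIcc _ h

theorem weighted_apply (μ : CondDist 𝒜 P n) (Y : RVSpace P) {B : Set (Fin n → ℝ)}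
    (hB : MeasurableSet B) : weighted μ Y B = ENNReal.ofReal (pairing Y (μ.apply B).1) := by
  rw [← weighted_real μ Y hB, ofReal_measureReal]

/-- For an increasing family of events, a countable supremum of conditional probabilities is the
conditional probability of the union. -/
theorem CondDist.iSup_apply (μ : CondDist 𝒜 P n) {ι : Type*} [Countable ι]
    {S : ι → Set (Fin n → ℝ)} (hS : ∀ i, MeasurableSet (S i)) (hd : Directed (· ⊆ ·) S) :
    ∀ᵐ ω ∂P, ⨆ i, rv (μ.apply (S i)) ω = rv (μ.apply (⋃ i, S i)) ω := by
  have hm : Measurable fun ω => ⨆ i, rv (μ.apply (S i)) ω := .iSup fun i => measurable_rv _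
  have hle : ∀ᵐ ω ∂P, ⨆ i, rv (μ.apply (S i)) ω ≤ rv (μ.apply (⋃ i, S i)) ω := by
    filter_upwards [ae_all_iff.2 fun i => μ.apply_mono (hS i) (.iUnion hS) (subset_iUnion S i)]
      with ω h
    exact iSup_le h
  have hint : ∀ B, MeasurableSet B → weighted μ oneRV B =
      ENNReal.ofReal (∫ ω, (rv (μ.apply B) ω : ℝ) ∂P) := by
    intro B hB
    rw [weighted_apply μ _ hB, pairing_coe]
    congr 1
    refine integral_congr_ae ?_
    filter_upwards [rv_oneRV (P := P)] with ω h
    rw [h, Icc.coe_one, one_mul]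
  have hge : ∫ ω, (rv (μ.apply (⋃ i, S i)) ω : ℝ) ∂P ≤
      ∫ ω, ((⨆ i, rv (μ.apply (S i)) ω : I) : ℝ) ∂P := by
    rw [← ENNReal.ofReal_le_ofReal_iff (integral_nonneg fun ω => (⨆ i, rv (μ.apply (S i)) ω).2.1),
      ← hint _ (.iUnion hS), hd.measure_iUnion]
    refine iSup_le fun i => ?_
    rw [hint _ (hS i)]
    exact ENNReal.ofReal_le_ofReal (integral_mono (integrable_coe_rv _) (integrable_coe hm)
      fun ω => Subtype.coe_le_coe.2 (le_iSup (fun i => rv (μ.apply (S i)) ω) i))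
  have := (integral_eq_iff_of_ae_le (integrable_coe hm) (integrable_coe_rv _)
    (by filter_upwards [hle] with ω h using h)).1
    (le_antisymm (integral_mono_ae (integrable_coe hm) (integrable_coe_rv _)
      (by filter_upwards [hle] with ω h using h)) hge)
  filter_upwards [this] with ω h
  exact Subtype.ext h

/-- Every conditional distribution over `Ω` is the conditional distribution of a random vector on
`Ω × [0,1]`, namely of the conditional quantile function at an independent uniform variable, after
`ℝⁿ` has been embedded in the line. Only countably many rational levels enter into the quantile
function, so no regular version of the conditional distribution has to be chosen. -/
theorem CondDist.exists_randomization (μ : CondDist 𝒜 P n) :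
    ∃ x : Ω × I → Fin n → ℝ, Measurable x ∧ ∀ (Y : RVSpace P) (B : Set (Fin n → ℝ)),
      MeasurableSet B →
        ∫ p in x ⁻¹' B, (rv Y p.1 : ℝ) ∂(P.prod (volume : Measure I)) =
          pairing Y (μ.apply B).1 := by
  let e : (Fin n → ℝ) → EReal := fun x => (embeddingReal (Fin n → ℝ) x : EReal)
  have he : MeasurableEmbedding e :=
    EReal.measurableEmbedding_coe.comp (measurableEmbedding_embeddingReal _)
  -- `F q` is the conditional distribution function at `q`, and `Z (ω, u) = inf {q | u < F q ω}`
  let F : ℚ → Ω → I := fun q => rv (μ.apply (e ⁻¹' Iic (q : ℝ)))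
  have hF : ∀ q, Measurable (F q) := fun q => measurable_rv _
  let Z : Ω × I → EReal := fun p => ⨅ q : ℚ, if p.2 < F q p.1 then ((q : ℝ) : EReal) else ⊤
  have hZ : Measurable Z := .iInf fun q => Measurable.ite
    (measurableSet_lt measurable_snd ((hF q).comp measurable_fst)) measurable_const measurable_const
  -- For fixed `ω`, the event `Z < a` is an initial interval whose length is the supremum of the
  -- `F q ω` with `q < a`, almost surely the conditional probability of `Iio a`. No monotonicity
  -- of `q ↦ F q ω` is needed.
  have hZlt : ∀ (a : EReal) (ω : Ω), Prod.mk ω ⁻¹' (Z ⁻¹' Iio a) =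
      Iio (⨆ q : {q : ℚ // ((q : ℝ) : EReal) < a}, F q ω) := by
    intro a ω
    ext u
    simp only [mem_preimage, mem_Iio, Z, iInf_lt_iff, lt_iSup_iff, Subtype.exists]
    refine exists_congr fun q => ?_
    split_ifs with h
    · exact ⟨fun h' => ⟨h', h⟩, fun h' => h'.1⟩
    · exact ⟨fun h' => absurd h' (not_lt.2 le_top), fun ⟨_, h'⟩ => absurd h' h⟩
  have hunion : ∀ a : EReal,
      ⋃ q : {q : ℚ // ((q : ℝ) : EReal) < a}, e ⁻¹' Iic ((q : ℚ) : ℝ) = e ⁻¹' Iio a := by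
    intro a
    ext x
    simp only [mem_iUnion, mem_preimage, mem_Iic, mem_Iio, Subtype.exists, exists_prop]
    constructor
    · rintro ⟨q, h1, h2⟩
      exact h2.trans_lt h1
    · intro h
      obtain ⟨q, h1, h2⟩ := EReal.lt_iff_exists_rat_btwn.1 h
      exact ⟨q, h2, h1.le⟩
  have hlaw : ∀ Y : RVSpace P,
      ((P.withDensity fun ω => ENNReal.ofReal (rv Y ω)).prod (volume : Measure I)).map Z =
        (weighted μ Y).map e := by
    intro Y
    have hY : Measurable fun ω => ENNReal.ofReal (rv Y ω) :=
      (measurable_subtype_coe.comp (measurable_rv Y)).ennreal_ofReal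
    have hfin : IsFiniteMeasure (P.withDensity fun ω => ENNReal.ofReal (rv Y ω)) :=
      isFiniteMeasure_withDensity_ofReal (integrable_coe_rv Y).2
    have hlt : ∀ a, ((P.withDensity fun ω => ENNReal.ofReal (rv Y ω)).prod
        (volume : Measure I)).map Z (Iio a) = (weighted μ Y).map e (Iio a) := by
      intro a
      have hsup := μ.iSup_apply (S := fun q : {q : ℚ // ((q : ℝ) : EReal) < a} =>
        e ⁻¹' Iic ((q : ℚ) : ℝ)) (fun q => he.measurable measurableSet_Iic)
        (directed_of_isDirected_le fun q r hqr => preimage_mono (Iic_subset_Iic.2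
          (by exact_mod_cast hqr)))
      rw [hunion] at hsup
      rw [Measure.map_apply hZ measurableSet_Iio, Measure.map_apply he.measurable measurableSet_Iio,
        weighted_apply _ _ (he.measurable measurableSet_Iio),
        Measure.prod_apply (hZ measurableSet_Iio)]
      simp only [hZlt, unitInterval.volume_Iio]
      have hg : Measurable fun ω =>
          ENNReal.ofReal (⨆ q : {q : ℚ // ((q : ℝ) : EReal) < a}, F q ω : I) :=
        (measurable_subtype_coe.comp (Measurable.iSup
          fun q : {q : ℚ // ((q : ℝ) : EReal) < a} => hF q.1)).ennreal_ofReal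
      rw [lintegral_withDensity_eq_lintegral_mul _ hY hg,
        pairing_coe, ofReal_integral_eq_lintegral_ofReal
          (integrable_rv_mul Y (μ.apply (e ⁻¹' Iio a)).1 |>.congr ?_)
          (Filter.Eventually.of_forall fun ω => mul_nonneg (rv Y ω).2.1 (rv _ ω).2.1)]
      · refine lintegral_congr_ae ?_
        filter_upwards [hsup] with ω h
        rw [Pi.mul_apply, ENNReal.ofReal_mul (rv Y ω).2.1, ← h]
      · filter_upwards [coe_rv (μ.apply (e ⁻¹' Iio a))] with ω h
        rw [h]
    have huniv : ((P.withDensity fun ω => ENNReal.ofReal (rv Y ω)).prod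
        (volume : Measure I)).map Z univ = (weighted μ Y).map e univ := by
      rw [Measure.map_apply hZ .univ, Measure.map_apply he.measurable .univ, preimage_univ,
        preimage_univ, weighted_apply _ _ .univ, ← univ_prod_univ, Measure.prod_prod,
        measure_univ (μ := (volume : Measure I)), mul_one, withDensity_apply _ .univ,
        setLIntegral_univ,
        ← ofReal_integral_eq_lintegral_ofReal (integrable_coe_rv Y)
          (Filter.Eventually.of_forall fun ω => (rv Y ω).2.1), pairing_apply]
      congr 1
      refine integral_congr_ae ?_
      have h1 : (μ.apply univ).1 = one P := μ.2.2
      filter_upwards [Lp.coeFn_const (p := 1) (μ := P) (1 : ℝ)] with ω h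
      rw [h1, h, Function.const_apply, mul_one]
    refine Measure.ext_of_Ici _ _ fun a => ?_
    rw [← compl_Iio, measure_compl measurableSet_Iio (measure_ne_top _ _),
      measure_compl measurableSet_Iio (measure_ne_top _ _), hlt, huniv]
  refine ⟨fun p => he.invFun (Z p), he.measurable_invFun.comp hZ, fun Y B hB => ?_⟩
  have hx : Measurable fun p => he.invFun (Z p) := he.measurable_invFun.comp hZ
  have h2 : e ⁻¹' (he.invFun ⁻¹' B) = B := by
    rw [← preimage_comp, he.leftInverse_invFun.comp_eq_id, preimage_id]
  have hY : Measurable fun ω => ENNReal.ofReal (rv Y ω) :=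
    (measurable_subtype_coe.comp (measurable_rv Y)).ennreal_ofReal
  have h1 := DFunLike.congr_fun (hlaw Y) (he.invFun ⁻¹' B)
  rw [Measure.map_apply hZ (he.measurable_invFun hB),
    Measure.map_apply he.measurable (he.measurable_invFun hB), prod_withDensity_left hY,
    withDensity_apply (s := Z ⁻¹' (he.invFun ⁻¹' B)) _ (hx hB), h2,
    ← ofReal_integral_eq_lintegral_ofReal] at h1
  · rw [← weighted_real _ _ hB, measureReal_def, ← h1, ENNReal.toReal_ofReal]
    · rfl
    · exact integral_nonneg fun p => (rv Y p.1).2.1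
  · exact (integrable_coe ((measurable_rv Y).comp measurable_fst)).integrableOn
  · exact Filter.Eventually.of_forall fun p => (rv Y p.1).2.1

/-- The random variable on `Ω × [0,1]` that depends on the first coordinate only. -/
noncomputable def liftFst (a : RVSpace P) : RVSpace (P.prod (volume : Measure I)) :=
  ofRV (fun p => rv a p.1) ((measurable_rv a).comp measurable_fst)

theorem rv_liftFst (a : RVSpace P) :
    ∀ᵐ p ∂P.prod (volume : Measure I), rv (liftFst a) p = rv a p.1 := rv_ofRV _

theorem law_liftFst {ι : Type*} [Countable ι] (a : ι → RVSpace P) :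
    law (fun i => liftFst (a i)) = law a := by
  have h1 := (measurePreserving_fst (μ := P) (ν := (volume : Measure I))).map_eq
  have h2 := Measure.map_map (μ := P.prod (volume : Measure I)) (measurable_rv_pi a) measurable_fst
  rw [h1] at h2
  refine Eq.trans (Measure.map_congr ?_) h2.symm
  filter_upwards [ae_all_iff.2 fun i => rv_liftFst (a i)] with p h
  exact funext h

theorem ae_joint_mem_Icc (X : Fin n → RVSpace P) :
    ∀ᵐ ω ∂P, joint X ω ∈ Icc (0 : Fin n → ℝ) 1 := by
  filter_upwards [ae_all_iff.2 fun i => ae_mem_Icc (X i)] with ω h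
  exact ⟨fun i => (h i).1, fun i => (h i).2⟩

/-- The distributions of tuples of `[0,1]`-valued random variables are supported by the cube. -/
theorem Represents.apply_compl_Icc {A : Set (RVSpace P)} {Ω' : Type*} [MeasurableSpace Ω']
    {P' : Measure Ω'} [IsProbabilityMeasure P'] {f : RVSpace P → RVSpace P'}
    {μ : CondDist (sigmaAlg A) P n} {X : Fin n → RVSpace P'} (h : Represents f μ X) :
    μ.1 (Icc (0 : Fin n → ℝ) 1)ᶜ = 0 := by
  have h1 := h oneRV aestronglyMeasurable_oneRV (Icc 0 1)ᶜ measurableSet_Icc.compl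
  have h0 : P' (joint X ⁻¹' (Icc 0 1)ᶜ) = 0 := ae_joint_mem_Icc X
  rw [setIntegral_measure_zero _ h0, ← norm_eq_pairing_oneRV, norm_eq_zero] at h1
  exact h1

end Realize

section Realize

variable {Ω : Type u} [mΩ : MeasurableSpace Ω] {P : Measure Ω} [IsProbabilityMeasure P]
variable {A : Set (RVSpace P)} {n : ℕ}

/-- The elementary extension `L₁(Ω × [0,1],[0,1])` of `L₁(Ω,[0,1])`. -/
noncomputable def prodExtension (hP : Atomless P) : Extension P where
  Ω' := Ω × I
  P' := P.prod volume
  atomless := atomless_prod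
  emb := ⟨liftFst, fun _ φ a => eval_elim0_eq_of_law_eq φ atomless_prod hP _ _ (law_liftFst a)⟩

/-- Every distribution over `σ(A)` that is supported by the cube is the conditional distribution of
a tuple in an elementary extension. -/
theorem CondDist.exists_represents (hP : Atomless P) (μ : CondDist (sigmaAlg A) P n)
    (hμ : μ.1 (Icc (0 : Fin n → ℝ) 1)ᶜ = 0) :
    ∃ (N : Extension P) (X : Fin n → RVSpace N.P'), Represents N.emb μ X := by
  obtain ⟨x, hx, h⟩ := μ.exists_randomization
  have hm : ∀ i, Measurable fun p => projIcc (0 : ℝ) 1 zero_le_one (x p i) := fun i =>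
    continuous_projIcc.measurable.comp ((measurable_pi_apply i).comp hx)
  let X : Fin n → RVSpace (P.prod (volume : Measure I)) := fun i => ofRV _ (hm i)
  have hmem : ∀ᵐ p ∂P.prod (volume : Measure I), x p ∈ Icc (0 : Fin n → ℝ) 1 := by
    have h1 := h oneRV (Icc 0 1)ᶜ measurableSet_Icc.compl
    have h2 : (μ.apply (Icc (0 : Fin n → ℝ) 1)ᶜ).1 = 0 := hμ
    have h3 : ∫ p in x ⁻¹' (Icc 0 1)ᶜ, (rv (oneRV : RVSpace P) p.1 : ℝ)
        ∂(P.prod (volume : Measure I)) =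
          ∫ p in x ⁻¹' (Icc 0 1)ᶜ, (1 : ℝ) ∂(P.prod (volume : Measure I)) := by
      refine integral_congr_ae (ae_restrict_of_ae ?_)
      filter_upwards [(measurePreserving_fst (μ := P) (ν := (volume : Measure I))
        ).quasiMeasurePreserving.ae (rv_oneRV (P := P))] with p hp
      rw [hp, Icc.coe_one]
    rw [h2, map_zero, h3, setIntegral_const, smul_eq_mul, mul_one, measureReal_eq_zero_iff] at h1
    exact h1
  have hjoint : ∀ᵐ p ∂P.prod (volume : Measure I), joint X p = x p := by
    filter_upwards [hmem, ae_all_iff.2 fun i => coe_ofRV (P := P.prod (volume : Measure I)) (hm i)]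
      with p h1 h2
    funext i
    exact (h2 i).trans (congrArg Subtype.val (projIcc_of_mem zero_le_one ⟨h1.1 i, h1.2 i⟩))
  refine ⟨prodExtension hP, X, fun Y _ B hB => ?_⟩
  rw [← h Y B hB]
  have h1 : joint X ⁻¹' B =ᵐ[P.prod (volume : Measure I)] x ⁻¹' B := by
    filter_upwards [hjoint] with p hp
    exact congrArg (· ∈ B) hp
  refine Eq.trans ?_ (setIntegral_congr_set h1).symm
  refine integral_congr_ae (ae_restrict_of_ae ?_)
  filter_upwards [rv_liftFst Y] with p hp
  exact congrArg Subtype.val hp.symm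

end Realize

/-! ### Formulas depend continuously on discretized laws -/

section Discretize

variable {Ω₁ Ω₂ : Type w} [MeasurableSpace Ω₁] [MeasurableSpace Ω₂] {P₁ : Measure Ω₁}
  {P₂ : Measure Ω₂} [IsProbabilityMeasure P₁] [IsProbabilityMeasure P₂]

theorem dist_ofFinite_ofFinite_le {V : Type*} [Finite V] [MeasurableSpace V]
    [MeasurableSingletonClass V] (s : V → I) {D E : Ω₁ → V} (hD : Measurable D)
    (hE : Measurable E) :
    dist (ofFinite (P := P₁) s hD) (ofFinite s hE) ≤ P₁.real {ω | D ω ≠ E ω} := by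
  have hm : MeasurableSet {ω | D ω ≠ E ω} := (measurableSet_eq_fun hD hE).compl
  rw [dist_eq, ← mul_one (P₁.real _), ← smul_eq_mul, ← setIntegral_const, ← integral_indicator hm]
  refine integral_mono_ae (integrable_dist (measurable_rv _) (measurable_rv _))
    ((integrable_const _).indicator hm) ?_
  filter_upwards [rv_ofFinite (P := P₁) s hD, rv_ofFinite (P := P₁) s hE] with ω h1 h2
  rw [h1, h2]
  by_cases h : D ω = E ω
  · simp [h]
  · rw [indicator_of_mem (show ω ∈ {ω | D ω ≠ E ω} from h), Subtype.dist_eq, Real.dist_eq, abs_le]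
    have h3 := (s (D ω)).2
    have h4 := (s (E ω)).2
    constructor <;> linarith [h3.1, h3.2, h4.1, h4.2]

/-- If the laws of two tuples are close after rounding, then the tuples give close values to a
formula: a suitable coupling moves one of the rounded tuples by little to a tuple which has the law
of the other one. -/
theorem exists_dist_eval_le {α : Type v} [Finite α] (ψ : Formula α 0) {ε : ℝ} (hε : 0 < ε) :
    ∃ δ : ℝ, 0 < δ ∧ ∀ {Ω₁ Ω₂ : Type w} [MeasurableSpace Ω₁] [MeasurableSpace Ω₂]
      {P₁ : Measure Ω₁} {P₂ : Measure Ω₂} [IsProbabilityMeasure P₁] [IsProbabilityMeasure P₂],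
      Atomless P₁ → Atomless P₂ → ∀ (K : ℕ) (r : I → Fin (K + 1)) (s : Fin (K + 1) → I),
      Measurable r → (∀ x, dist (s (r x)) x ≤ δ) → ∀ (v₁ : α → RVSpace P₁) (v₂ : α → RVSpace P₂),
      (∀ d : α → Fin (K + 1), |P₁.real {ω | ∀ i, r (rv (v₁ i) ω) = d i} -
        P₂.real {ω | ∀ i, r (rv (v₂ i) ω) = d i}| ≤ δ / Nat.card (α → Fin (K + 1))) →
      dist (ψ.eval v₁ Fin.elim0) (ψ.eval v₂ Fin.elim0) ≤ ε := by
  classical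
  cases nonempty_fintype α
  obtain ⟨δ, hδ0, hδ⟩ := exists_modulus_formula.{v, w} ψ (ε / 2) (half_pos hε)
  refine ⟨δ / 2, half_pos hδ0, ?_⟩
  intro Ω₁ Ω₂ _ _ P₁ P₂ _ _ hP₁ hP₂ K r s hr hrs v₁ v₂ hd
  have hD : ∀ {Ω : Type w} [MeasurableSpace Ω] {P : Measure Ω} [IsProbabilityMeasure P]
      (v : α → RVSpace P), Measurable fun ω i => r (rv (v i) ω) := fun v =>
    measurable_pi_lambda _ fun i => hr.comp (measurable_rv (v i))
  have hset : ∀ {Ω : Type w} [MeasurableSpace Ω] {P : Measure Ω} [IsProbabilityMeasure P]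
      (v : α → RVSpace P) (d : α → Fin (K + 1)),
      (fun ω i => r (rv (v i) ω)) ⁻¹' {d} = {ω | ∀ i, r (rv (v i) ω) = d i} := by
    intro Ω _ P _ v d
    ext ω
    exact funext_iff
  have hround : ∀ {Ω : Type w} [MeasurableSpace Ω] {P : Measure Ω} [IsProbabilityMeasure P]
      (v : α → RVSpace P) (i : α),
      dist (v i) (ofFinite (P := P) (fun d : α → Fin (K + 1) => s (d i)) (hD v)) ≤ δ / 2 := by
    intro Ω _ P _ v i
    refine dist_le_of_ae ?_
    filter_upwards [rv_ofFinite (P := P) (fun d : α → Fin (K + 1) => s (d i)) (hD v)] with ω h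
    rw [h, dist_comm]
    exact hrs _
  obtain ⟨Z, hZ, hZp, hZD⟩ := hP₁.exists_close (hD v₁)
    (fun d => P₂.real {ω | ∀ i, r (rv (v₂ i) ω) = d i}) (fun d => measureReal_nonneg) (by
      simp_rw [← hset v₂]
      rw [← measureReal_biUnion_finset]
      · have : ⋃ d ∈ (Finset.univ : Finset (α → Fin (K + 1))),
            (fun ω i => r (rv (v₂ i) ω)) ⁻¹' {d} = univ := by
          ext ω
          simp
        rw [this, probReal_univ]
      · intro d _ d' _ hdd'
        exact Disjoint.preimage _ (disjoint_singleton.2 hdd')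
      · exact fun d _ => hD v₂ (measurableSet_singleton d))
  have hsum : P₁.real {ω | Z ω ≠ fun i => r (rv (v₁ i) ω)} ≤ δ / 2 := by
    refine hZD.trans ((Finset.sum_le_card_nsmul _ _
      (δ / 2 / Nat.card (α → Fin (K + 1))) fun d _ => ?_).trans_eq ?_)
    · rw [hset]
      exact hd d
    · rw [nsmul_eq_mul, Finset.card_univ, ← Nat.card_eq_fintype_card]
      exact mul_div_cancel₀ _ (Nat.cast_ne_zero.2 Nat.card_pos.ne')
  have hlaw : law (fun i => ofFinite (P := P₁) (fun d : α → Fin (K + 1) => s (d i)) hZ) =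
      law (fun i => ofFinite (P := P₂) (fun d : α → Fin (K + 1) => s (d i)) (hD v₂)) := by
    rw [law_ofFinite, law_ofFinite, map_eq_map_of_real_eq (P₁ := P₁) (P₂ := P₂) hZ (hD v₂)
      fun d => (hZp d).trans (by rw [hset])]
  have h1 := hδ v₁ (fun i => ofFinite (P := P₁) (fun d : α → Fin (K + 1) => s (d i)) hZ)
    Fin.elim0 Fin.elim0 (fun i => ?_) fun j => j.elim0
  · have h2 := hδ v₂ (fun i => ofFinite (P := P₂) (fun d : α → Fin (K + 1) => s (d i)) (hD v₂))
      Fin.elim0 Fin.elim0 (fun i => (hround v₂ i).trans (half_le_self hδ0.le)) fun j => j.elim0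
    rw [eval_elim0_eq_of_law_eq ψ hP₁ hP₂ _ _ hlaw] at h1
    rw [dist_comm] at h2
    linarith [dist_triangle (ψ.eval v₁ Fin.elim0) (ψ.eval (fun i => ofFinite (P := P₂)
      (fun d : α → Fin (K + 1) => s (d i)) (hD v₂)) Fin.elim0) (ψ.eval v₂ Fin.elim0)]
  · have h3 := dist_ofFinite_ofFinite_le (P₁ := P₁) (fun d : α → Fin (K + 1) => s (d i)) hZ (hD v₁)
    rw [dist_comm] at h3
    linarith [dist_triangle (v₁ i)
      (ofFinite (P := P₁) (fun d : α → Fin (K + 1) => s (d i)) (hD v₁))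
      (ofFinite (P := P₁) (fun d : α → Fin (K + 1) => s (d i)) hZ), hround v₁ i]

end Discretize

/-! ### Weak convergence -/

section Weak

variable {Ω : Type*} {𝒜 : MeasurableSpace Ω} [mΩ : MeasurableSpace Ω] {P : Measure Ω}
  [IsProbabilityMeasure P] {n : ℕ}

theorem continuous_integral_weighted {Y : RVSpace P} (hY : AEStronglyMeasurable[𝒜] Y.1 P)
    (θ : C(Fin n → ℝ, I)) :
    Continuous fun μ : CondDist 𝒜 P n => ∫ x, (θ x : ℝ) ∂(weighted μ Y) := by
  simp_rw [← integral_mul_integral]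
  have h : Continuous fun (μ : CondDist 𝒜 P n)
      (p : C(Fin n → ℝ, I) × {Y : RVSpace P // AEStronglyMeasurable[𝒜] Y.1 P}) =>
      ∫ ω, p.2.1.1 ω * (∫ᵛ x, (p.1 x : ℝ) ∂•μ.1) ω ∂P := continuous_induced_dom
  exact continuous_pi_iff.1 h (θ, ⟨Y, hY⟩)

/-- All weighted measures with the same weight `Y` have the total mass `E[Y]`. -/
theorem weighted_real_univ (μ ν : CondDist 𝒜 P n) (Y : RVSpace P) :
    (weighted μ Y).real univ = (weighted ν Y).real univ := by
  rw [weighted_real _ _ .univ, weighted_real _ _ .univ]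
  exact congrArg (pairing Y) (μ.2.2.trans ν.2.2.symm)

/-- The weighted measures of a closed set are upper semicontinuous functions of the distribution. -/
theorem eventually_weighted_real_lt {Y : RVSpace P} (hY : AEStronglyMeasurable[𝒜] Y.1 P)
    (μ₀ : CondDist 𝒜 P n) {F : Set (Fin n → ℝ)} (hF : IsClosed F) {ε : ℝ} (hε : 0 < ε) :
    ∀ᶠ μ in nhds μ₀, (weighted μ Y).real F < (weighted μ₀ Y).real F + ε := by
  have hlim := tendsto_integral_thickenedIndicator_of_isClosed (weighted μ₀ Y) hF
    (δs := fun k : ℕ => 1 / ((k : ℝ) + 1)) (fun k => Nat.one_div_pos_of_nat)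
    tendsto_one_div_add_atTop_nhds_zero_nat
  obtain ⟨k, hk⟩ := (hlim.eventually (gt_mem_nhds (lt_add_of_pos_right _ hε))).exists
  have hpos : (0 : ℝ) < 1 / ((k : ℝ) + 1) := Nat.one_div_pos_of_nat
  let θ : C(Fin n → ℝ, I) := ⟨fun x => ⟨thickenedIndicator hpos F x, NNReal.coe_nonneg _,
    NNReal.coe_le_one.2 (thickenedIndicator_le_one hpos F x)⟩, by fun_prop⟩
  filter_upwards [(continuous_integral_weighted hY θ).continuousAt.eventually (gt_mem_nhds hk)]
    with μ h
  refine lt_of_le_of_lt ?_ h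
  rw [← mul_one ((weighted μ Y).real F), ← smul_eq_mul, ← setIntegral_const,
    ← integral_indicator hF.measurableSet]
  refine integral_mono ((integrable_const _).indicator hF.measurableSet)
    (integrable_thickenedIndicator F hpos) fun x => ?_
  by_cases hx : x ∈ F
  · rw [indicator_of_mem hx]
    change (1 : ℝ) ≤ (thickenedIndicator hpos F x : ℝ)
    rw [thickenedIndicator_one hpos F hx, NNReal.coe_one]
  · rw [indicator_of_notMem hx]
    exact NNReal.coe_nonneg _

/-- Portmanteau for conditional distributions: the weighted measures of a set with null boundary
depend continuously on the distribution. -/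
theorem eventually_abs_weighted_sub_le {Y : RVSpace P} (hY : AEStronglyMeasurable[𝒜] Y.1 P)
    (μ₀ : CondDist 𝒜 P n) {B : Set (Fin n → ℝ)} (hB : MeasurableSet B)
    (h0 : (weighted μ₀ Y).real (frontier B) = 0) {ε : ℝ} (hε : 0 < ε) :
    ∀ᶠ μ in nhds μ₀, |(weighted μ Y).real B - (weighted μ₀ Y).real B| ≤ ε := by
  have hcl : ∀ C, (weighted μ₀ Y).real (frontier C) = 0 →
      (weighted μ₀ Y).real (closure C) ≤ (weighted μ₀ Y).real C := fun C hC => by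
    have := measureReal_union_le (μ := weighted μ₀ Y) C (frontier C)
    rw [← closure_eq_self_union_frontier] at this
    linarith
  have h1 := hcl B h0
  have h2 := hcl Bᶜ (by rwa [frontier_compl])
  filter_upwards [eventually_weighted_real_lt hY μ₀ (isClosed_closure (s := B)) hε,
    eventually_weighted_real_lt hY μ₀ (isClosed_closure (s := Bᶜ)) hε] with μ h3 h4
  have h5 := measureReal_mono (μ := weighted μ Y) (subset_closure (s := B))
  have h6 := measureReal_mono (μ := weighted μ Y) (subset_closure (s := Bᶜ))
  rw [measureReal_compl hB] at h2 h6
  rw [weighted_real_univ μ μ₀] at h6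
  rw [abs_le]
  constructor <;> linarith

end Weak

/-! ### Types depend continuously on distributions -/

section Types

variable {Ω : Type u} [mΩ : MeasurableSpace Ω] {P : Measure Ω} [IsProbabilityMeasure P]
variable {A : Set (RVSpace P)} {n : ℕ}

theorem frontier_iInter_subset {X ι : Type*} [TopologicalSpace X] [Finite ι] (G : ι → Set X) :
    frontier (⋂ i, G i) ⊆ ⋃ i, frontier (G i) := by
  rintro x ⟨hx, hx'⟩
  rw [interior_iInter_of_finite, mem_iInter, not_forall] at hx'
  obtain ⟨i, hi⟩ := hx'
  exact mem_iUnion.2 ⟨i, closure_mono (iInter_subset G i) hx, hi⟩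

theorem countable_atoms (x : RVSpace P) : {t : I | 0 < P (rv x ⁻¹' {t})}.Countable :=
  Measure.countable_meas_pos_of_disjoint_iUnion
    (fun t => measurable_rv x (measurableSet_singleton t))
    fun _ _ h => Disjoint.preimage _ (disjoint_singleton.2 h)

/-- The value of a formula at a tuple depends continuously on the conditional distribution of the
tuple. -/
theorem Represents.eventually_dist_tp_le {N₀ : Extension P} {X₀ : Fin n → RVSpace N₀.P'}
    {μ₀ : CondDist (sigmaAlg A) P n} (h₀ : Represents N₀.emb μ₀ X₀)
    (φ : Formula (A ⊕ Fin n) 0) {ε : ℝ} (hε : 0 < ε) :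
    ∀ᶠ μ in nhds μ₀, ∀ (N : Extension P) (X : Fin n → RVSpace N.P'), Represents N.emb μ X →
      dist (tp A N X φ) (tp A N₀ X₀ φ) ≤ ε := by
  obtain ⟨S, ψ, hS, hψ⟩ := exists_finite_parameters.{u, u} φ
  have := hS.to_subtype
  obtain ⟨δ, hδ0, hδ⟩ := exists_dist_eval_le.{u, u} ψ hε
  -- the cells of the rounding have boundaries without atoms of the law of any `X₀ i`
  obtain ⟨K, r, s, hr, hrs, hfr⟩ := exists_rounding
    (C := ⋃ i, {t : I | 0 < N₀.P' (rv (X₀ i) ⁻¹' {t})})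
    (countable_iUnion fun i => countable_atoms (X₀ i)) hδ0
  let a : S → RVSpace P := fun s => (s : A).1
  have ha : ∀ i, AEStronglyMeasurable[sigmaAlg A] (a i).1 P := fun i =>
    aestronglyMeasurable_of_mem (i : A).2
  let C : (S ⊕ Fin n → Fin (K + 1)) → Set (S → I) := fun d => {z | ∀ i, r (z i) = d (.inl i)}
  have hC : ∀ d, MeasurableSet (C d) := fun d => by
    simp only [C, ofPred_forall]
    exact .iInter fun i => measurableSet_eq_fun (hr.comp (measurable_pi_apply i)) measurable_const
  let G : (S ⊕ Fin n → Fin (K + 1)) → Fin n → Set (Fin n → ℝ) := fun d i =>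
    (fun x => projIcc (0 : ℝ) 1 zero_le_one (x i)) ⁻¹' (r ⁻¹' {d (.inr i)})
  have hGc : ∀ i : Fin n, Continuous fun x : Fin n → ℝ => projIcc (0 : ℝ) 1 zero_le_one (x i) :=
    fun i => continuous_projIcc.comp (continuous_apply i)
  have hB : ∀ d, MeasurableSet (⋂ i, G d i) := fun d =>
    .iInter fun i => (hGc i).measurable (hr (measurableSet_singleton _))
  have hcell : ∀ (N : Extension P) (X : Fin n → RVSpace N.P') (d : S ⊕ Fin n → Fin (K + 1)),
      {ω | ∀ i, r (rv (Sum.elim (fun s : S => N.emb (s : A).1) X i) ω) = d i} =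
        {ω | (fun i => rv (N.emb (a i)) ω) ∈ C d ∧ joint X ω ∈ ⋂ i, G d i} := by
    intro N X d
    ext ω
    simp only [mem_iInter, Sum.forall, Sum.elim_inl, Sum.elim_inr]
    rfl
  -- On the boundary of a cell some `X₀ i` takes one of countably many values that are not atoms.
  have hnull : ∀ d, (weighted μ₀ (indPreimage (hC d) a)).real (frontier (⋂ i, G d i)) = 0 := by
    intro d
    rw [← h₀.real_inter ha (hC d) isClosed_frontier.measurableSet, measureReal_eq_zero_iff]
    refine measure_mono_null (t := ⋃ i, rv (X₀ i) ⁻¹' frontier (r ⁻¹' {d (.inr i)})) ?_ ?_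
    · rintro ω ⟨-, hω⟩
      obtain ⟨i, hi⟩ := mem_iUnion.1 (frontier_iInter_subset _ hω)
      exact mem_iUnion.2 ⟨i, (hGc i).frontier_preimage_subset _ hi⟩
    · refine measure_iUnion_null fun i => ?_
      obtain ⟨h1, h2⟩ := hfr (d (.inr i))
      rw [← biUnion_preimage_singleton, measure_biUnion_null_iff h1]
      intro t ht
      by_contra h
      exact disjoint_left.1 h2 ht (mem_iUnion.2 ⟨i, pos_iff_ne_zero.2 h⟩)
  have hcard : 0 < δ / Nat.card (S ⊕ Fin n → Fin (K + 1)) :=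
    div_pos hδ0 (Nat.cast_pos.2 Nat.card_pos)
  filter_upwards [Filter.eventually_all.2 fun d => eventually_abs_weighted_sub_le
    (aestronglyMeasurable_indPreimage (hC d) ha) μ₀ (hB d) (hnull d) hcard] with μ hμ N X hX
  simp only [tp]
  rw [hψ, hψ]
  refine hδ N.atomless N₀.atomless K r s hr hrs _ _ fun d => ?_
  rw [hcell, hcell, hX.real_inter ha (hC d) (hB d), h₀.real_inter ha (hC d) (hB d)]
  exact hμ d

end Types

/-! ### The type space as a space of distributions -/

section Main

variable {Ω : Type u} [mΩ : MeasurableSpace Ω] {P : Measure Ω} [IsProbabilityMeasure P]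
variable {A : Set (RVSpace P)} {n : ℕ}

/-- All realizations of a type are represented by the same distribution. -/
theorem exists_condDistOn_represents (p : TypeSpace A n) :
    ∃ μ : CondDistOn (sigmaAlg A) P (Icc (0 : Fin n → ℝ) 1),
      ∀ (N : Extension P) (X : Fin n → RVSpace N.P'), tp A N X = p.1 → Represents N.emb μ.1 X := by
  obtain ⟨p, N, X, rfl⟩ := p
  obtain ⟨μ, hμ⟩ := N.emb.lawPreserving.exists_represents A X
  exact ⟨⟨μ, hμ.apply_compl_Icc⟩, fun N' X' h => hμ.of_tp_eq h.symm⟩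

/-- The map `tp(X̄/A) ↦ dist(X̄ | σ(A))`. -/
noncomputable def typeDist (p : TypeSpace A n) :
    CondDistOn (sigmaAlg A) P (Icc (0 : Fin n → ℝ) 1) :=
  (exists_condDistOn_represents p).choose

theorem represents_typeDist {p : TypeSpace A n} {N : Extension P} {X : Fin n → RVSpace N.P'}
    (h : tp A N X = p.1) : Represents N.emb (typeDist p).1 X :=
  (exists_condDistOn_represents p).choose_spec N X h

theorem injective_typeDist : Function.Injective (typeDist (A := A) (n := n)) := by
  rintro ⟨_, N, X, rfl⟩ ⟨_, N', X', rfl⟩ h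
  have h1 := represents_typeDist (p := tpPoint A N X) rfl
  have h2 := represents_typeDist (p := tpPoint A N' X') rfl
  change typeDist (tpPoint A N X) = typeDist (tpPoint A N' X') at h
  rw [← h] at h2
  exact Subtype.ext (h1.tp_eq h2)

theorem surjective_typeDist (hP : Atomless P) :
    Function.Surjective (typeDist (A := A) (n := n)) := by
  intro μ
  obtain ⟨N, X, h⟩ := μ.1.exists_represents hP μ.2
  exact ⟨tpPoint A N X, Subtype.ext
    ((represents_typeDist (p := tpPoint A N X) rfl).unique N.emb.lawPreserving h)⟩

/-- The functions that define the topology of weak convergence are uniform limits of formulas on the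
type space. -/
theorem continuous_typeDist : Continuous (typeDist (A := A) (n := n)) := by
  refine Continuous.subtype_mk (f := fun p => (typeDist p).1) ?_ _
  refine continuous_induced_rng.2 (continuous_pi fun ⟨θ, Y, hY⟩ => ?_)
  refine continuous_of_uniform_approx_of_continuous fun s hs => ?_
  obtain ⟨ε, hε, hεs⟩ := Metric.mem_uniformity_dist.1 hs
  obtain ⟨φ, hφ⟩ := exists_formula_approx hY θ (half_pos hε)
  refine ⟨fun p => (p.1 φ : ℝ), continuous_subtype_val.comp
    ((continuous_apply φ).comp continuous_subtype_val), fun p => hεs ?_⟩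
  obtain ⟨p, N, X, rfl⟩ := p
  have h1 := (represents_typeDist (p := tpPoint A N X) rfl).integral_weighted hY θ
  have h2 := hφ N X
  simp only [Function.comp_apply]
  rw [integral_mul_integral]
  refine lt_of_le_of_lt ?_ (half_lt_self hε)
  rw [dist_comm, Real.dist_eq]
  exact (congrArg (fun t => |(tp A N X φ : ℝ) - t|) h1).trans_le h2

/-- `S_n(A)` is homeomorphic to the space of distributions over `σ(A)` supported by the cube. -/
noncomputable def typeHomeomorph (hP : Atomless P) :
    TypeSpace A n ≃ₜ CondDistOn (sigmaAlg A) P (Icc (0 : Fin n → ℝ) 1) where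
  toEquiv := Equiv.ofBijective typeDist ⟨injective_typeDist, surjective_typeDist hP⟩
  continuous_toFun := continuous_typeDist
  continuous_invFun := by
    refine continuous_induced_rng.2 (continuous_pi fun φ => continuous_iff_continuousAt.2 ?_)
    intro μ₀
    set e := Equiv.ofBijective (typeDist (A := A) (n := n))
      ⟨injective_typeDist, surjective_typeDist hP⟩
    have hrep : ∀ (μ : CondDistOn (sigmaAlg A) P (Icc (0 : Fin n → ℝ) 1)) (N : Extension P)
        (X : Fin n → RVSpace N.P'), tp A N X = (e.symm μ).1 → Represents N.emb μ.1 X := by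
      intro μ N X h
      have h1 := represents_typeDist h
      have h2 : typeDist (e.symm μ) = μ := e.apply_symm_apply μ
      rwa [h2] at h1
    obtain ⟨N₀, X₀, h₀⟩ := (e.symm μ₀).2
    refine Metric.tendsto_nhds.2 fun ε hε => ?_
    filter_upwards [continuous_subtype_val.continuousAt.eventually
      ((hrep μ₀ N₀ X₀ h₀).eventually_dist_tp_le φ (half_pos hε))] with μ hμ
    obtain ⟨N, X, h⟩ := (e.symm μ).2
    have h1 := (hμ N X (hrep μ N X h)).trans_lt (half_lt_self hε)
    rw [h, h₀] at h1
    exact h1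

end Main

end ARV

theorem mainTheorem5 {Ω : Type u} [MeasurableSpace Ω] (P : Measure Ω) [IsProbabilityMeasure P]
    (hP : ARV.Atomless P) (A : Set (ARV.RVSpace P)) (n : ℕ) :
    (∀ (N₁ N₂ : ARV.Extension P) (X₁ : Fin n → ARV.RVSpace N₁.P') (X₂ : Fin n → ARV.RVSpace N₂.P'),
      ARV.tp A N₁ X₁ = ARV.tp A N₂ X₂ →
      ∃ μ : ARV.CondDist (ARV.sigmaAlg A) P n,
        ARV.SameDist μ (ARV.distOver A N₁ X₁) ∧ ARV.SameDist μ (ARV.distOver A N₂ X₂)) ∧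
    ∃ ζ : ARV.TypeSpace A n ≃ₜ
        ARV.CondDistOn (ARV.sigmaAlg A) P (Set.Icc (0 : Fin n → ℝ) 1),
      ∀ (N : ARV.Extension P) (X : Fin n → ARV.RVSpace N.P'),
        ARV.SameDist (ζ (ARV.tpPoint A N X)).1 (ARV.distOver A N X) := by
  refine ⟨fun N₁ N₂ X₁ X₂ h => ?_, ARV.typeHomeomorph hP, fun N X => ?_⟩
  · obtain ⟨μ, hμ⟩ := N₁.emb.lawPreserving.exists_represents A X₁
    exact ⟨μ, (N₁.emb.lawPreserving.represents_iff μ X₁).1 hμ,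
      (N₂.emb.lawPreserving.represents_iff μ X₂).1 (hμ.of_tp_eq h)⟩
  · exact (N.emb.lawPreserving.represents_iff _ X).1
      (ARV.represents_typeDist (p := ARV.tpPoint A N X) rfl)
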